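/- A \emph{class} $\mathcal{C}$ is a class of finite groups closed under isomorphisms, subgroups, quotients and extensions. For a field $K$ with separable closure $K^{sep}$, let $K^c \subseteq K^{sep}$ be the compositum of all finite Galois extensions $L/K$ inside $K^{sep}$ with $Gal(L/K) \in \mathcal{C}$ (so that $Gal(K^c/K)$ is the maximal pro-$\mathcal{C}$ quotient of $Gal(K^{sep}/K)$), and let $\mathcal{C}(K)$ be the set of (finite or infinite) Galois subextensions of $K^c/K$. A valuation ring $\mathcal{O}$ of $K$ (or the corresponding valuation $v$, with residue field $Kv$) is called \emph{$c$-henselian} if there is exactly one valuation ring of $K^c$ lying over it. Two valuation rings of $K$ are \emph{independent} if both are different from $K$ and the smallest valuation ring of $K$ containing both is $K$ itself. The class $\mathcal{C}$ is called \emph{canonical} if the following hold for every field $K$: (L) Let $v$ be a $c$-henselian valuation on $K$, let $w$ be its unique extension to $K^c$, write $Mw$ for the residue field of the restriction of $w$ to a subextension $M$ of $K^c/K$, and assume that $K^cw/Kv$ is separable. Then $K^cw$ is $Kv$-isomorphic to a member of $\mathcal{C}(Kv)$, and for every $E \in \mathcal{C}(Kv)$ there is an $M \in \mathcal{C}(K)$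 (not necessarily unique) such that $Mw$ is isomorphic to $E$ over $Kv$. In particular, if $K^c=K$, then $(Kv)^c = K^cw = Kv$. (S) If $\mathcal{O}_1$ and $\mathcal{O}_2$ are two independent $c$-henselian valuation rings of $K$, then $K=K^c$. (R) If $K^c$ is a finite extension of $K$, then $[K^c:K] \leq 2$. Then the class $\mathcal{C}_{solv}$ of all finite solvable groups is a canonical class. Likewise, for any two primes $p,q$, the class $\mathcal{C}_{p,q}$ of finite $(p,q)$-groups, i.e. groups of order $p^nq^m$ for some $n,m \geq 0$, is a canonical class. -/

import Mathlib

universe u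

noncomputable section

namespace CanonicalClass

open IsLocalRing

/-- A class of groups, given by its membership predicate. -/
abbrev GroupClass : Type (u + 1) := (G : Type u) → [Group G] → Prop

/-- `C` is an (isomorphism-closed) class of finite groups which is closed under subgroups,
quotients and extensions. -/
structure GroupClass.IsClass (C : GroupClass.{u}) : Prop where
  finite : ∀ (G : Type u) [Group G], C G → Finite G
  iso : ∀ (G H : Type u) [Group G] [Group H], (G ≃* H) → C G → C H
  subgroup : ∀ (G : Type u) [Group G] (H : Subgroup G), C G → C H
  quotient : ∀ (G : Type u) [Group G] (N : Subgroup G) [N.Normal], C G → C (G ⧸ N)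
  extension : ∀ (G : Type u) [Group G] (N : Subgroup G) [N.Normal], C N → C (G ⧸ N) → C G

/-- The class of finite solvable groups. -/
def solvClass : GroupClass.{u} := fun G _ => Finite G ∧ Group.IsSolvable G

/-- The class of finite `(p, q)`-groups, i.e. groups of cardinality `p ^ n * q ^ m`.
(`Nat.card` of an infinite group is `0`, so for primes `p`, `q` these groups are finite.) -/
def pqClass (p q : ℕ) : GroupClass.{u} := fun G _ => ∃ n m : ℕ, Nat.card G = p ^ n * q ^ m

/-- The field `K^c`: the compositum, inside the separable closure of `K`, of all finite Galois
extensions of `K` whose Galois group is in `C`. By Galois theory this is the subextension of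
`K^sep` whose Galois group over `K` is the maximal pro-`C` quotient of `G_K`. -/
def cClosure (C : GroupClass.{u}) (K : Type u) [Field K] :
    IntermediateField K (SeparableClosure K) :=
  sSup {L | FiniteDimensional K L ∧ IsGalois K L ∧ C (L ≃ₐ[K] L)}

/-- The set `C(K)` of Galois subextensions (finite or infinite) of `K^c / K`. -/
def subexts (C : GroupClass.{u}) (K : Type u) [Field K] :
    Set (IntermediateField K (cClosure C K)) :=
  {L | IsGalois K L}

section Residue

variable {K L : Type u} [Field K] [Field L] [Algebra K L]

/-- The valuation ring `w` of `L` extends (i.e. lies over) the valuation ring `O` of `K`. -/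
def Extends (O : ValuationSubring K) (w : ValuationSubring L) : Prop :=
  w.comap (algebraMap K L) = O

theorem Extends.mem_iff {O : ValuationSubring K} {w : ValuationSubring L} (h : Extends O w)
    (x : K) : algebraMap K L x ∈ w ↔ x ∈ O := by
  rw [← h]; rfl

/-- The inclusion of valuation rings `O → w`. -/
def Extends.ringHom {O : ValuationSubring K} {w : ValuationSubring L} (h : Extends O w) :
    O →+* w :=
  (algebraMap K L).restrict O w fun x hx => (h.mem_iff x).2 hx

theorem Extends.isLocalHom {O : ValuationSubring K} {w : ValuationSubring L}
    (h : Extends O w) : IsLocalHom h.ringHom := by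
  refine ⟨fun a ha => ?_⟩
  obtain ⟨b, hb⟩ := ha.exists_right_inv
  have hb' : algebraMap K L a * (b : L) = 1 := congrArg Subtype.val hb
  have ha0 : (a : K) ≠ 0 := by
    intro h0
    rw [h0, map_zero, zero_mul] at hb'
    exact zero_ne_one hb'
  have hinv : algebraMap K L ((a : K)⁻¹) = b := by
    rw [map_inv₀]
    exact inv_eq_of_mul_eq_one_right hb'
  have hmem : (a : K)⁻¹ ∈ O := (h.mem_iff _).1 (hinv ▸ b.2)
  exact IsUnit.of_mul_eq_one (⟨(a : K)⁻¹, hmem⟩ : O) (Subtype.ext (mul_inv_cancel₀ ha0))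

/-- The residue field extension `Kv → Lw` induced by an extension of valuation rings. -/
def Extends.residueMap {O : ValuationSubring K} {w : ValuationSubring L} (h : Extends O w) :
    ResidueField O →+* ResidueField w :=
  haveI := h.isLocalHom
  ResidueField.map h.ringHom

/-- `Lw` as an algebra over `Kv`. -/
abbrev Extends.residueAlgebra {O : ValuationSubring K} {w : ValuationSubring L}
    (h : Extends O w) : Algebra (ResidueField O) (ResidueField w) :=
  h.residueMap.toAlgebra

/-- The residue field extension `Lw / Kv` is separable. -/
def Extends.IsSeparable {O : ValuationSubring K} {w : ValuationSubring L}
    (h : Extends O w) : Prop :=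
  letI := h.residueAlgebra
  Algebra.IsSeparable (ResidueField O) (ResidueField w)

/-- `Lw = E` as extensions of `Kv`, i.e. they are isomorphic over `Kv`. (When `E / Kv` is
Galois, this is the same as equality inside any common algebraic closure.) -/
def Extends.ResidueEq {O : ValuationSubring K} {w : ValuationSubring L}
    (h : Extends O w) (E : Type u) [Field E] [Algebra (ResidueField O) E] : Prop :=
  letI := h.residueAlgebra
  Nonempty (ResidueField w ≃ₐ[ResidueField O] E)

/-- The restriction of a valuation ring of `L` to an intermediate field. -/
def restrict (w : ValuationSubring L) (M : IntermediateField K L) : ValuationSubring M :=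
  w.comap (algebraMap M L)

theorem Extends.restrict {O : ValuationSubring K} {w : ValuationSubring L} (h : Extends O w)
    (M : IntermediateField K L) : Extends O (restrict w M) := by
  rw [← h]; rfl

end Residue

/-- `O` is `c`-henselian: it extends uniquely to `K^c`. -/
def IsCHenselian (C : GroupClass.{u}) {K : Type u} [Field K] (O : ValuationSubring K) : Prop :=
  ∃! w : ValuationSubring (cClosure C K), Extends O w

/-- Two valuation rings are independent: both are non-trivial, and the smallest valuation ring
containing both is the whole field. -/
def Independent {K : Type u} [Field K] (O₁ O₂ : ValuationSubring K) : Prop :=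
  O₁ ≠ ⊤ ∧ O₂ ≠ ⊤ ∧ O₁ ⊔ O₂ = ⊤

/-- The lifting property (L) for the field `K`. -/
def LiftingProperty (C : GroupClass.{u}) (K : Type u) [Field K] : Prop :=
  ∀ O : ValuationSubring K, IsCHenselian C O →
    ∀ (w : ValuationSubring (cClosure C K)) (h : Extends O w), h.IsSeparable →
      (∃ E ∈ subexts C (ResidueField O), h.ResidueEq E) ∧
      (∀ E ∈ subexts C (ResidueField O), ∃ M ∈ subexts C K, (h.restrict M).ResidueEq E) ∧
      (cClosure C K = ⊥ →
        Function.Bijective h.residueMap ∧ cClosure C (ResidueField O) = ⊥)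

/-- The independence property (S) for the field `K`. -/
def IndependenceProperty (C : GroupClass.{u}) (K : Type u) [Field K] : Prop :=
  ∀ O₁ O₂ : ValuationSubring K, IsCHenselian C O₁ → IsCHenselian C O₂ →
    Independent O₁ O₂ → cClosure C K = ⊥

/-- The degree bound (R) for the field `K`. -/
def DegreeBound (C : GroupClass.{u}) (K : Type u) [Field K] : Prop :=
  FiniteDimensional K (cClosure C K) → Module.finrank K (cClosure C K) ≤ 2

/-- `C` is a canonical class: a class of finite groups closed under subgroups, quotients and
extensions that satisfies (L), (S) and (R) for every field. -/
structure GroupClass.IsCanonical (C : GroupClass.{u}) : Prop where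
  isClass : C.IsClass
  lifting : ∀ (K : Type u) [Field K], LiftingProperty C K
  independence : ∀ (K : Type u) [Field K], IndependenceProperty C K
  degreeBound : ∀ (K : Type u) [Field K], DegreeBound C K

end CanonicalClass

end

/-! Both classes are instances of `GroupClass.IsClass.isCanonical`: a class that contains the
trivial group and consists of solvable groups is canonical. That (p,q)-groups are solvable is
Burnside's theorem, proved here with complex characters.

Everything about fields is reduced to Galois extensions of prime degree r, where C contains the
groups of order r. Since C is closed under extensions, K^c contains all C-extensions of every field
F between K and K^c (`restrictScalars_le_relClosure`); in particular K^c has no Galois extension of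
such a degree. In characteristic r these extensions are described by Artin–Schreier theory.
Otherwise Kummer theory needs a primitive r-th root of unity ζ, which need not lie in K^c. The
remedy is to use families z_t, t in (Z/r)ˣ, which the Galois group permutes through the cyclotomic
character, and the product `cycloProj` of the z_t with exponents 1/t mod r, on which it acts by that
character modulo r-th powers. An r-th root of this product outside F(ζ) produces a Galois extension
of F itself of degree r (`IsEquivariant.exists_isGalois_finrank_eq`), and every such extension
yields a family whose product is not an r-th power in F(ζ) (`exists_isEquivariant_not_pow`).

(R) If L/F is Galois of degree r and L has no Galois extension of degree r, a norm computation gives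
r = 2 and -1 not a square in F (`eq_two_and_not_sq`). So if K^c/K is finite, every nontrivial
automorphism has a power moving a square root i of -1, hence moves i itself, and the Galois group
acts faithfully on {i, -i}.

(S) If a valuation ring is invariant on Galois extensions of degree r, then families close to 1 have
products that are r-th powers (`IsEquivariant.mem_adjoin_of_valuation_lt`); no Hensel lemma is
available, and a dimension count replaces it. Given two independent rings of this kind, weak
approximation provides, for any family z, a family y such that y is close to 1 for one ring and y/z
for the other. So the product of z is an r-th power too, and degree r does not occur
(`Independent.finrank_ne`).

(L) If a field has no Galois extension of degree r, neither has the residue field of any of its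
valuation rings (`finrank_residueField_ne`), because Artin–Schreier equations and equivariant
families lift. Applied to K^c, and combined with solvability, this shows that (Kv)^c is contained in
the residue field of K^c. Conversely Gal(K^c/K) maps onto the Galois group of that residue field, so
its finite Galois subextensions have groups in C. The two fields therefore agree over Kv, and
subextensions are lifted by pulling back closed subgroups. -/

namespace CanonicalClass

section

open IntermediateField Module

/-! ### Kummer theory without roots of unity in the base field. -/

section Kummer

variable (F : Type*) {Ω : Type*} [Field F] [Field Ω] [Algebra F Ω] {r : ℕ} [Fact r.Prime] {ζ : Ω}

theorem pow_eq_pow_of_natCast_eq {M : Type*} [Monoid M] {x : M} (hx : x ^ r = 1) {m n : ℕ}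
    (h : (m : ZMod r) = n) : x ^ m = x ^ n :=
  pow_eq_pow_of_modEq ((ZMod.natCast_eq_natCast_iff _ _ _).1 h) hx

/-- Families indexed by `(ℤ/r)ˣ` on which the Galois group acts through the cyclotomic character. -/
def IsEquivariant (hζ : IsPrimitiveRoot ζ r) (z : (ZMod r)ˣ → Ω) : Prop :=
  ∀ (σ : Ω ≃ₐ[F] Ω) (t : (ZMod r)ˣ), σ (z t) = z (hζ.autToPow F σ * t)

/-- The projection of an equivariant family to the part of the multiplicative group on which the
Galois group acts like on the `r`-th roots of unity. -/
def cycloProj (z : (ZMod r)ˣ → Ω) : Ω := ∏ t, z t ^ ((t⁻¹ : (ZMod r)ˣ) : ZMod r).val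

theorem cycloProj_ne_zero {z : (ZMod r)ˣ → Ω} (hz : ∀ t, z t ≠ 0) : cycloProj z ≠ 0 :=
  Finset.prod_ne_zero_iff.2 fun t _ => pow_ne_zero _ (hz t)

theorem cycloProj_mul (z z' : (ZMod r)ˣ → Ω) :
    cycloProj (fun t => z t * z' t) = cycloProj z * cycloProj z' := by
  simp_rw [cycloProj, mul_pow, Finset.prod_mul_distrib]

variable {F}

theorem apply_root_eq_pow (hζ : IsPrimitiveRoot ζ r) (σ : Ω ≃ₐ[F] Ω) :
    σ ζ = ζ ^ (hζ.autToPow F σ : ZMod r).val := (hζ.autToPow_spec F σ).symm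

theorem autToPow_eq_one_iff (hζ : IsPrimitiveRoot ζ r) (σ : Ω ≃ₐ[F] Ω) :
    hζ.autToPow F σ = 1 ↔ σ ζ = ζ := by
  have hr : r.Prime := Fact.out
  constructor
  · intro h
    rw [apply_root_eq_pow hζ, h, Units.val_one, ZMod.val_one, pow_one]
  · intro h
    rw [apply_root_eq_pow hζ] at h
    have h1 := hζ.pow_inj (ZMod.val_lt _) hr.one_lt (h.trans (pow_one ζ).symm)
    ext
    rw [Units.val_one]
    exact ZMod.val_injective r (h1.trans (ZMod.val_one r).symm)

/-- An element fixed by all automorphisms fixing `S` lies in `F(S)`. -/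
theorem mem_adjoin_of_fixed [IsGalois F Ω] {S : Set Ω} {x : Ω}
    (h : ∀ σ : Ω ≃ₐ[F] Ω, (∀ s ∈ S, σ s = s) → σ x = x) : x ∈ adjoin F S := by
  rw [← InfiniteGalois.fixedField_fixingSubgroup (adjoin F S), mem_fixedField_iff]
  intro σ hσ
  rw [IntermediateField.mem_fixingSubgroup_iff] at hσ
  exact h σ fun s hs => hσ s (subset_adjoin F S hs)

theorem apply_eq_of_mem_adjoin {S : Set Ω} {x : Ω} (hx : x ∈ adjoin F S) {σ : Ω ≃ₐ[F] Ω}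
    (h : ∀ s ∈ S, σ s = s) : σ x = x := by
  have : adjoin F S ≤ fixedField (Subgroup.zpowers σ) := by
    rw [adjoin_le_iff]
    intro s hs
    rw [SetLike.mem_coe, mem_fixedField_iff]
    intro f hf
    have : Subgroup.zpowers σ ≤ MulAction.stabilizer (Ω ≃ₐ[F] Ω) s := by
      rw [Subgroup.zpowers_le]
      exact h s hs
    exact this hf
  exact (mem_fixedField_iff _ _).1 (this hx) σ (Subgroup.mem_zpowers σ)

theorem IsEquivariant.mem_adjoin [IsGalois F Ω] {hζ : IsPrimitiveRoot ζ r} {z : (ZMod r)ˣ → Ω}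
    (hz : IsEquivariant F hζ z) (t : (ZMod r)ˣ) : z t ∈ F⟮ζ⟯ := by
  refine mem_adjoin_of_fixed fun σ hσ => ?_
  rw [hz, (autToPow_eq_one_iff hζ σ).2 (hσ ζ rfl), one_mul]

/-- The Galois group acts on `cycloProj z` through the cyclotomic character, up to `r`-th powers. -/
theorem IsEquivariant.exists_apply_cycloProj [IsGalois F Ω] {hζ : IsPrimitiveRoot ζ r}
    {z : (ZMod r)ˣ → Ω} (hz : IsEquivariant F hζ z) (h0 : ∀ t, z t ≠ 0) (σ : Ω ≃ₐ[F] Ω) :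
    ∃ u ∈ F⟮ζ⟯, u ≠ 0 ∧
      σ (cycloProj z) = cycloProj z ^ (hζ.autToPow F σ : ZMod r).val * u ^ r := by
  set s := hζ.autToPow F σ with hs
  -- Reindexing the product by `s` turns the exponent at t into a representative of s/t. It differs
  -- from the product of the representatives of s and 1/t by a multiple of r, possibly negative, and
  -- these multiples make up the factor u ^ r.
  have key : ∀ t : (ZMod r)ˣ, ∃ k : ℤ, ((((s⁻¹ * t)⁻¹ : (ZMod r)ˣ) : ZMod r).val : ℤ) =
      (s : ZMod r).val * ((t⁻¹ : (ZMod r)ˣ) : ZMod r).val + r * k := by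
    intro t
    have : ((((s⁻¹ * t)⁻¹ : (ZMod r)ˣ) : ZMod r).val : ℤ) ≡
      (s : ZMod r).val * ((t⁻¹ : (ZMod r)ˣ) : ZMod r).val [ZMOD r] := by
      rw [← ZMod.intCast_eq_intCast_iff]
      simp only [Int.cast_mul, Int.cast_natCast, ZMod.natCast_zmod_val, ← Units.val_mul,
        mul_inv_rev, inv_inv, mul_comm]
    obtain ⟨k, hk⟩ := (Int.modEq_iff_dvd.1 this.symm)
    exact ⟨k, by rw [← hk]; ring⟩
  choose k hk using key
  refine ⟨∏ t, z t ^ k t, prod_mem fun t _ => zpow_mem (hz.mem_adjoin t) _,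
    Finset.prod_ne_zero_iff.2 fun t _ => zpow_ne_zero _ (h0 t), ?_⟩
  have h1 : σ (cycloProj z) = ∏ t, z t ^ (((s⁻¹ * t)⁻¹ : (ZMod r)ˣ) : ZMod r).val := by
    rw [cycloProj, map_prod]
    refine Fintype.prod_equiv (Equiv.mulLeft s) _ _ fun t => ?_
    rw [map_pow, hz, ← hs, Equiv.coe_mulLeft, inv_mul_cancel_left]
  rw [h1, cycloProj, ← Finset.prod_pow, ← Finset.prod_pow, ← Finset.prod_mul_distrib]
  refine Finset.prod_congr rfl fun t _ => ?_
  rw [← zpow_natCast, hk, zpow_add₀ (h0 t), zpow_mul', mul_comm (r : ℤ), zpow_mul]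
  simp only [zpow_natCast]

omit [Fact r.Prime] in
theorem isGalois_of_forall_map_le [IsGalois F Ω] {E : IntermediateField F Ω}
    (h : ∀ σ : Ω ≃ₐ[F] Ω, ∀ x ∈ E, σ x ∈ E) : IsGalois F E := by
  have : Normal F E := by
    rw [normal_iff_forall_map_le']
    rintro σ _ ⟨x, hx, rfl⟩
    exact h σ x hx
  exact ⟨⟩

omit [Fact r.Prime] in
theorem isGalois_adjoin [IsGalois F Ω] {S : Set Ω}
    (h : ∀ σ : Ω ≃ₐ[F] Ω, ∀ s ∈ S, σ s ∈ adjoin F S) : IsGalois F (adjoin F S) := by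
  refine isGalois_of_forall_map_le fun σ x hx => ?_
  have : adjoin F S ≤ (adjoin F S).comap (σ : Ω →ₐ[F] Ω) := adjoin_le_iff.2 fun s hs => h σ s hs
  exact this hx

/-- The order of the kernel is prime to its index, which is smaller than r, so Schur–Zassenhaus
gives a complement. The kernel is central, hence normalizes the complement, which is therefore
normal. -/
theorem exists_normal_index_eq {G A : Type*} [Group G] [Finite G] [Group A] (χ : G →* A)
    (hcard : Nat.card χ.ker = r) (hrange : Nat.card χ.range < r)
    (hcentral : χ.ker ≤ Subgroup.center G) :
    ∃ H : Subgroup G, H.Normal ∧ H.index = r ∧ Nat.card H < r := by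
  have hr : r.Prime := Fact.out
  have hidx : χ.ker.index = Nat.card χ.range := Subgroup.index_ker χ
  have hcop : Nat.Coprime (Nat.card χ.ker) χ.ker.index := by
    rw [hcard, hidx, hr.coprime_iff_not_dvd]
    have : 0 < χ.ker.index := Nat.pos_of_ne_zero Subgroup.FiniteIndex.index_ne_zero
    exact Nat.not_dvd_of_pos_of_lt (hidx ▸ this) hrange
  obtain ⟨H, hH⟩ := Subgroup.exists_left_complement'_of_coprime hcop
  refine ⟨H, ?_, ?_, ?_⟩
  · rw [← Subgroup.normalizer_eq_top_iff, eq_top_iff, ← hH.sup_eq_top, sup_le_iff]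
    refine ⟨Subgroup.le_normalizer, hcentral.trans ?_⟩
    intro g hg
    rw [Subgroup.mem_normalizer_iff]
    intro h
    rw [← Subgroup.mem_center_iff.1 hg h, mul_inv_cancel_right]
  · rw [← hcard]
    exact hH.symm.index_eq_card
  · rw [← hH.index_eq_card, hidx]
    exact hrange

/-- A root `β ^ r = cycloProj z` outside of `F(ζ)` generates, over `F(ζ)`, the compositum of `F(ζ)`
with a Galois extension of `F` of degree `r`. -/
theorem IsEquivariant.exists_isGalois_finrank_eq [IsGalois F Ω] {hζ : IsPrimitiveRoot ζ r}
    {z : (ZMod r)ˣ → Ω} (hz : IsEquivariant F hζ z) (h0 : ∀ t, z t ≠ 0) {β : Ω}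
    (hβ : β ^ r = cycloProj z) (hβF : β ∉ F⟮ζ⟯) :
    ∃ E : IntermediateField F Ω, E ≤ F⟮ζ, β⟯ ∧ FiniteDimensional F F⟮ζ, β⟯ ∧ IsGalois F E ∧
      finrank F E = r ∧ finrank F F⟮ζ, β⟯ < r * r := by
  have hr : r.Prime := Fact.out
  have hβ0 : β ≠ 0 := by
    rintro rfl
    exact cycloProj_ne_zero h0 (by rw [← hβ, zero_pow hr.ne_zero])
  have hζ0 : ζ ≠ 0 := hζ.ne_zero hr.ne_zero
  have hζN : ζ ∈ F⟮ζ, β⟯ := subset_adjoin F _ (by simp)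
  have hβN : β ∈ F⟮ζ, β⟯ := subset_adjoin F _ (by simp)
  have hle : F⟮ζ⟯ ≤ F⟮ζ, β⟯ := adjoin_le_iff.2 (by simpa using hζN)
  -- the action on `β`
  have hact : ∀ σ : Ω ≃ₐ[F] Ω, ∃ u ∈ F⟮ζ⟯, σ β = u * β ^ (hζ.autToPow F σ : ZMod r).val := by
    intro σ
    obtain ⟨u, hu, hu0, h⟩ := hz.exists_apply_cycloProj h0 σ
    have h1 : (σ β / (β ^ (hζ.autToPow F σ : ZMod r).val * u)) ^ r = 1 := by
      rw [div_pow, ← map_pow, hβ, h, mul_pow, ← pow_mul, mul_comm _ r, pow_mul, hβ, div_self]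
      exact mul_ne_zero (pow_ne_zero _ (cycloProj_ne_zero h0)) (pow_ne_zero _ hu0)
    obtain ⟨i, -, hi⟩ := hζ.eq_pow_of_pow_eq_one h1
    refine ⟨ζ ^ i * u, mul_mem (pow_mem (mem_adjoin_simple_self F ζ) i) hu, ?_⟩
    rw [eq_div_iff (mul_ne_zero (pow_ne_zero _ hβ0) hu0)] at hi
    rw [← hi]
    ring
  have hGal : IsGalois F F⟮ζ, β⟯ := by
    refine isGalois_adjoin fun σ s hs => ?_
    rcases hs with rfl | rfl
    · rw [apply_root_eq_pow hζ]
      exact pow_mem hζN _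
    · obtain ⟨u, hu, h⟩ := hact σ
      rw [h]
      exact mul_mem (hle hu) (pow_mem hβN _)
  have hfin : FiniteDimensional F F⟮ζ, β⟯ :=
    finiteDimensional_adjoin fun x _ => Algebra.IsSeparable.isIntegral F x
  set N := F⟮ζ, β⟯ with hN
  have hζ' : IsPrimitiveRoot (⟨ζ, hζN⟩ : N) r := by
    rw [← IsPrimitiveRoot.map_iff_of_injective (f := N.val) N.val.injective]
    exact hζ
  have hR : ∀ (ρ : Ω ≃ₐ[F] Ω) (x : N), ((AlgEquiv.restrictNormalHom N ρ x : N) : Ω) = ρ x :=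
    fun ρ x => AlgEquiv.restrictNormal_commutes ρ N x
  have hsurj : Function.Surjective (AlgEquiv.restrictNormalHom (F := F) (K₁ := Ω) N) :=
    AlgEquiv.restrictNormalHom_surjective Ω
  have hext : ∀ σ τ : Ω ≃ₐ[F] Ω, σ ζ = τ ζ → σ β = τ β →
      AlgEquiv.restrictNormalHom N σ = AlgEquiv.restrictNormalHom N τ := by
    intro σ τ h1 h2
    ext x
    rw [hR, hR]
    have h3 : (τ⁻¹ * σ) (x : Ω) = x := by
      refine apply_eq_of_mem_adjoin x.2 fun s hs => ?_
      rw [AlgEquiv.mul_apply, AlgEquiv.aut_inv, AlgEquiv.symm_apply_eq]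
      rcases hs with rfl | rfl
      · exact h1
      · exact h2
    rwa [AlgEquiv.mul_apply, AlgEquiv.aut_inv, AlgEquiv.symm_apply_eq] at h3
  set χ := hζ'.autToPow F
  have hker : ∀ σ : Ω ≃ₐ[F] Ω, AlgEquiv.restrictNormalHom N σ ∈ χ.ker ↔ σ ζ = ζ := by
    intro σ
    rw [MonoidHom.mem_ker, autToPow_eq_one_iff, ← Subtype.coe_inj, hR]
  have hkerβ : ∀ σ : Ω ≃ₐ[F] Ω, σ ζ = ζ → ∃ i < r, σ β = ζ ^ i * β := by
    intro σ hσ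
    obtain ⟨u, hu, hu'⟩ := hact σ
    have h1 : (σ β / β) ^ r = 1 := by
      have : cycloProj z ∈ F⟮ζ⟯ := prod_mem fun t _ => pow_mem (hz.mem_adjoin t) _
      rw [div_pow, ← map_pow, hβ, apply_eq_of_mem_adjoin this (by simpa using hσ),
        div_self (cycloProj_ne_zero h0)]
    obtain ⟨i, hi, h⟩ := hζ.eq_pow_of_pow_eq_one h1
    exact ⟨i, hi, by rw [h, div_mul_cancel₀ _ hβ0]⟩
  -- This is what the exponents in `cycloProj` are chosen for: an element of the kernel multiplies β
  -- by a power of ζ, and any automorphism raises ζ and, up to a factor in F(ζ), also β to the same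
  -- power.
  have hcentral : χ.ker ≤ Subgroup.center (N ≃ₐ[F] N) := by
    intro n hn
    obtain ⟨n, rfl⟩ := hsurj n
    rw [hker] at hn
    obtain ⟨i, -, hi⟩ := hkerβ n hn
    rw [Subgroup.mem_center_iff]
    intro g
    obtain ⟨g, rfl⟩ := hsurj g
    rw [← map_mul, ← map_mul]
    obtain ⟨u, hu, hgβ⟩ := hact g
    refine hext _ _ ?_ ?_
    · rw [AlgEquiv.mul_apply, AlgEquiv.mul_apply, hn, apply_root_eq_pow hζ g, map_pow, hn]
    · rw [AlgEquiv.mul_apply, AlgEquiv.mul_apply, hi, map_mul, hgβ, map_mul, map_pow, map_pow, hi,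
        apply_root_eq_pow hζ g, apply_eq_of_mem_adjoin hu (by simpa using hn)]
      ring
  have hcard : Nat.card χ.ker = r := by
    apply le_antisymm
    · have : ∀ n : χ.ker, ∃ i : Fin r, ((n : N ≃ₐ[F] N) ⟨β, hβN⟩ : Ω) = ζ ^ (i : ℕ) * β := by
        rintro ⟨n, hn⟩
        obtain ⟨n, rfl⟩ := hsurj n
        obtain ⟨i, hi, h⟩ := hkerβ n ((hker n).1 hn)
        exact ⟨⟨i, hi⟩, by rw [hR, h]⟩
      choose i hi using this
      have hinj : Function.Injective i := by
        intro a b hab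
        have h1 := hi a
        have h2 := hi b
        rw [hab, ← h2] at h1
        obtain ⟨a, ha⟩ := a
        obtain ⟨b, hb⟩ := b
        obtain ⟨a, rfl⟩ := hsurj a
        obtain ⟨b, rfl⟩ := hsurj b
        simp only [hR] at h1
        exact Subtype.ext (hext a b (by rw [(hker a).1 ha, (hker b).1 hb]) h1)
      simpa using Nat.card_le_card_of_injective i hinj
    · obtain ⟨σ, hσ, hσβ⟩ : ∃ σ : Ω ≃ₐ[F] Ω, σ ζ = ζ ∧ σ β ≠ β := by
        by_contra! h
        exact hβF (mem_adjoin_of_fixed fun σ hσ => h σ (hσ ζ rfl))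
      obtain ⟨i, -, hi⟩ := hkerβ σ hσ
      have hpow : ∀ k : ℕ, (σ ^ k) ζ = ζ ∧ (σ ^ k) β = ζ ^ (i * k) * β := by
        intro k
        induction k with
        | zero => simp
        | succ k ih =>
          rw [pow_succ', AlgEquiv.mul_apply, AlgEquiv.mul_apply, ih.1, ih.2, map_mul, map_pow, hσ,
            hi]
          exact ⟨rfl, by ring⟩
      let g : χ.ker := ⟨AlgEquiv.restrictNormalHom N σ, (hker σ).2 hσ⟩
      have hg : orderOf g = r := by
        refine orderOf_eq_prime ?_ ?_
        · refine Subtype.ext ?_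
          change (AlgEquiv.restrictNormalHom N σ) ^ r = 1
          rw [← map_pow, ← map_one (AlgEquiv.restrictNormalHom (F := F) (K₁ := Ω) N)]
          refine hext _ _ (hpow r).1 ?_
          rw [(hpow r).2, mul_comm i, pow_mul, hζ.pow_eq_one, one_pow, one_mul]
          rfl
        · intro h
          have := congrArg (fun h : χ.ker => (((h : N ≃ₐ[F] N) ⟨β, hβN⟩ : N) : Ω)) h
          simp only [g, hR] at this
          exact hσβ this
      have hdvd := orderOf_dvd_natCard g
      rw [hg] at hdvd
      exact Nat.le_of_dvd Nat.card_pos hdvd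
  have hrange : Nat.card χ.range < r := by
    refine (Subgroup.card_le_card_group _).trans_lt ?_
    rw [Nat.card_eq_fintype_card, ZMod.card_units]
    exact Nat.sub_lt hr.pos one_pos
  -- E is the fixed field of the complement. Its index gives the degree r, and its order, less than
  -- r, gives the bound on the degree of F(ζ, β).
  obtain ⟨H, hH, hidx, hHcard⟩ := exists_normal_index_eq χ hcard hrange hcentral
  have hHN : finrank (fixedField H) N = Nat.card H := finrank_fixedField_eq_card H
  have hmul : finrank F (fixedField H) * finrank (fixedField H) N = finrank F N :=
    finrank_mul_finrank F (fixedField H) N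
  have hFN : finrank F N = r * Nat.card H := by
    rw [← IsGalois.card_aut_eq_finrank, ← hidx, mul_comm]
    exact (Subgroup.card_mul_index H).symm
  have hFE : finrank F (fixedField H) = r := by
    rw [hHN, hFN] at hmul
    exact Nat.eq_of_mul_eq_mul_right Nat.card_pos hmul
  have := IsGalois.of_fixedField_normal_subgroup H
  refine ⟨lift (fixedField H), lift_le _, hfin,
    IsGalois.of_algEquiv (liftAlgEquiv (fixedField H)), ?_, ?_⟩
  · rw [← (liftAlgEquiv (fixedField H)).toLinearEquiv.finrank_eq, hFE]
  · rw [hFN]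
    exact Nat.mul_lt_mul_of_pos_left hHcard hr.pos

end Kummer

end

section

open IntermediateField Module

/-! ### Lagrange resolvents, and Galois extensions whose top field has none of the same prime
degree. -/

section Resolvent

variable {F Ω : Type*} [Field F] [Field Ω] [Algebra F Ω] {r : ℕ} [Fact r.Prime] {ζ : Ω}

/-- Pigeonhole: Gal(L/F) has r elements and the cyclotomic character only r - 1 values, so two
different elements have lifts with the same character, and their quotient does the job. -/
theorem exists_apply_root_eq_and_ne [IsGalois F Ω] (hζ : IsPrimitiveRoot ζ r)
    (L : IntermediateField F Ω) [IsGalois F L] (hL : finrank F L = r) :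
    ∃ σ : Ω ≃ₐ[F] Ω, σ ζ = ζ ∧ ∃ x ∈ L, σ x ≠ x := by
  have hr : r.Prime := Fact.out
  have : FiniteDimensional F L := finite_of_finrank_pos (hL ▸ hr.pos)
  have hsurj : Function.Surjective (AlgEquiv.restrictNormalHom (F := F) (K₁ := Ω) L) :=
    AlgEquiv.restrictNormalHom_surjective Ω
  choose s hs using hsurj
  have hcard : Nat.card (ZMod r)ˣ < Nat.card (L ≃ₐ[F] L) := by
    rw [IsGalois.card_aut_eq_finrank, hL, Nat.card_eq_fintype_card, ZMod.card_units]
    exact Nat.sub_lt hr.pos one_pos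
  obtain ⟨g, h, hgh, hχ⟩ : ∃ g h, g ≠ h ∧ hζ.autToPow F (s g) = hζ.autToPow F (s h) := by
    by_contra! hc
    refine hcard.not_ge (Nat.card_le_card_of_injective (fun g => hζ.autToPow F (s g)) ?_)
    intro g h hgh
    by_contra hne
    exact hc g h hne hgh
  refine ⟨(s h)⁻¹ * s g, ?_, ?_⟩
  · rw [← autToPow_eq_one_iff hζ, map_mul, map_inv, hχ, inv_mul_cancel]
  · by_contra! hc
    refine hgh ?_
    rw [← hs g, ← hs h]
    ext x
    have := hc x x.2
    rw [AlgEquiv.mul_apply, AlgEquiv.aut_inv, AlgEquiv.symm_apply_eq] at this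
    exact ((AlgEquiv.restrictNormal_commutes (s g) L x).trans this).trans
      (AlgEquiv.restrictNormal_commutes (s h) L x).symm

/-- Lagrange resolvents of a Galois extension of prime degree. -/
theorem exists_resolvents [IsGalois F Ω] (hζ : IsPrimitiveRoot ζ r)
    (L : IntermediateField F Ω) [IsGalois F L] (hL : finrank F L = r) :
    ∃ (σ₀ : Ω ≃ₐ[F] Ω) (j : (ZMod r)ˣ) (b : (ZMod r)ˣ → Ω),
      σ₀ ζ = ζ ∧ (∀ x ∈ L, (σ₀ ^ r) x = x) ∧
      (∀ t, σ₀ (b t) = ζ ^ ((j * t : (ZMod r)ˣ) : ZMod r).val * b t) ∧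
      (∀ τ : Ω ≃ₐ[F] Ω, (∀ x ∈ L, τ x = x) → ∀ t, τ (b t) = b (hζ.autToPow F τ * t)) ∧
      (∀ (σ : Ω ≃ₐ[F] Ω) (t), σ (b t) ^ r = b (hζ.autToPow F σ * t) ^ r) ∧
      ∀ t ∈ (hζ.autToPow F).range, b t ≠ 0 := by
  have hr : r.Prime := Fact.out
  have : FiniteDimensional F L := finite_of_finrank_pos (hL ▸ hr.pos)
  obtain ⟨σ₀, hσ₀, x, hx, hσx⟩ := exists_apply_root_eq_and_ne hζ L hL
  have hR : ∀ (ρ : Ω ≃ₐ[F] Ω) (x : L), ((AlgEquiv.restrictNormalHom L ρ x : L) : Ω) = ρ x :=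
    fun ρ x => AlgEquiv.restrictNormal_commutes ρ L x
  have hcardL : Nat.card (L ≃ₐ[F] L) = r := by rw [IsGalois.card_aut_eq_finrank, hL]
  have hne : AlgEquiv.restrictNormalHom L σ₀ ≠ 1 := by
    intro h
    apply hσx
    have := hR σ₀ ⟨x, hx⟩
    rw [h] at this
    exact this.symm
  have hpowr : ∀ y ∈ L, (σ₀ ^ r) y = y := by
    intro y hy
    have := hR (σ₀ ^ r) ⟨y, hy⟩
    rw [map_pow, ← hcardL, pow_card_eq_one'] at this
    rw [← hcardL]
    exact this.symm
  have hgen : ∀ σ : Ω ≃ₐ[F] Ω, ∃ m : ℕ, ∀ y ∈ L, σ y = (σ₀ ^ m) y := by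
    intro σ
    obtain ⟨m, hm⟩ := mem_powers_of_prime_card (p := r) hcardL
      (g' := AlgEquiv.restrictNormalHom L σ) hne
    refine ⟨m, fun y hy => ?_⟩
    have h1 := hR σ ⟨y, hy⟩
    have h2 := hR (σ₀ ^ m) ⟨y, hy⟩
    rw [map_pow] at h2
    simp only at hm
    rw [hm] at h2
    rw [← h1, h2]
  have hLmem : ∀ (σ : Ω ≃ₐ[F] Ω), ∀ y ∈ L, σ y ∈ L := by
    intro σ y hy
    rw [← hR σ ⟨y, hy⟩]
    exact Subtype.property _
  -- the conjugates of `x`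
  let c : ZMod r → Ω := fun i => (σ₀ ^ i.val) x
  have hc : ∀ n : ℕ, (σ₀ ^ n) x = c n := by
    intro n
    change (σ₀ ^ n) x = (σ₀ ^ (n : ZMod r).val) x
    rw [ZMod.val_natCast]
    conv_lhs => rw [← Nat.mod_add_div n r, pow_add, pow_mul, AlgEquiv.mul_apply]
    congr 1
    generalize n / r = k
    induction k with
    | zero => rfl
    | succ k ih => rw [pow_succ, AlgEquiv.mul_apply, hpowr x hx, ih]
  have hσc : ∀ (σ : Ω ≃ₐ[F] Ω) (m : ℕ), (∀ y ∈ L, σ y = (σ₀ ^ m) y) → ∀ i, σ (c i) = c (i + m) := by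
    intro σ m h i
    rw [h _ (hLmem _ _ hx), ← AlgEquiv.mul_apply, ← pow_add, hc]
    push_cast
    rw [ZMod.natCast_zmod_val, add_comm]
  let ψ := AddChar.zmodChar r hζ.pow_eq_one
  have hψ : ψ.IsPrimitive := AddChar.zmodChar_primitive_of_primitive_root r hζ
  have hσψ : ∀ (σ : Ω ≃ₐ[F] Ω) a, σ (ψ a) = ψ ((hζ.autToPow F σ : ZMod r) * a) := by
    intro σ a
    change σ (ζ ^ a.val) = ζ ^ _
    rw [map_pow, apply_root_eq_pow hζ, ← pow_mul]
    refine pow_eq_pow_of_natCast_eq (r := r) hζ.pow_eq_one ?_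
    simp
  -- The discrete Fourier transform of the conjugates of x; σ₀ shifts the conjugates and so
  -- multiplies ρ s by ψ s.
  let ρ : ZMod r → Ω := fun s => ∑ i, ψ (-(i * s)) * c i
  have hσρ : ∀ (σ : Ω ≃ₐ[F] Ω) (m : ℕ), (∀ y ∈ L, σ y = (σ₀ ^ m) y) → ∀ s,
      σ (ρ s) = ψ ((hζ.autToPow F σ : ZMod r) * m * s) * ρ ((hζ.autToPow F σ : ZMod r) * s) := by
    intro σ m h s
    simp only [ρ]
    rw [map_sum, Finset.mul_sum]
    refine Fintype.sum_equiv (Equiv.addRight (m : ZMod r)) _ _ fun i => ?_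
    rw [map_mul, hσψ, hσc σ m h, Equiv.coe_addRight, ← mul_assoc, ← AddChar.map_add_eq_mul]
    congr 2
    ring
  have hσ₀ρ : ∀ s, σ₀ (ρ s) = ψ s * ρ s := by
    intro s
    rw [hσρ σ₀ 1 (by simp), (autToPow_eq_one_iff hζ σ₀).2 hσ₀]
    simp
  -- If ρ vanished off 0, Fourier inversion would give ρ 0 = r x. But σ₀ fixes ρ 0 and moves x.
  obtain ⟨j, hj, hρj⟩ : ∃ j, j ≠ 0 ∧ ρ j ≠ 0 := by
    by_contra! h
    have h1 : ∑ s, ρ s = r * x := by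
      simp only [ρ]
      rw [Finset.sum_comm]
      simp_rw [← Finset.sum_mul]
      have : ∀ i : ZMod r, ∑ s, ψ (-(i * s)) = if i = 0 then (r : Ω) else 0 := by
        intro i
        have := AddChar.sum_mulShift (-i) hψ
        rw [ZMod.card] at this
        simp only [neg_eq_zero] at this
        rw [Nat.cast_ite, Nat.cast_zero] at this
        rw [← this]
        exact Finset.sum_congr rfl fun s _ => by congr 1; ring
      simp_rw [this, ite_mul, zero_mul]
      rw [Finset.sum_ite_eq' Finset.univ (0 : ZMod r), if_pos (Finset.mem_univ _)]
      simp [c]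
    rw [Finset.sum_eq_single 0 (fun s _ hs => h s hs) (by simp)] at h1
    have h2 := hσ₀ρ 0
    rw [AddChar.map_zero_eq_one, one_mul, h1, map_mul, map_natCast] at h2
    have : NeZero (r : Ω) := hζ.neZero'
    exact hσx (mul_left_cancel₀ (NeZero.ne _) h2)
  have hψr : ∀ a, ψ a ^ r = 1 := by
    intro a
    rw [← AddChar.map_nsmul_eq_pow]
    simp
  refine ⟨σ₀, Units.mk0 j hj, fun t => ρ (j * t), hσ₀, hpowr, fun t => hσ₀ρ _, ?_, ?_, ?_⟩
  · intro τ hτ t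
    dsimp only
    rw [hσρ τ 0 (by simpa using hτ)]
    simp only [Nat.cast_zero, mul_zero, zero_mul, AddChar.map_zero_eq_one, one_mul, Units.val_mul]
    congr 1
    ring
  · intro σ t
    obtain ⟨m, hm⟩ := hgen σ
    dsimp only
    rw [hσρ σ m hm, mul_pow, hψr, one_mul, Units.val_mul]
    congr 2
    ring
  · rintro _ ⟨σ, rfl⟩ h
    obtain ⟨m, hm⟩ := hgen σ
    have := hσρ σ m hm j
    dsimp only at h
    rw [mul_comm j] at h
    rw [h, mul_zero, map_eq_zero] at this
    exact hρj this

/-- Nonzero elements `z t` with `z t ^ r` equivariant over `F`, such that `z` is equivariant over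
`L`, and whose projection is moved by an automorphism fixing `ζ`. -/
theorem exists_resolvent_family [IsGalois F Ω] (hζ : IsPrimitiveRoot ζ r)
    (L : IntermediateField F Ω) [IsGalois F L] (hL : finrank F L = r) :
    ∃ (σ₀ : Ω ≃ₐ[F] Ω) (ω : Ω) (z : (ZMod r)ˣ → Ω),
      σ₀ ζ = ζ ∧ (∀ x ∈ L, (σ₀ ^ r) x = x) ∧ σ₀ (cycloProj z) = ω * cycloProj z ∧
      IsPrimitiveRoot ω r ∧ σ₀ ω = ω ∧ (∀ t, z t ≠ 0) ∧
      IsEquivariant L hζ z ∧ IsEquivariant F hζ fun t => z t ^ r := by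
  classical
  have hr : r.Prime := Fact.out
  obtain ⟨σ₀, j, b, hσ₀, hpow, hσb, hLb, hFb, hb0⟩ := exists_resolvents hζ L hL
  set R := (hζ.autToPow F).range
  let s : Finset (ZMod r)ˣ := Finset.univ.filter (· ∈ R)
  have hmem : ∀ (σ : Ω ≃ₐ[F] Ω) t, hζ.autToPow F σ * t ∈ R ↔ t ∈ R := fun σ t =>
    Subgroup.mul_mem_cancel_left R ⟨σ, rfl⟩
  -- The resolvents are known to be nonzero only on the image R of the cyclotomic character. Since R
  -- is stable under translation by itself, setting the family to 1 elsewhere preserves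
  -- equivariance. Each factor indexed by R is multiplied by ζ ^ j under σ₀, as (j t) / t = j, so ω
  -- = ζ ^ (j |R|); this is primitive because 0 < |R| < r.
  refine ⟨σ₀, ζ ^ ((j : ZMod r).val * s.card), fun t => if t ∈ R then b t else 1, hσ₀, hpow, ?_, ?_,
    by rw [map_pow, hσ₀], ?_, ?_, ?_⟩
  · have h1 : ∀ t, σ₀ ((if t ∈ R then b t else 1) ^ ((t⁻¹ : (ZMod r)ˣ) : ZMod r).val) =
        (if t ∈ s then ζ ^ (j : ZMod r).val else 1) *
          (if t ∈ R then b t else 1) ^ ((t⁻¹ : (ZMod r)ˣ) : ZMod r).val := by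
      intro t
      by_cases ht : t ∈ R
      · rw [if_pos ht, if_pos (by simpa [s] using ht), map_pow, hσb, mul_pow, ← pow_mul]
        congr 1
        refine pow_eq_pow_of_natCast_eq (r := r) hζ.pow_eq_one ?_
        rw [Nat.cast_mul, ZMod.natCast_zmod_val, ZMod.natCast_zmod_val, ZMod.natCast_zmod_val,
          ← Units.val_mul, mul_inv_cancel_right]
      · rw [if_neg ht, if_neg (by simpa [s] using ht), one_pow, map_one, one_mul]
    rw [cycloProj, map_prod, Finset.prod_congr rfl fun t _ => h1 t, Finset.prod_mul_distrib,
      Finset.prod_ite_mem, Finset.univ_inter, Finset.prod_const, ← pow_mul]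
  · refine hζ.pow_of_coprime _ ?_
    rw [Nat.coprime_comm, hr.coprime_iff_not_dvd, hr.dvd_mul, not_or]
    constructor
    · rw [← ZMod.natCast_eq_zero_iff, ZMod.natCast_zmod_val]
      exact j.ne_zero
    · refine Nat.not_dvd_of_pos_of_lt ?_ ?_
      · exact Finset.card_pos.2 ⟨1, by simp [s, one_mem]⟩
      · refine (Finset.card_le_univ s).trans_lt ?_
        rw [ZMod.card_units]
        exact Nat.sub_lt hr.pos one_pos
  · intro t
    dsimp only
    split_ifs with ht
    · exact hb0 t ht
    · exact one_ne_zero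
  · intro τ t
    have h1 : hζ.autToPow L τ = hζ.autToPow F (τ.restrictScalars F) := by
      ext
      refine ZMod.val_injective r (hζ.pow_inj (ZMod.val_lt _) (ZMod.val_lt _) ?_)
      rw [← apply_root_eq_pow, ← apply_root_eq_pow]
      rfl
    dsimp only
    rw [h1]
    simp only [hmem]
    split_ifs with ht
    · exact hLb (τ.restrictScalars F) (fun x hx => τ.commutes ⟨x, hx⟩) t
    · exact map_one τ
  · intro σ t
    dsimp only
    simp only [hmem]
    split_ifs with ht
    · rw [map_pow, hFb]
    · rw [one_pow, map_one]

/-- For the family z ^ r the product is the r-th power of `cycloProj z`. Its r-th roots are the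
multiples of `cycloProj z` by powers of ζ, all moved by σ₀, whereas σ₀ fixes F(ζ). -/
theorem exists_isEquivariant_not_pow [IsGalois F Ω] (hζ : IsPrimitiveRoot ζ r)
    (L : IntermediateField F Ω) [IsGalois F L] (hL : finrank F L = r) :
    ∃ z : (ZMod r)ˣ → Ω, IsEquivariant F hζ z ∧ (∀ t, z t ≠ 0) ∧
      ∀ γ ∈ F⟮ζ⟯, γ ^ r ≠ cycloProj z := by
  have hr : r.Prime := Fact.out
  obtain ⟨σ₀, ω, z, hσ₀, -, hσz, hω, hσω, hz0, -, hzF⟩ := exists_resolvent_family hζ L hL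
  refine ⟨_, hzF, fun t => pow_ne_zero _ (hz0 t), fun γ hγ h => ?_⟩
  have h1 : γ ^ r = cycloProj z ^ r := by
    rw [h, cycloProj, cycloProj, ← Finset.prod_pow]
    exact Finset.prod_congr rfl fun t _ => by rw [← pow_mul, ← pow_mul, mul_comm]
  have h0 := cycloProj_ne_zero hz0
  obtain ⟨i, -, hi⟩ := hζ.eq_pow_of_pow_eq_one (show (cycloProj z / γ) ^ r = 1 by
    rw [div_pow, h1, div_self (pow_ne_zero _ h0)])
  have hγ0 : γ ≠ 0 := by
    rintro rfl
    rw [zero_pow hr.ne_zero] at h1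
    exact pow_ne_zero _ h0 h1.symm
  rw [eq_div_iff hγ0] at hi
  have h2 : σ₀ (cycloProj z) = cycloProj z := by
    rw [← hi, map_mul, map_pow, hσ₀, apply_eq_of_mem_adjoin hγ (by simpa using hσ₀)]
  rw [h2] at hσz
  exact hω.ne_one hr.one_lt (mul_right_cancel₀ h0 (hσz.symm.trans (one_mul _).symm))

/-- If `L / F` is Galois of prime degree `r ≠ char F` and `L` has no Galois extension of degree `r`,
then `r = 2` and `-1` is not a square in `F`. -/
theorem eq_two_and_not_sq_of_primitiveRoot [IsGalois F Ω] [IsSepClosed Ω]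
    (hζ : IsPrimitiveRoot ζ r)
    (L : IntermediateField F Ω) [IsGalois F L] (hL : finrank F L = r)
    (hno : ∀ E : IntermediateField L Ω, IsGalois L E → finrank L E ≠ r) :
    r = 2 ∧ ∀ i : F, i ^ 2 ≠ -1 := by
  have hr : r.Prime := Fact.out
  obtain ⟨σ₀, ω, z, hσ₀, hpow, hσz, hω, hσω, hz0, hzL, -⟩ := exists_resolvent_family hζ L hL
  have h0 := cycloProj_ne_zero hz0
  have : NeZero (r : Ω) := hζ.neZero'
  obtain ⟨β, hβ⟩ := IsSepClosed.exists_pow_nat_eq (cycloProj z) r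
  have hβL : β ∈ L⟮ζ⟯ := by
    by_contra hβL
    obtain ⟨E, -, -, hE, hEr, -⟩ := hzL.exists_isGalois_finrank_eq hz0 hβ hβL
    exact hno E hE hEr
  have hσr : (σ₀ ^ r) β = β := by
    let τ : Ω ≃ₐ[L] Ω := AlgEquiv.ofRingEquiv (f := (σ₀ ^ r : Ω ≃ₐ[F] Ω).toRingEquiv)
      fun x => hpow x x.2
    refine apply_eq_of_mem_adjoin (σ := τ) hβL ?_
    rintro s rfl
    change (σ₀ ^ r) s = s
    generalize r = n
    induction n with
    | zero => rfl
    | succ n ih => rw [pow_succ, AlgEquiv.mul_apply, hσ₀, ih]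
  -- Since σ₀ ^ r fixes β, this norm along the σ₀-orbit is fixed by σ₀; its r-th power is `cycloProj
  -- z ^ r` up to a power of ω.
  set N := ∏ i ∈ Finset.range r, (σ₀ ^ i) β with hN
  have hσN : σ₀ N = N := by
    have h1 : σ₀ N = ∏ i ∈ Finset.range r, (σ₀ ^ (i + 1)) β := by
      rw [hN, map_prod]
      exact Finset.prod_congr rfl fun i _ => by rw [pow_succ', AlgEquiv.mul_apply]
    have h2 := Finset.prod_range_succ (fun i => (σ₀ ^ i) β) r
    rw [Finset.prod_range_succ', hσr, ← h1, pow_zero, AlgEquiv.one_apply] at h2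
    have hβ0 : β ≠ 0 := by
      rintro rfl
      exact h0 (by rw [← hβ, zero_pow hr.ne_zero])
    exact mul_right_cancel₀ hβ0 h2
  have hσi : ∀ i : ℕ, (σ₀ ^ i) (cycloProj z) = ω ^ i * cycloProj z := by
    intro i
    induction i with
    | zero => simp
    | succ i ih => rw [pow_succ', AlgEquiv.mul_apply, ih, map_mul, map_pow, hσω, hσz]; ring
  have hNr : N ^ r = ω ^ (∑ i ∈ Finset.range r, i) * cycloProj z ^ r := by
    rw [hN, ← Finset.prod_pow]
    simp_rw [← map_pow, hβ, hσi]
    rw [Finset.prod_mul_distrib, Finset.prod_pow_eq_pow_sum, Finset.prod_const, Finset.card_range]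
  -- the projection is not fixed by `σ₀`
  have hfix : σ₀ (cycloProj z) ≠ cycloProj z := by
    intro h
    rw [h] at hσz
    exact hω.ne_one hr.one_lt (mul_right_cancel₀ h0 (hσz.symm.trans (one_mul _).symm))
  -- For odd r the exponent r(r - 1)/2 of ω is divisible by r, so N is `cycloProj z` times a power
  -- of ω, and σ₀ would fix `cycloProj z`. For r = 2 a sign survives, and a square root of -1 in F
  -- is what would absorb it.
  rcases hr.eq_two_or_odd' with rfl | hodd
  · refine ⟨rfl, fun i hi => hfix ?_⟩
    have h1 : ω = -1 := hω.eq_neg_one_of_two_right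
    have h2 : cycloProj z ^ 2 = (algebraMap F Ω i * N) ^ 2 := by
      rw [mul_pow, hNr, h1, ← map_pow, hi]
      simp [Finset.sum_range_succ]
    rcases sq_eq_sq_iff_eq_or_eq_neg.1 h2 with h | h <;> simp [h, hσN]
  · exfalso
    have h1 : ω ^ (∑ i ∈ Finset.range r, i) = 1 := by
      obtain ⟨k, hk⟩ := hodd
      have h2 : ∑ i ∈ Finset.range r, i = r * k := by
        have h3 := Finset.sum_range_id_mul_two r
        have h4 : r - 1 = k * 2 := by omega
        rw [h4, ← mul_assoc] at h3
        exact Nat.eq_of_mul_eq_mul_right two_pos h3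
      rw [h2, pow_mul, hω.pow_eq_one, one_pow]
    rw [h1, one_mul] at hNr
    obtain ⟨i, -, hi⟩ := hω.eq_pow_of_pow_eq_one (show (N / cycloProj z) ^ r = 1 by
      rw [div_pow, hNr, div_self (pow_ne_zero _ h0)])
    rw [eq_div_iff h0] at hi
    have h2 := hσN
    rw [← hi, map_mul, map_pow, hσω] at h2
    exact hfix (mul_left_cancel₀ (pow_ne_zero _ (hω.ne_zero hr.ne_zero)) h2)

end Resolvent

/-! ### Equivariant families as values of polynomials over the base field. -/

section Interpolation

open Polynomial

variable {F Ω : Type*} [Field F] [Field Ω] [Algebra F Ω] {r : ℕ} [Fact r.Prime] {ζ : Ω}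

theorem isEquivariant_aeval (hζ : IsPrimitiveRoot ζ r) (f : F[X]) :
    IsEquivariant F hζ fun t => aeval (ζ ^ (t : ZMod r).val) f := by
  intro σ t
  dsimp only
  rw [← aeval_algHom_apply, map_pow, apply_root_eq_pow hζ, ← pow_mul]
  congr 2
  refine pow_eq_pow_of_natCast_eq (r := r) hζ.pow_eq_one ?_
  simp

/-- The Lagrange interpolant at the points ζ ^ t is unique and the family is equivariant, so its
coefficients are Galois invariant. In this form families can be lifted or approximated coefficient
by coefficient. -/
theorem IsEquivariant.exists_polynomial [IsGalois F Ω] {hζ : IsPrimitiveRoot ζ r}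
    {z : (ZMod r)ˣ → Ω} (hz : IsEquivariant F hζ z) :
    ∃ f : F[X], ∀ t : (ZMod r)ˣ, aeval (ζ ^ (t : ZMod r).val) f = z t := by
  classical
  let v : (ZMod r)ˣ → Ω := fun t => ζ ^ (t : ZMod r).val
  have hv : Function.Injective v := fun s t h =>
    Units.ext (ZMod.val_injective r (hζ.pow_inj (ZMod.val_lt _) (ZMod.val_lt _) h))
  have hσv : ∀ (σ : Ω ≃ₐ[F] Ω) t, σ (v t) = v (hζ.autToPow F σ * t) := by
    intro σ t
    simpa [v] using isEquivariant_aeval hζ (X : F[X]) σ t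
  set p := Lagrange.interpolate Finset.univ v z with hp
  have hpe : ∀ t, p.eval (v t) = z t := fun t =>
    Lagrange.eval_interpolate_at_node z hv.injOn (Finset.mem_univ t)
  have hσp : ∀ σ : Ω ≃ₐ[F] Ω, p.map (σ : Ω →+* Ω) = p := by
    intro σ
    refine Lagrange.eq_interpolate_of_eval_eq z hv.injOn ?_ fun t _ => ?_
    · rw [degree_map]
      exact Lagrange.degree_interpolate_lt z hv.injOn
    · have h1 : v t = σ (v ((hζ.autToPow F σ)⁻¹ * t)) := by rw [hσv, mul_inv_cancel_left]
      rw [h1]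
      change (p.map (σ : Ω →+* Ω)).eval ((σ : Ω →+* Ω) _) = _
      rw [eval_map_apply, hpe]
      change σ _ = _
      rw [hz, mul_inv_cancel_left]
  have hlift : p ∈ lifts (algebraMap F Ω) := by
    rw [lifts_iff_coeff_lifts]
    intro n
    rw [InfiniteGalois.mem_range_algebraMap_iff_fixed]
    intro σ
    conv_rhs => rw [← hσp σ]
    rw [coeff_map]
    rfl
  obtain ⟨f, hf⟩ := (mem_lifts p).1 hlift
  refine ⟨f, fun t => ?_⟩
  rw [← hpe t, ← hf, eval_map_algebraMap]

end Interpolation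

end

section

open IntermediateField Module

/-! ### Artin–Schreier extensions. -/

section ArtinSchreier

open Polynomial

variable {r : ℕ} [Fact r.Prime]

theorem prod_range_sub_natCast {R : Type*} [CommRing R] [CharP R r] (x : R) :
    ∏ i ∈ Finset.range r, (x - (i : R)) = x ^ r - x := by
  have hr : r.Prime := Fact.out
  have h1 : ∏ a : ZMod r, ((X : (ZMod r)[X]) - C a) = X ^ r - X := by
    have hroots := FiniteField.roots_X_pow_card_sub_X (ZMod r)
    rw [ZMod.card] at hroots
    have hmonic : (X ^ r - X : (ZMod r)[X]).Monic :=
      monic_X_pow_sub (by rw [degree_X]; exact_mod_cast hr.one_lt)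
    have h2 := prod_multiset_X_sub_C_of_monic_of_roots_card_eq hmonic (by
      rw [hroots, FiniteField.X_pow_card_sub_X_natDegree_eq _ hr.one_lt]
      simp)
    rw [hroots] at h2
    exact h2
  have h2 := congrArg (eval₂ (ZMod.castHom dvd_rfl R) x) h1
  rw [eval₂_finsetProd] at h2
  simp only [eval₂_sub, eval₂_X, eval₂_C, eval₂_pow] at h2
  rw [← h2]
  refine Finset.prod_bij' (fun i _ => (i : ZMod r)) (fun a _ => a.val) (by simp)
    (fun a _ => Finset.mem_range.2 (ZMod.val_lt a))
    (fun i hi => ZMod.val_cast_of_lt (Finset.mem_range.1 hi)) (by simp) (by simp)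

theorem exists_natCast_of_pow_eq_self {R : Type*} [CommRing R] [IsDomain R] [CharP R r] {x : R}
    (hx : x ^ r = x) : ∃ i : ℕ, x = i := by
  have h := prod_range_sub_natCast (r := r) x
  rw [hx, sub_self, Finset.prod_eq_zero_iff] at h
  obtain ⟨i, -, hi⟩ := h
  exact ⟨i, sub_eq_zero.1 hi⟩

theorem sub_pow_sub_self {R : Type*} [CommRing R] [CharP R r] (x y : R) :
    (x - y) ^ r - (x - y) = (x ^ r - x) - (y ^ r - y) := by
  rw [sub_pow_char]
  ring

theorem natCast_pow_char (R : Type*) [CommRing R] [CharP R r] (i : ℕ) : (i : R) ^ r = i := by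
  have h : (i : ZMod r) ^ r = i := ZMod.pow_card _
  simpa only [map_pow, map_natCast] using congrArg (ZMod.castHom dvd_rfl R) h

variable {F Ω : Type*} [Field F] [Field Ω] [Algebra F Ω]

/-- The roots of X ^ r - X - b are the β + i with i in the prime field, so F(β) is the splitting
field of a separable polynomial. A nontrivial automorphism translates β by an element of the prime
field and thus has order r. -/
theorem isGalois_of_artinSchreier [CharP F r] {b : F} {β : Ω}
    (hβ : β ^ r - β = algebraMap F Ω b) (hβF : β ∉ (⊥ : IntermediateField F Ω)) :
    IsGalois F F⟮β⟯ ∧ finrank F F⟮β⟯ = r := by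
  have hr : r.Prime := Fact.out
  have : CharP Ω r := charP_of_injective_algebraMap (algebraMap F Ω).injective r
  have : CharP F⟮β⟯ r := charP_of_injective_algebraMap (algebraMap F F⟮β⟯).injective r
  let γ := AdjoinSimple.gen F β
  have hγ : γ ^ r - γ = algebraMap F F⟮β⟯ b := Subtype.ext hβ
  let p : F[X] := X ^ r - X - C b
  have hp : p.Separable := by
    rw [separable_def]
    refine ⟨0, -1, ?_⟩
    simp [p, derivative_X_pow]
  have hpγ : p.map (algebraMap F F⟮β⟯) = ∏ i ∈ Finset.range r, (X - C (γ + i)) := by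
    have h1 := prod_range_sub_natCast (r := r) ((X : F⟮β⟯[X]) - C γ)
    rw [sub_pow_sub_self, ← C_pow, ← C_sub, hγ] at h1
    simp only [p, Polynomial.map_sub, Polynomial.map_pow, map_X, map_C]
    rw [← h1]
    refine Finset.prod_congr rfl fun i _ => ?_
    simp [sub_sub]
  have hsplit : p.IsSplittingField F F⟮β⟯ := by
    rw [isSplittingField_iff_intermediateField]
    refine ⟨?_, ?_⟩
    · rw [hpγ]
      exact Splits.prod fun i _ => Splits.X_sub_C _
    · suffices h : F⟮β⟯ ≤ lift (adjoin F (p.rootSet F⟮β⟯)) from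
        eq_top_iff.2 fun x _ => (mem_lift x).1 (h x.2)
      rw [adjoin_simple_le_iff]
      refine (mem_lift γ).2 (subset_adjoin F _ ?_)
      rw [mem_rootSet]
      refine ⟨hp.ne_zero, ?_⟩
      simp [p, hγ]
  have hG : IsGalois F F⟮β⟯ := IsGalois.of_separable_splitting_field hp
  refine ⟨hG, ?_⟩
  have hpβ : aeval β p = 0 := by simp [p, hβ]
  have hdeg : p.natDegree ≤ r := by
    have : 1 ≤ r := hr.one_le
    simp only [p]
    compute_degree!
  have hpm : p.Monic := by
    refine monic_of_natDegree_le_of_coeff_eq_one r hdeg ?_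
    simp [p, coeff_X, coeff_C, hr.ne_one.symm, hr.ne_zero]
  have hint : IsIntegral F β := ⟨p, hpm, hpβ⟩
  have : FiniteDimensional F F⟮β⟯ := adjoin.finiteDimensional hint
  apply le_antisymm
  · rw [adjoin.finrank hint]
    exact (natDegree_le_natDegree (minpoly.min F β hpm hpβ)).trans hdeg
  · have h1 : finrank F F⟮β⟯ ≠ 1 := by
      rw [Ne, IntermediateField.finrank_eq_one_iff, adjoin_simple_eq_bot_iff]
      exact hβF
    rw [← IsGalois.card_aut_eq_finrank] at h1 ⊢
    have : Nontrivial (F⟮β⟯ ≃ₐ[F] F⟮β⟯) := by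
      rw [← Finite.one_lt_card_iff_nontrivial]
      have : 0 < Nat.card (F⟮β⟯ ≃ₐ[F] F⟮β⟯) := Nat.card_pos
      omega
    obtain ⟨g, hg⟩ := exists_ne (1 : F⟮β⟯ ≃ₐ[F] F⟮β⟯)
    have hgγ : ∃ i : ℕ, g γ - γ = i := by
      apply exists_natCast_of_pow_eq_self (r := r)
      rw [← sub_eq_zero, sub_pow_sub_self, ← map_pow, ← map_sub, hγ, AlgEquiv.commutes, sub_self]
    obtain ⟨i, hi⟩ := hgγ
    rw [sub_eq_iff_eq_add] at hi
    have hpow : ∀ k : ℕ, (g ^ k) γ = k * i + γ := by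
      intro k
      induction k with
      | zero => simp
      | succ k ih =>
        rw [pow_succ', AlgEquiv.mul_apply, ih, map_add, map_mul, map_natCast, map_natCast, hi]
        push_cast
        ring
    have hgr : orderOf g = r := by
      refine orderOf_eq_prime ?_ hg
      apply AlgEquiv.coe_toAlgHom_injective
      refine (adjoin.powerBasis hint).algHom_ext ?_
      rw [adjoin.powerBasis_gen]
      change (g ^ r) γ = γ
      rw [hpow, CharP.cast_eq_zero, zero_mul, zero_add]
    exact Nat.le_of_dvd Nat.card_pos (hgr ▸ orderOf_dvd_natCard g)

/-- Additive Hilbert 90: a weighted sum of the conjugates of an element of trace 1 gives α with σ α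
= α - 1, and a = α ^ r - α lies in F. If c ^ r - c = a, then α - c is in the prime field, hence
fixed by σ, which is absurd. -/
theorem exists_ne_pow_sub_self [CharP F r] {L : Type*} [Field L] [Algebra F L] [IsGalois F L]
    (hL : finrank F L = r) : ∃ a : F, ∀ c : F, c ^ r - c ≠ a := by
  have hr : r.Prime := Fact.out
  have : FiniteDimensional F L := finite_of_finrank_pos (hL ▸ hr.pos)
  have : CharP L r := charP_of_injective_algebraMap (algebraMap F L).injective r
  have hcard : Nat.card (L ≃ₐ[F] L) = r := by rw [IsGalois.card_aut_eq_finrank, hL]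
  have := Finite.one_lt_card_iff_nontrivial.1 (hcard ▸ hr.one_lt)
  obtain ⟨σ, hσ⟩ := exists_ne (1 : L ≃ₐ[F] L)
  have hσr : orderOf σ = r := by
    refine orderOf_eq_prime ?_ hσ
    rw [← hcard, pow_card_eq_one']
  obtain ⟨x, hx⟩ := Algebra.trace_surjective F L 1
  have htr : ∑ i ∈ Finset.range r, (σ ^ i) x = 1 := by
    have h1 := trace_eq_sum_automorphisms (K := F) (L := L) x
    rw [hx, map_one] at h1
    rw [h1]
    classical
    have h2 : Set.InjOn (fun i => σ ^ i) (Finset.range r : Set ℕ) := by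
      intro i hi j hj hij
      exact pow_injOn_Iio_orderOf (by simpa [hσr] using hi) (by simpa [hσr] using hj) hij
    have h3 : (Finset.range r).image (fun i => σ ^ i) = Finset.univ := by
      rw [← Finset.card_eq_iff_eq_univ, Finset.card_image_of_injOn h2, Finset.card_range,
        ← Nat.card_eq_fintype_card, hcard]
    rw [← h3, Finset.sum_image h2]
  let α := ∑ i ∈ Finset.range r, (i : L) * (σ ^ i) x
  have hα : σ α = α - 1 := by
    have h1 := Finset.sum_range_succ (fun i => (i : L) * (σ ^ i) x) r
    rw [Finset.sum_range_succ'] at h1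
    simp only [CharP.cast_eq_zero, zero_mul, add_zero, Nat.cast_zero, Nat.cast_succ, add_mul,
      one_mul, Finset.sum_add_distrib] at h1
    have h2 : ∑ i ∈ Finset.range r, (σ ^ (i + 1)) x = 1 := by
      rw [← map_one σ, ← htr, map_sum]
      exact Finset.sum_congr rfl fun i _ => by rw [pow_succ', AlgEquiv.mul_apply]
    rw [h2] at h1
    rw [eq_sub_iff_add_eq]
    refine Eq.trans ?_ h1
    rw [map_sum]
    congr 1
    exact Finset.sum_congr rfl fun i _ => by
      rw [map_mul, map_natCast, pow_succ', AlgEquiv.mul_apply]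
  have hfix : ∀ g : L ≃ₐ[F] L, g (α ^ r - α) = α ^ r - α := by
    intro g
    obtain ⟨m, rfl⟩ := mem_powers_of_prime_card (p := r) hcard (g' := g) hσ
    dsimp only
    induction m with
    | zero => rfl
    | succ m ih =>
      rw [pow_succ, AlgEquiv.mul_apply, map_sub σ, map_pow σ, hα, sub_pow_sub_self, one_pow,
        sub_self, sub_zero, ih]
  obtain ⟨a, ha⟩ := (IsGalois.mem_range_algebraMap_iff_fixed (F := F) (α ^ r - α)).2 hfix
  refine ⟨a, fun c hc => ?_⟩
  obtain ⟨i, hi⟩ := exists_natCast_of_pow_eq_self (r := r) (x := α - algebraMap F L c) (by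
    rw [← sub_eq_zero, sub_pow_sub_self, ← map_pow, ← map_sub, hc, ha, sub_self])
  have h1 : σ (α - algebraMap F L c) = α - algebraMap F L c := by rw [hi, map_natCast]
  rw [map_sub, AlgEquiv.commutes, hα] at h1
  have : (1 : L) = 0 := by linear_combination -h1
  exact one_ne_zero this

end ArtinSchreier

end

section

open IntermediateField Module

/-! ### Valuations of roots of unity and of their differences. -/

section RootValuation

variable {Ω Γ₀ : Type*} [Field Ω] [LinearOrderedCommGroupWithZero Γ₀] (v : Valuation Ω Γ₀)
  {r : ℕ} [Fact r.Prime] {ζ : Ω}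

theorem prod_sub_pow_eq (hζ : IsPrimitiveRoot ζ r) (x : Ω) :
    ∏ i ∈ Finset.range r, (x - ζ ^ i) = x ^ r - 1 := by
  have hr : r.Prime := Fact.out
  have h := hζ.pow_sub_pow_eq_prod_sub_mul x 1 hr.pos
  rw [one_pow] at h
  rw [h]
  refine Finset.prod_bij (fun i _ => ζ ^ i) ?_ ?_ ?_ ?_
  · intro i _
    rw [Polynomial.mem_nthRootsFinset hr.pos, ← pow_mul, mul_comm, pow_mul, hζ.pow_eq_one, one_pow]
  · intro i hi j hj hij
    exact hζ.pow_inj (Finset.mem_range.1 hi) (Finset.mem_range.1 hj) hij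
  · intro b hb
    obtain ⟨i, hi, h⟩ := hζ.eq_pow_of_pow_eq_one ((Polynomial.mem_nthRootsFinset hr.pos _).1 hb)
    exact ⟨i, Finset.mem_range.2 hi, h⟩
  · simp

/-- The elements `(ζ ^ i - 1) / (ζ - 1)`. -/
def rootQuot (ζ : Ω) (i : ℕ) : Ω := (ζ ^ i - 1) / (ζ - 1)

theorem rootQuot_eq_sum {ζ : Ω} (h : ζ ≠ 1) (i : ℕ) :
    rootQuot ζ i = ∑ k ∈ Finset.range i, ζ ^ k := (geom_sum_eq h i).symm

/-- The substitution x = 1 + (ζ - 1) Y turns x ^ r - 1 into a polynomial in Y whose roots have unit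
differences for every valuation, even in residue characteristic r, where the powers of ζ all have
residue 1. -/
theorem prod_sub_rootQuot (hζ : IsPrimitiveRoot ζ r) (x : Ω) :
    ∏ i ∈ Finset.range r, ((x - 1) / (ζ - 1) - rootQuot ζ i) = (x ^ r - 1) / (ζ - 1) ^ r := by
  rw [← prod_sub_pow_eq hζ, ← Finset.card_range r, ← Finset.prod_const, Finset.card_range,
    ← Finset.prod_div_distrib]
  refine Finset.prod_congr rfl fun i _ => ?_
  rw [rootQuot, ← sub_div]
  ring

theorem valuation_root (hζ : IsPrimitiveRoot ζ r) : v ζ = 1 := by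
  have hr : r.Prime := Fact.out
  refine (pow_eq_one_iff_of_nonneg zero_le hr.ne_zero).1 ?_
  rw [← map_pow, hζ.pow_eq_one, map_one]

theorem valuation_rootQuot_le (hζ : IsPrimitiveRoot ζ r) (i : ℕ) : v (rootQuot ζ i) ≤ 1 := by
  have hr : r.Prime := Fact.out
  rw [rootQuot_eq_sum (hζ.ne_one hr.one_lt)]
  refine v.map_sum_le fun k _ => ?_
  rw [map_pow, valuation_root v hζ, one_pow]

/-- Cyclotomic units: since ζ is in turn a power of ζ ^ i, the inverse is a quotient of the same
shape, so both have value at most 1. -/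
theorem valuation_rootQuot (hζ : IsPrimitiveRoot ζ r) {i : ℕ} (hi : ¬ r ∣ i) :
    v (rootQuot ζ i) = 1 := by
  have hr : r.Prime := Fact.out
  have hζi : IsPrimitiveRoot (ζ ^ i) r :=
    hζ.pow_of_coprime i (Nat.coprime_comm.1 ((hr.coprime_iff_not_dvd).2 hi))
  obtain ⟨k, -, hk⟩ := hζi.eq_pow_of_pow_eq_one hζ.pow_eq_one
  have h1 := valuation_rootQuot_le v hζi k
  have h0 : ζ - 1 ≠ 0 := sub_ne_zero.2 (hζ.ne_one hr.one_lt)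
  have h0' : ζ ^ i - 1 ≠ 0 := sub_ne_zero.2 (hζi.ne_one hr.one_lt)
  have h2 : rootQuot (ζ ^ i) k = (rootQuot ζ i)⁻¹ := by
    rw [rootQuot, rootQuot, hk, inv_div]
  rw [h2, map_inv₀] at h1
  refine le_antisymm (valuation_rootQuot_le v hζ i) ?_
  exact (inv_le_one₀ (zero_lt_iff.2 (v.ne_zero_iff.2 (div_ne_zero h0' h0)))).1 h1

theorem valuation_rootQuot_sub (hζ : IsPrimitiveRoot ζ r) {i j : ℕ} (hi : i < r) (hj : j < r)
    (hij : i ≠ j) : v (rootQuot ζ i - rootQuot ζ j) = 1 := by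
  wlog h : j < i generalizing i j
  · rw [v.map_sub_swap]
    exact this hj hi hij.symm (by omega)
  obtain ⟨k, rfl⟩ := Nat.exists_eq_add_of_lt h
  have h1 : rootQuot ζ (j + k + 1) - rootQuot ζ j = ζ ^ j * rootQuot ζ (k + 1) := by
    rw [rootQuot, rootQuot, rootQuot, ← sub_div, ← mul_div_assoc]
    ring
  rw [h1, map_mul, map_pow, valuation_root v hζ, one_pow, one_mul, valuation_rootQuot v hζ]
  exact Nat.not_dvd_of_pos_of_lt (by omega) (by omega)

theorem valuation_prod_sub_one_lt {ι : Type*} (s : Finset ι) (f : ι → Ω) (γ : Γ₀) (hγ0 : γ ≠ 0)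
    (hγ : γ ≤ 1) (h : ∀ i ∈ s, v (f i - 1) < γ) : v (∏ i ∈ s, f i - 1) < γ := by
  classical
  induction s using Finset.induction_on with
  | empty => simpa using zero_lt_iff.2 hγ0
  | insert a s ha ih =>
    rw [Finset.prod_insert ha]
    have h1 := h a (Finset.mem_insert_self a s)
    have h2 := ih fun i hi => h i (Finset.mem_insert_of_mem hi)
    have h3 : f a * ∏ i ∈ s, f i - 1 = (f a - 1) * (∏ i ∈ s, f i - 1) + (f a - 1) +
      (∏ i ∈ s, f i - 1) := by ring
    rw [h3]
    refine v.map_add_lt (v.map_add_lt ?_ h1) h2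
    rw [map_mul]
    calc v (f a - 1) * v (∏ i ∈ s, f i - 1) ≤ v (f a - 1) * 1 := by
          gcongr
          exact h2.le.trans hγ
      _ < γ := by rwa [mul_one]

theorem exists_valuation_sub_lt_one_of_prod {ι : Type*} (s : Finset ι) (f : ι → Ω)
    (h : v (∏ i ∈ s, f i) < 1) : ∃ i ∈ s, v (f i) < 1 := by
  by_contra! hc
  rw [map_prod] at h
  exact h.not_ge (Finset.one_le_prod' hc)

end RootValuation

/-! ### Kummer generators close to 1 under an invariant valuation ring. -/

section Rigidity

variable {F Ω : Type*} [Field F] [Field Ω] [Algebra F Ω] {r : ℕ} [Fact r.Prime] {ζ : Ω}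

/-- Divide a linear relation by its coefficient of largest value. -/
theorem exists_normalized_relation {Γ₀ ι : Type*} [LinearOrderedCommGroupWithZero Γ₀]
    (v : Valuation Ω Γ₀) [Fintype ι] (E : IntermediateField F Ω) {N : IntermediateField E Ω}
    [FiniteDimensional E N] (hN : finrank E N < Fintype.card ι) (z : ι → Ω) (hz : ∀ i, z i ∈ N) :
    ∃ c : ι → E, ∑ i, (c i : Ω) * z i = 0 ∧ (∀ i, v (c i) ≤ 1) ∧ ∃ j, c j = 1 := by
  have h1 : ¬ LinearIndependent E (fun i => (⟨z i, hz i⟩ : N)) := fun h =>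
    hN.not_ge h.fintype_card_le_finrank
  rw [Fintype.not_linearIndependent_iff] at h1
  obtain ⟨g, hg, i₀, hi₀⟩ := h1
  obtain ⟨j, -, hj⟩ := Finset.exists_max_image Finset.univ (fun i => v (g i)) ⟨i₀, Finset.mem_univ _⟩
  have hgj : g j ≠ 0 := by
    intro h
    have := hj i₀ (Finset.mem_univ _)
    rw [h] at this
    simp only [ZeroMemClass.coe_zero, map_zero, nonpos_iff_eq_zero, map_eq_zero] at this
    exact hi₀ (Subtype.ext this)
  have hvj : 0 < v (g j) := zero_lt_iff.2 (v.ne_zero_iff.2 (by simpa using hgj))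
  refine ⟨fun i => g i / g j, ?_, fun i => ?_, j, div_self hgj⟩
  · have h2 := congrArg (fun x : N => (x : Ω)) hg
    simp only [ZeroMemClass.coe_zero] at h2
    rw [AddSubmonoidClass.coe_finsetSum] at h2
    have h3 : ∀ i, ((g i / g j : E) : Ω) * z i = (g j : Ω)⁻¹ * (g i * z i) := by
      intro i
      push_cast
      ring
    simp_rw [h3, ← Finset.mul_sum]
    rw [mul_eq_zero]
    exact Or.inr h2
  · push_cast
    rw [map_div₀]
    exact div_le_one_of_le₀ (hj i (Finset.mem_univ _)) zero_le

/-- If a valuation ring is stable under the Galois group on Galois extensions of degree `r`, then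
equivariant families close to `1` have a projection which is an `r`-th power. -/
theorem IsEquivariant.mem_adjoin_of_valuation_lt [IsGalois F Ω] {hζ : IsPrimitiveRoot ζ r}
    {z : (ZMod r)ˣ → Ω} (hz : IsEquivariant F hζ z) (h0 : ∀ t, z t ≠ 0) {β : Ω}
    (hβ : β ^ r = cycloProj z) (W : ValuationSubring Ω)
    (hW : ∀ E : IntermediateField F Ω, IsGalois F E → finrank F E = r →
      ∀ σ : Ω ≃ₐ[F] Ω, ∀ x ∈ E, x ∈ W → σ x ∈ W)
    (hlt : W.valuation (cycloProj z - 1) < W.valuation (ζ - 1) ^ r) : β ∈ F⟮ζ⟯ := by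
  have hr : r.Prime := Fact.out
  by_contra hβF
  set v := W.valuation
  obtain ⟨E, hEN, hfin, hE, hEr, hNr⟩ := hz.exists_isGalois_finrank_eq h0 hβ hβF
  have hζ1 : ζ - 1 ≠ 0 := sub_ne_zero.2 (hζ.ne_one hr.one_lt)
  have hζN : ζ ∈ F⟮ζ, β⟯ := subset_adjoin F _ (by simp)
  have hβN : β ∈ F⟮ζ, β⟯ := subset_adjoin F _ (by simp)
  have hβ0 : β ≠ 0 := by
    rintro rfl
    exact cycloProj_ne_zero h0 (by rw [← hβ, zero_pow hr.ne_zero])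
  -- a root congruent to `1`
  obtain ⟨β', hβ'r, hβ'N, hβ'0, hβ'F, hβ'v⟩ : ∃ β' : Ω, β' ^ r = cycloProj z ∧ β' ∈ F⟮ζ, β⟯ ∧
      β' ≠ 0 ∧ β' ∉ F⟮ζ⟯ ∧ v ((β' - 1) / (ζ - 1)) < 1 := by
    have h1 : v (∏ i ∈ Finset.range r, ((β - 1) / (ζ - 1) - rootQuot ζ i)) < 1 := by
      rw [prod_sub_rootQuot hζ, hβ, map_div₀, map_pow]
      exact (div_lt_one₀ (zero_lt_iff.2 (pow_ne_zero _ (v.ne_zero_iff.2 hζ1)))).2 hlt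
    obtain ⟨i, hi, h⟩ := exists_valuation_sub_lt_one_of_prod v _ _ h1
    have hinv : ζ ^ i ≠ 0 := pow_ne_zero _ (hζ.ne_zero hr.ne_zero)
    refine ⟨(ζ ^ i)⁻¹ * β, ?_, mul_mem (inv_mem (pow_mem hζN i)) hβN,
      mul_ne_zero (inv_ne_zero hinv) hβ0, ?_, ?_⟩
    · rw [mul_pow, inv_pow, ← pow_mul, mul_comm i, pow_mul, hζ.pow_eq_one, one_pow, inv_one,
        one_mul, hβ]
    · intro hmem
      refine hβF ?_
      have := mul_mem (pow_mem (mem_adjoin_simple_self F ζ) i) hmem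
      rwa [mul_inv_cancel_left₀ hinv] at this
    · have h2 : ((ζ ^ i)⁻¹ * β - 1) / (ζ - 1) =
          (ζ ^ i)⁻¹ * ((β - 1) / (ζ - 1) - rootQuot ζ i) := by
        rw [rootQuot]
        field_simp
        ring
      rw [h2, map_mul, map_inv₀, map_pow, valuation_root v hζ, one_pow, inv_one, one_mul]
      exact h
  -- an automorphism over `F(ζ)` multiplying it by `ζ`
  obtain ⟨σ, hσζ, hσβ⟩ : ∃ σ : Ω ≃ₐ[F] Ω, σ ζ = ζ ∧ σ β' = ζ * β' := by
    obtain ⟨τ, hτζ, hτβ⟩ : ∃ τ : Ω ≃ₐ[F] Ω, τ ζ = ζ ∧ τ β' ≠ β' := by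
      by_contra! h
      exact hβ'F (mem_adjoin_of_fixed fun τ hτ => h τ (hτ ζ rfl))
    have h1 : (τ β' / β') ^ r = 1 := by
      have : cycloProj z ∈ F⟮ζ⟯ := prod_mem fun t _ => pow_mem (hz.mem_adjoin t) _
      rw [div_pow, ← map_pow, hβ'r, apply_eq_of_mem_adjoin this (by simpa using hτζ),
        div_self (cycloProj_ne_zero h0)]
    obtain ⟨i, hi, h⟩ := hζ.eq_pow_of_pow_eq_one h1
    rw [eq_div_iff hβ'0] at h
    have hpow : ∀ k : ℕ, (τ ^ k) ζ = ζ ∧ (τ ^ k) β' = ζ ^ (i * k) * β' := by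
      intro k
      induction k with
      | zero => simp
      | succ k ih =>
        rw [pow_succ', AlgEquiv.mul_apply, AlgEquiv.mul_apply, ih.1, ih.2, map_mul, map_pow, hτζ,
          ← h]
        exact ⟨rfl, by ring⟩
    have hi0 : (i : ZMod r) ≠ 0 := by
      intro h2
      rw [ZMod.natCast_eq_zero_iff] at h2
      rw [Nat.eq_zero_of_dvd_of_lt h2 hi, pow_zero, one_mul] at h
      exact hτβ h.symm
    -- As τ multiplies β' by ζ ^ i with i prime to r, the inverse of i modulo r is the exponent that
    -- makes the factor equal to ζ.
    refine ⟨τ ^ ((i : ZMod r)⁻¹).val, (hpow _).1, ?_⟩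
    rw [(hpow _).2]
    congr 1
    conv_rhs => rw [← pow_one ζ]
    refine pow_eq_pow_of_natCast_eq (r := r) hζ.pow_eq_one ?_
    rw [Nat.cast_mul, ZMod.natCast_zmod_val, mul_inv_cancel₀ hi0, Nat.cast_one]
  have hσk : ∀ k : ℕ, (σ ^ k) ζ = ζ ∧ (σ ^ k) β' = ζ ^ k * β' := by
    intro k
    induction k with
    | zero => simp
    | succ k ih =>
      rw [pow_succ', AlgEquiv.mul_apply, AlgEquiv.mul_apply, ih.1, ih.2, map_mul, map_pow, hσζ,
        hσβ]
      exact ⟨rfl, by ring⟩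
  -- The conjugate of Y under σ ^ k is congruent to `rootQuot ζ k`, so the r conjugates of Y have
  -- distinct residues. The elements `e l` below can then be built so that σ ^ k (e l) reduces to 1
  -- if k = l and to 0 otherwise.
  set Y := (β' - 1) / (ζ - 1) with hY
  have hσρ : ∀ k i : ℕ, (σ ^ k) (rootQuot ζ i) = rootQuot ζ i := by
    intro k i
    simp only [rootQuot, map_div₀, map_sub, map_pow, map_one, (hσk k).1]
  have hσY : ∀ k : ℕ, v ((σ ^ k) Y - rootQuot ζ k) < 1 := by
    intro k
    have : (σ ^ k) Y - rootQuot ζ k = ζ ^ k * Y := by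
      simp only [hY, rootQuot, map_div₀, map_sub, map_one, (hσk k).1, (hσk k).2]
      field_simp
      ring
    rw [this, map_mul, map_pow, valuation_root v hζ, one_pow, one_mul]
    exact hβ'v
  -- Lagrange idempotents
  let f : Fin r → Fin r → Ω := fun l m =>
    (Y - rootQuot ζ m) / (rootQuot ζ l - rootQuot ζ m)
  let e : Fin r → Ω := fun l => ∏ m ∈ Finset.univ.erase l, f l m
  have hσf : ∀ (k : ℕ) (l m : Fin r), (σ ^ k) (f l m) =
      ((σ ^ k) Y - rootQuot ζ m) / (rootQuot ζ l - rootQuot ζ m) := by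
    intro k l m
    simp only [f, map_div₀, map_sub, hσρ]
  have hvρ : ∀ l m : Fin r, l ≠ m → v (rootQuot ζ l - rootQuot ζ m) = 1 := fun l m h =>
    valuation_rootQuot_sub v hζ l.2 m.2 (fun h' => h (Fin.ext h'))
  have hYle : ∀ k : ℕ, v ((σ ^ k) Y) ≤ 1 := by
    intro k
    have := v.map_add ((σ ^ k) Y - rootQuot ζ k) (rootQuot ζ k)
    rw [sub_add_cancel] at this
    exact this.trans (max_le (hσY k).le (valuation_rootQuot_le v hζ k))
  have hfle : ∀ (k : ℕ) (l m : Fin r), l ≠ m → v ((σ ^ k) (f l m)) ≤ 1 := by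
    intro k l m h
    rw [hσf, map_div₀, hvρ l m h, div_one]
    exact (v.map_sub _ _).trans (max_le (hYle k) (valuation_rootQuot_le v hζ m))
  have he1 : ∀ k : Fin r, v ((σ ^ (k : ℕ)) (e k) - 1) < 1 := by
    intro k
    simp only [e, map_prod]
    refine valuation_prod_sub_one_lt v _ _ 1 one_ne_zero le_rfl fun m hm => ?_
    have hm' : k ≠ m := (Finset.ne_of_mem_erase hm).symm
    have h1 : rootQuot ζ k - rootQuot ζ m ≠ 0 := by
      rw [← v.ne_zero_iff, hvρ k m hm']
      exact one_ne_zero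
    rw [hσf, div_sub_one h1, map_div₀, hvρ k m hm', div_one, sub_sub_sub_cancel_right]
    exact hσY k
  have he0 : ∀ k l : Fin r, l ≠ k → v ((σ ^ (k : ℕ)) (e l)) < 1 := by
    intro k l hkl
    simp only [e, map_prod]
    rw [← Finset.mul_prod_erase _ _ (Finset.mem_erase.2 ⟨hkl.symm, Finset.mem_univ k⟩)]
    refine mul_lt_one_of_lt_of_le ?_ ?_
    · rw [hσf, map_div₀, hvρ l k hkl, div_one]
      exact hσY k
    · refine Finset.prod_le_one' fun m hm => hfle k l m ?_
      exact (Finset.ne_of_mem_erase (Finset.mem_of_mem_erase hm)).symm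
  have heN : ∀ l, e l ∈ extendScalars hEN := by
    intro l
    have hρN : ∀ i, rootQuot ζ i ∈ F⟮ζ, β⟯ := fun i =>
      div_mem (sub_mem (pow_mem hζN i) (one_mem _)) (sub_mem hζN (one_mem _))
    refine prod_mem fun m _ => ?_
    exact div_mem (sub_mem (div_mem (sub_mem hβ'N (one_mem _)) (sub_mem hζN (one_mem _))) (hρN m))
      (sub_mem (hρN l) (hρN m))
  have hmul : r * finrank E (extendScalars hEN) = finrank F F⟮ζ, β⟯ := by
    have h1 := relfinrank_mul_relfinrank (bot_le (a := E)) hEN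
    rwa [relfinrank_eq_finrank_of_le hEN, relfinrank_bot_left, relfinrank_bot_left, hEr] at h1
  have hdim : finrank E (extendScalars hEN) < r := by
    rw [← hmul] at hNr
    exact Nat.lt_of_mul_lt_mul_left hNr
  have hfin' : FiniteDimensional E (extendScalars hEN) :=
    finite_of_finrank_pos (Nat.pos_of_mul_pos_left (hmul ▸ finrank_pos))
  -- The r elements `e l` are dependent over E, as N has degree less than r over E. In a relation
  -- with coefficients in W and `c k = 1`, apply σ ^ k: invariance on E keeps the coefficients in W,
  -- so modulo the maximal ideal only the k-th term, 1, survives.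
  obtain ⟨c, hc, hc1, k, hk⟩ := exists_normalized_relation v E (by simpa using hdim) e heN
  have h1 := congrArg (σ ^ (k : ℕ)) hc
  rw [map_zero, map_sum, ← Finset.add_sum_erase _ _ (Finset.mem_univ k), hk] at h1
  simp only [map_mul, OneMemClass.coe_one, one_mul] at h1
  have h2 : v (∑ l ∈ Finset.univ.erase k, (σ ^ (k : ℕ)) (c l) * (σ ^ (k : ℕ)) (e l)) < 1 := by
    refine v.map_sum_lt one_ne_zero fun l hl => ?_
    rw [map_mul, mul_comm]
    refine mul_lt_one_of_lt_of_le (he0 k l (Finset.ne_of_mem_erase hl)) ?_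
    rw [W.valuation_le_one_iff]
    exact hW E hE hEr _ _ (c l).2 ((W.valuation_le_one_iff _).1 (hc1 l))
  have h3 : (1 : Ω) = -((σ ^ (k : ℕ)) (e k) - 1) -
      ∑ l ∈ Finset.univ.erase k, (σ ^ (k : ℕ)) (c l) * (σ ^ (k : ℕ)) (e l) := by
    linear_combination h1
  have h4 := v.map_sub_lt ((v.map_neg _).trans_lt (he1 k)) h2
  rw [← h3, map_one] at h4
  exact h4.false

end Rigidity

end

section

open IntermediateField Module IsLocalRing

/-! ### The same phenomenon for Artin–Schreier equations with small constant term. -/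

section ArtinSchreierRigidity

variable {F Ω : Type*} [Field F] [Field Ω] [Algebra F Ω] {r : ℕ} [Fact r.Prime]

theorem valuation_natCast_of_charP {Γ₀ : Type*} [LinearOrderedCommGroupWithZero Γ₀]
    (v : Valuation Ω Γ₀) [CharP Ω r] {i : ℕ} (hi : (i : Ω) ≠ 0) : v (i : Ω) = 1 := by
  have hr : r.Prime := Fact.out
  have h1 : (i : Ω) ^ (r - 1) = 1 := by
    refine mul_left_cancel₀ hi ?_
    rw [← pow_succ', Nat.sub_add_cancel hr.one_le, natCast_pow_char, mul_one]
  refine (pow_eq_one_iff_of_nonneg zero_le (Nat.sub_ne_zero_of_lt hr.one_lt)).1 ?_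
  rw [← map_pow, h1, map_one]

/-- Some β - i has value less than 1. If β generated an extension of degree r, invariance of W there
would force the same for all conjugates of β - i; but two different conjugates differ by a nonzero
element of the prime field, of value 1. -/
theorem mem_bot_of_artinSchreier_of_valuation_lt [IsGalois F Ω] [CharP F r] {b : F} {β : Ω}
    (hβ : β ^ r - β = algebraMap F Ω b) (W : ValuationSubring Ω)
    (hW : ∀ E : IntermediateField F Ω, IsGalois F E → finrank F E = r →
      ∀ σ : Ω ≃ₐ[F] Ω, ∀ x ∈ E, x ∈ W → σ x ∈ W)
    (hlt : W.valuation (algebraMap F Ω b) < 1) : β ∈ (⊥ : IntermediateField F Ω) := by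
  by_contra hβF
  have : CharP Ω r := charP_of_injective_algebraMap (algebraMap F Ω).injective r
  obtain ⟨hG, hdeg⟩ := isGalois_of_artinSchreier hβ hβF
  rw [← hβ, ← prod_range_sub_natCast] at hlt
  obtain ⟨i, -, hi⟩ := exists_valuation_sub_lt_one_of_prod _ _ _ hlt
  obtain ⟨σ, hσ⟩ : ∃ σ : Ω ≃ₐ[F] Ω, σ β ≠ β := by
    by_contra! h
    rw [← adjoin_empty] at hβF
    exact hβF (mem_adjoin_of_fixed fun σ _ => h σ)
  obtain ⟨j, hj⟩ : ∃ j : ℕ, σ β - β = j := by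
    apply exists_natCast_of_pow_eq_self (r := r)
    rw [← sub_eq_zero, sub_pow_sub_self, ← map_pow, ← map_sub, hβ, AlgEquiv.commutes, sub_self]
  have hj0 : (j : Ω) ≠ 0 := by
    rw [← hj]
    exact sub_ne_zero.2 hσ
  -- the inverse of `β - i` is in `E` and not in `W`
  have hmem : ∀ τ : Ω ≃ₐ[F] Ω, W.valuation (τ (β - i)) < 1 := by
    intro τ
    have hE : β - i ∈ F⟮β⟯ := sub_mem (mem_adjoin_simple_self F β) (_root_.natCast_mem _ i)
    by_cases h0 : β - (i : Ω) = 0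
    · simp [h0]
    · by_contra! h
      have h1 : (τ (β - i))⁻¹ ∈ W := by
        rw [← W.valuation_le_one_iff, map_inv₀]
        exact inv_le_one_of_one_le₀ h
      have h2 : (τ (β - i))⁻¹ ∈ F⟮β⟯ := by
        have h3 : (τ : Ω →ₐ[F] Ω) (β - i) ∈ (F⟮β⟯).map (τ : Ω →ₐ[F] Ω) := ⟨_, hE, rfl⟩
        rw [normal_iff_forall_map_eq.1 hG.to_normal] at h3
        exact inv_mem h3
      have h4 := hW _ hG hdeg τ⁻¹ _ h2 h1
      rw [map_inv₀, AlgEquiv.aut_inv, AlgEquiv.symm_apply_apply, ← W.valuation_le_one_iff,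
        map_inv₀, inv_le_one₀ (zero_lt_iff.2 ((W.valuation).ne_zero_iff.2 h0))] at h4
      exact h4.not_gt hi
  have h1 := (W.valuation).map_sub_lt (hmem σ) hi
  have h2 : σ (β - i) - (β - i) = j := by
    rw [map_sub, map_natCast, ← hj]
    ring
  rw [h2, valuation_natCast_of_charP _ hj0] at h1
  exact h1.false

end ArtinSchreierRigidity

/-! ### Extension of valuation rings and degrees of residues. -/

section Extension

/-- Chevalley: a valuation ring dominates the image of O. Locality of the map prevents new elements
of F from entering. -/
theorem exists_extends {F Ω : Type u} [Field F] [Field Ω] [Algebra F Ω] (O : ValuationSubring F) :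
    ∃ W : ValuationSubring Ω, Extends O W := by
  obtain ⟨W, h, hloc⟩ := IsLocalRing.exists_factor_valuationRing ((algebraMap F Ω).comp O.subtype)
  refine ⟨W, ?_⟩
  ext x
  rw [ValuationSubring.mem_comap]
  refine ⟨fun hx => ?_, fun hx => h ⟨x, hx⟩⟩
  by_contra hxO
  have hx' : x⁻¹ ∈ O := (O.mem_or_inv_mem x).resolve_left hxO
  have hx0 : x ≠ 0 := fun h0 => hxO (h0 ▸ O.zero_mem)
  have hunit : IsUnit ((((algebraMap F Ω).comp O.subtype).codRestrict W.toSubring h) ⟨x⁻¹, hx'⟩) := by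
    refine IsUnit.of_mul_eq_one (⟨algebraMap F Ω x, hx⟩ : W.toSubring) (Subtype.ext ?_)
    change algebraMap F Ω x⁻¹ * algebraMap F Ω x = 1
    rw [← map_mul, inv_mul_cancel₀ hx0, map_one]
  obtain ⟨y, hy⟩ := (hloc.map_nonunit _ hunit).exists_right_inv
  have hy' : x⁻¹ * (y : F) = 1 := congrArg Subtype.val hy
  have : x = y := by
    rw [← mul_right_inj' (inv_ne_zero hx0), hy', inv_mul_cancel₀ hx0]
  exact hxO (this ▸ y.2)

variable {F Ω : Type u} [Field F] [Field Ω] [Algebra F Ω] {O : ValuationSubring F}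
  {W : ValuationSubring Ω}

theorem Extends.residueMap_residue (h : Extends O W) (a : O) :
    h.residueMap (residue O a) = residue W ⟨algebraMap F Ω a, (h.mem_iff _).2 a.2⟩ := rfl

theorem Extends.valuation_le_one_iff (h : Extends O W) (x : F) :
    W.valuation (algebraMap F Ω x) ≤ 1 ↔ x ∈ O := by
  rw [W.valuation_le_one_iff, h.mem_iff]

theorem residue_eq_zero_iff_valuation (x : W) : residue W x = 0 ↔ W.valuation x < 1 := by
  rw [residue_eq_zero_iff, W.valuation_lt_one_iff]

/-- The residue of an element of a subextension of degree less than `r` has degree less than `r`. -/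
theorem Extends.exists_polynomial_residue (h : Extends O W) (N : IntermediateField F Ω)
    [FiniteDimensional F N] {r : ℕ} (hN : finrank F N < r) (Y : W) (hY : (Y : Ω) ∈ N) :
    ∃ p : Polynomial (ResidueField O), p ≠ 0 ∧ p.natDegree < r ∧
      p.eval₂ h.residueMap (residue W Y) = 0 := by
  -- The first r powers of Y are dependent. Dividing the relation by its largest coefficient makes
  -- it integral with one coefficient equal to 1, so it stays nontrivial after reduction.
  have hdep : ¬ LinearIndependent F (fun i : Fin r => (⟨Y, hY⟩ : N) ^ (i : ℕ)) := fun hli =>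
    hN.not_ge (by simpa using hli.fintype_card_le_finrank)
  rw [Fintype.not_linearIndependent_iff] at hdep
  obtain ⟨g, hg, i₀, hi₀⟩ := hdep
  obtain ⟨j, -, hj⟩ := Finset.exists_max_image Finset.univ (fun i => O.valuation (g i))
    ⟨i₀, Finset.mem_univ _⟩
  have hgj : g j ≠ 0 := by
    intro h0
    have := hj i₀ (Finset.mem_univ _)
    rw [h0] at this
    simp only [map_zero, nonpos_iff_eq_zero, map_eq_zero] at this
    exact hi₀ this
  have hc : ∀ i, g i / g j ∈ O := by
    intro i
    rw [← O.valuation_le_one_iff, map_div₀]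
    exact div_le_one_of_le₀ (hj i (Finset.mem_univ _)) zero_le
  let c : Fin r → O := fun i => ⟨g i / g j, hc i⟩
  have hr : 0 < r := (Nat.zero_le _).trans_lt hN
  refine ⟨∑ i : Fin r, Polynomial.monomial (i : ℕ) (residue O (c i)), ?_, ?_, ?_⟩
  · intro h0
    have h1 := congrArg (fun p => Polynomial.coeff p (j : ℕ)) h0
    simp only [Polynomial.finsetSum_coeff, Polynomial.coeff_monomial, Polynomial.coeff_zero] at h1
    rw [Finset.sum_eq_single j (fun i _ hij => if_neg fun h' => hij (Fin.ext h')) (by simp),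
      if_pos rfl] at h1
    have : c j = 1 := Subtype.ext (div_self hgj)
    rw [this, map_one] at h1
    exact one_ne_zero h1
  · refine (Nat.le_sub_one_iff_lt hr).1 ?_
    refine Polynomial.natDegree_sum_le_of_forall_le _ _ fun i _ => ?_
    exact (Polynomial.natDegree_monomial_le _).trans (Nat.le_sub_one_of_lt i.2)
  · rw [Polynomial.eval₂_finsetSum]
    simp only [Polynomial.eval₂_monomial, h.residueMap_residue]
    simp_rw [← map_pow, ← map_mul]
    rw [← map_sum, ← map_zero (residue W)]
    congr 1
    apply Subtype.ext
    have h2 := congrArg (fun x : N => (x : Ω)) hg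
    simp only [ZeroMemClass.coe_zero, AddSubmonoidClass.coe_finsetSum, IntermediateField.coe_smul,
      SubmonoidClass.coe_pow] at h2
    have h3 : ∀ i, algebraMap F Ω (g i / g j) * (Y : Ω) ^ (i : ℕ) =
        (algebraMap F Ω (g j))⁻¹ * (g i • (Y : Ω) ^ (i : ℕ)) := by
      intro i
      rw [Algebra.smul_def, map_div₀]
      ring
    simp only [AddSubmonoidClass.coe_finsetSum, ZeroMemClass.coe_zero, MulMemClass.coe_mul,
      SubmonoidClass.coe_pow, c, h3]
    rw [← Finset.mul_sum, h2, mul_zero]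

end Extension

end

section

open IntermediateField Module IsLocalRing

/-! ### Artin–Schreier equations over residue fields. -/

section ResidueCyclic

variable {F Ω : Type u} [Field F] [Field Ω] [Algebra F Ω] {O : ValuationSubring F}
  {W : ValuationSubring Ω} {r : ℕ} [Fact r.Prime] {ζ : Ω}

omit [Fact r.Prime] in
theorem finiteDimensional_adjoin_root [IsGalois F Ω] : FiniteDimensional F F⟮ζ⟯ :=
  adjoin.finiteDimensional (Algebra.IsSeparable.isIntegral F ζ)

theorem finrank_adjoin_root_lt [IsGalois F Ω] (hζ : IsPrimitiveRoot ζ r) : finrank F F⟮ζ⟯ < r := by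
  have hr : r.Prime := Fact.out
  rw [adjoin.finrank (Algebra.IsSeparable.isIntegral F ζ)]
  have h1 : Polynomial.aeval ζ (Polynomial.cyclotomic r F) = 0 := by
    rw [Polynomial.aeval_def, Polynomial.eval₂_eq_eval_map, Polynomial.map_cyclotomic]
    exact hζ.isRoot_cyclotomic hr.pos
  refine (Polynomial.natDegree_le_natDegree
    (minpoly.min F ζ (Polynomial.cyclotomic.monic r F) h1)).trans_lt ?_
  rw [Polynomial.natDegree_cyclotomic, Nat.totient_prime hr]
  exact Nat.sub_lt hr.pos one_pos

theorem cycloProj_mem_adjoin [IsGalois F Ω] {hζ : IsPrimitiveRoot ζ r} {z : (ZMod r)ˣ → Ω}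
    (hz : IsEquivariant F hζ z) : cycloProj z ∈ F⟮ζ⟯ :=
  prod_mem fun t _ => pow_mem (hz.mem_adjoin t) _

/-- If a field of characteristic prime to `r` has no Galois extension of degree `r`, the projection
of an equivariant family is an `r`-th power in the field of `r`-th roots of unity. -/
theorem IsEquivariant.exists_pow_eq [IsGalois F Ω] [IsSepClosed Ω] {hζ : IsPrimitiveRoot ζ r}
    {z : (ZMod r)ˣ → Ω} (hz : IsEquivariant F hζ z) (h0 : ∀ t, z t ≠ 0)
    (hno : ∀ E : IntermediateField F Ω, IsGalois F E → finrank F E ≠ r) :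
    ∃ β ∈ F⟮ζ⟯, β ^ r = cycloProj z := by
  have : NeZero (r : Ω) := hζ.neZero'
  obtain ⟨β, hβ⟩ := IsSepClosed.exists_pow_nat_eq (cycloProj z) r
  refine ⟨β, ?_, hβ⟩
  by_contra hβF
  obtain ⟨E, -, -, hE, hEr, -⟩ := hz.exists_isGalois_finrank_eq h0 hβ hβF
  exact hno E hE hEr

/-- The Artin–Schreier case, in equal characteristic. -/
theorem exists_pow_sub_self_of_charP [IsGalois F Ω] [IsSepClosed Ω] [CharP F r]
    (hno : ∀ E : IntermediateField F Ω, IsGalois F E → finrank F E ≠ r)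
    (a : ResidueField O) : ∃ c, c ^ r - c = a := by
  have hr : r.Prime := Fact.out
  obtain ⟨a, rfl⟩ := residue_surjective a
  have : CharP Ω r := charP_of_injective_algebraMap (algebraMap F Ω).injective r
  obtain ⟨β, hβ⟩ : ∃ β : Ω, β ^ r - β = algebraMap F Ω a := by
    obtain ⟨β, hβ⟩ := IsSepClosed.exists_root_C_mul_X_pow_add_C_mul_X_add_C (k := Ω) (n := r) 1 (-1)
      (-algebraMap F Ω a) (CharP.cast_eq_zero Ω r) hr.two_le (by simp)
    exact ⟨β, by linear_combination hβ⟩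
  have hβF : β ∈ (⊥ : IntermediateField F Ω) := by
    by_contra h
    obtain ⟨h1, h2⟩ := isGalois_of_artinSchreier hβ h
    exact hno _ h1 h2
  obtain ⟨b, rfl⟩ := mem_bot.1 hβF
  have hb : b ^ r - b = a := (algebraMap F Ω).injective (by rw [map_sub, map_pow, hβ])
  have hbO : b ∈ O := by
    by_contra hbO
    rw [← O.valuation_le_one_iff, not_le] at hbO
    have h1 : O.valuation b < O.valuation (b ^ r) := by
      rw [map_pow]
      exact lt_self_pow₀ hbO hr.one_lt
    have h2 := O.valuation.map_sub_eq_of_lt_right h1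
    have h3 := O.valuation_le_one a
    rw [← hb, O.valuation.map_sub_swap, h2] at h3
    exact (hbO.trans h1).not_ge h3
  refine ⟨residue O ⟨b, hbO⟩, ?_⟩
  rw [← map_pow, ← map_sub]
  exact congrArg _ (Subtype.ext hb)

/-- The first order expansion of `cycloProj` at `1`. -/
theorem exists_cycloProj_eq (W : ValuationSubring Ω) {lam : Ω} (hlam : W.valuation lam < 1)
    (w : (ZMod r)ˣ → W) (d : (ZMod r)ˣ → ResidueField W) (hd : ∀ t, residue W (w t) = d t) :
    ∃ D : W, cycloProj (fun t => 1 + lam * w t) = 1 + lam * D ∧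
      residue W D = ∑ t : (ZMod r)ˣ, (((t⁻¹ : (ZMod r)ˣ) : ZMod r).val : ResidueField W) * d t := by
  have hlamW : lam ∈ W := (W.valuation_le_one_iff _).1 hlam.le
  have hlam0 : residue W ⟨lam, hlamW⟩ = 0 := (residue_eq_zero_iff_valuation _).2 hlam
  have hpow : ∀ (t : (ZMod r)ˣ) (n : ℕ), ∃ D : W, (1 + lam * w t : Ω) ^ n = 1 + lam * D ∧
      residue W D = n * d t := by
    intro t n
    induction n with
    | zero => exact ⟨0, by simp, by simp⟩
    | succ n ih =>
      obtain ⟨D, hD, hDr⟩ := ih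
      refine ⟨D + w t + ⟨lam, hlamW⟩ * D * w t, ?_, ?_⟩
      · rw [pow_succ, hD]
        push_cast
        ring
      · rw [map_add, map_add, map_mul, map_mul, hlam0, hDr, hd]
        push_cast
        ring
  choose D hD hDr using hpow
  unfold cycloProj
  simp_rw [hD]
  have : ∀ s : Finset (ZMod r)ˣ, ∃ D' : W,
      ∏ t ∈ s, (1 + lam * (D t ((t⁻¹ : (ZMod r)ˣ) : ZMod r).val : Ω)) = 1 + lam * D' ∧
      residue W D' = ∑ t ∈ s, (((t⁻¹ : (ZMod r)ˣ) : ZMod r).val : ResidueField W) * d t := by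
    classical
    intro s
    induction s using Finset.induction_on with
    | empty =>
      refine ⟨0, ?_, ?_⟩
      · rw [Finset.prod_empty, ZeroMemClass.coe_zero, mul_zero, add_zero]
      · rw [Finset.sum_empty, map_zero]
    | insert a s ha ih =>
      obtain ⟨D', hD', hDr'⟩ := ih
      refine ⟨D a ((a⁻¹ : (ZMod r)ˣ) : ZMod r).val + D' +
        ⟨lam, hlamW⟩ * D a ((a⁻¹ : (ZMod r)ˣ) : ZMod r).val * D', ?_, ?_⟩
      · rw [Finset.prod_insert ha, hD']
        push_cast
        ring
      · rw [Finset.sum_insert ha, map_add, map_add, map_mul, map_mul, hlam0, hDr, hDr']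
        ring
  exact this Finset.univ

/-- The Artin–Schreier case, in mixed characteristic. -/
theorem exists_pow_sub_self_of_mixed [IsGalois F Ω] [IsSepClosed Ω] (h : Extends O W)
    (hF : (r : F) ≠ 0) [CharP (ResidueField O) r]
    (hno : ∀ E : IntermediateField F Ω, IsGalois F E → finrank F E ≠ r)
    (a : ResidueField O) : ∃ c, c ^ r - c = a := by
  have hr : r.Prime := Fact.out
  obtain ⟨a, rfl⟩ := residue_surjective a
  have hCκ : CharP (ResidueField W) r := charP_of_injective_ringHom h.residueMap.injective r
  have : NeZero (r : Ω) := ⟨by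
    rw [← map_natCast (algebraMap F Ω)]
    exact (map_ne_zero _).2 hF⟩
  obtain ⟨ζ, hζ⟩ := HasEnoughRootsOfUnity.exists_primitiveRoot Ω r
  have hζ1 : ζ - 1 ≠ 0 := sub_ne_zero.2 (hζ.ne_one hr.one_lt)
  have hζW : ζ ∈ W := (W.valuation_le_one_iff _).1 (valuation_root W.valuation hζ).le
  have hρW : ∀ i, rootQuot ζ i ∈ W := fun i =>
    (W.valuation_le_one_iff _).1 (valuation_rootQuot_le W.valuation hζ i)
  -- residues of roots of unity
  have hζr : residue W ⟨ζ, hζW⟩ = 1 := by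
    rw [← sub_eq_zero]
    refine eq_zero_of_pow_eq_zero (n := r) ?_
    rw [sub_pow_char, ← map_pow]
    have : (⟨ζ, hζW⟩ : W) ^ r = 1 := Subtype.ext hζ.pow_eq_one
    rw [this, map_one, one_pow, sub_self]
  have hlam : W.valuation (ζ - 1) < 1 := by
    rw [← residue_eq_zero_iff_valuation ⟨ζ - 1, sub_mem hζW (one_mem W)⟩]
    have : (⟨ζ - 1, sub_mem hζW (one_mem W)⟩ : W) = ⟨ζ, hζW⟩ - 1 := rfl
    rw [this, map_sub, map_one, hζr, sub_self]
  have hρr : ∀ i, residue W ⟨rootQuot ζ i, hρW i⟩ = i := by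
    intro i
    have : (⟨rootQuot ζ i, hρW i⟩ : W) = ∑ k ∈ Finset.range i, (⟨ζ, hζW⟩ : W) ^ k := by
      apply Subtype.ext
      rw [AddSubmonoidClass.coe_finsetSum]
      exact rootQuot_eq_sum (hζ.ne_one hr.one_lt) i
    rw [this, map_sum]
    simp_rw [map_pow, hζr, one_pow]
    simp
  set aW : W := ⟨algebraMap F Ω a, (h.mem_iff _).2 a.2⟩ with haW
  -- the equivariant family
  let f : Polynomial F := 1 + Polynomial.C (a : F) * (Polynomial.X - 1) ^ r
  let w : (ZMod r)ˣ → W := fun t => aW * ⟨rootQuot ζ (t : ZMod r).val, hρW _⟩ ^ r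
  -- At ζ ^ t, the polynomial X - 1 has the value (ζ - 1) times a `rootQuot` reducing to t. So the
  -- perturbation is (ζ - 1) ^ r times w t, and w t reduces to a t ^ r = a t.
  have hz : ∀ t : (ZMod r)ˣ, Polynomial.aeval (ζ ^ (t : ZMod r).val) f =
      1 + (ζ - 1) ^ r * w t := by
    intro t
    simp only [f, w, map_add, map_one, map_mul, map_pow, map_sub, Polynomial.aeval_C,
      Polynomial.aeval_X, rootQuot, MulMemClass.coe_mul, SubmonoidClass.coe_pow, div_pow, haW]
    field_simp
  have hlamr : W.valuation ((ζ - 1) ^ r) < 1 := by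
    rw [map_pow]
    exact pow_lt_one₀ zero_le hlam hr.ne_zero
  have hz0 : ∀ t : (ZMod r)ˣ, Polynomial.aeval (ζ ^ (t : ZMod r).val) f ≠ 0 := by
    intro t h0
    rw [hz] at h0
    have h1 : W.valuation ((ζ - 1) ^ r * w t) < 1 := by
      rw [map_mul]
      exact mul_lt_one_of_lt_of_le hlamr (W.valuation_le_one _)
    rw [eq_neg_of_add_eq_zero_right h0, Valuation.map_neg, map_one] at h1
    exact h1.false
  obtain ⟨β, hβF, hβ⟩ := (isEquivariant_aeval hζ f).exists_pow_eq hz0 hno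
  simp_rw [hz] at hβ
  obtain ⟨D, hD, hDr⟩ := exists_cycloProj_eq W hlamr w
    (fun t => residue W aW * (t : ZMod r).val) (fun t => by
      simp only [w]
      rw [map_mul, map_pow, hρr, natCast_pow_char])
  -- Each of the r - 1 terms is (1/t) a t = a, and r - 1 = -1 in the residue field.
  have hDr' : residue W D = -residue W aW := by
    rw [hDr]
    have : ∀ t : (ZMod r)ˣ, (((t⁻¹ : (ZMod r)ˣ) : ZMod r).val : ResidueField W) *
        (residue W aW * (t : ZMod r).val) = residue W aW := by
      intro t
      have h1 : (((t⁻¹ : (ZMod r)ˣ) : ZMod r).val : ZMod r) * (t : ZMod r).val = 1 := by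
        rw [ZMod.natCast_zmod_val, ZMod.natCast_zmod_val, ← Units.val_mul, inv_mul_cancel,
          Units.val_one]
      have h2 := congrArg (ZMod.castHom dvd_rfl (ResidueField W)) h1
      rw [map_mul, map_natCast, map_natCast, map_one] at h2
      linear_combination (residue W aW) * h2
    rw [Finset.sum_congr rfl fun t _ => this t, Finset.sum_const, Finset.card_univ, ZMod.card_units,
      nsmul_eq_mul, Nat.cast_sub hr.one_le, CharP.cast_eq_zero]
    ring
  rw [hD] at hβ
  -- In terms of Y the equation for β reads ∏ (Y - `rootQuot ζ i`) = D. The roots reduce to the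
  -- elements of the prime field, so its reduction is Y ^ r - Y = -a.
  set Y := (β - 1) / (ζ - 1) with hY
  have hprod : ∏ i ∈ Finset.range r, (Y - rootQuot ζ i) = D := by
    rw [prod_sub_rootQuot hζ, hβ]
    field_simp
    ring
  have hYW : Y ∈ W := by
    by_contra hYW
    rw [← W.valuation_le_one_iff, not_le] at hYW
    have h1 : ∀ i, 1 < W.valuation (Y - rootQuot ζ i) := by
      intro i
      rw [Valuation.map_sub_eq_of_lt_left]
      · exact hYW
      · exact (valuation_rootQuot_le W.valuation hζ i).trans_lt hYW
    have h2 := W.valuation_le_one D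
    rw [← hprod, map_prod, ← Finset.mul_prod_erase _ _ (Finset.mem_range.2 hr.pos)] at h2
    exact h2.not_gt (one_lt_mul_of_lt_of_le (h1 0) (Finset.one_le_prod' fun i _ => (h1 i).le))
  have hres : residue W ⟨Y, hYW⟩ ^ r - residue W ⟨Y, hYW⟩ = -residue W aW := by
    rw [← prod_range_sub_natCast, ← hDr']
    have : D = ∏ i ∈ Finset.range r, ((⟨Y, hYW⟩ : W) - ⟨rootQuot ζ i, hρW i⟩) := by
      apply Subtype.ext
      rw [SubmonoidClass.coe_finsetProd]
      exact hprod.symm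
    rw [this, map_prod]
    simp_rw [map_sub, hρr]
  -- degree considerations
  let := h.residueAlgebra
  by_contra hc
  have hAS : (-residue W ⟨Y, hYW⟩) ^ r - (-residue W ⟨Y, hYW⟩) =
      algebraMap (ResidueField O) (ResidueField W) (residue O a) := by
    have h1 := sub_pow_sub_self (r := r) 0 (residue W ⟨Y, hYW⟩)
    rw [zero_sub, hres, zero_pow hr.ne_zero] at h1
    rw [h1, sub_self, zero_sub, neg_neg]
    rfl
  have hbot : -residue W ⟨Y, hYW⟩ ∉ (⊥ : IntermediateField (ResidueField O) (ResidueField W)) := by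
    intro hmem
    obtain ⟨c, hc'⟩ := mem_bot.1 hmem
    refine hc ⟨c, (algebraMap (ResidueField O) (ResidueField W)).injective ?_⟩
    rw [map_sub, map_pow, hc', hAS]
  obtain ⟨-, hdeg⟩ := isGalois_of_artinSchreier hAS hbot
  have hfin := finiteDimensional_adjoin_root (F := F) (ζ := ζ)
  -- Since Y lies in F(ζ), of degree less than r, so does the degree of its residue over that of O;
  -- an unsolvable Artin–Schreier equation would give degree r.
  obtain ⟨p, hp0, hpdeg, hp⟩ := h.exists_polynomial_residue F⟮ζ⟯ (finrank_adjoin_root_lt hζ)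
    (-⟨Y, hYW⟩) (neg_mem (div_mem (sub_mem hβF (one_mem _))
      (sub_mem (mem_adjoin_simple_self F ζ) (one_mem _))))
  rw [map_neg] at hp
  have hpa : Polynomial.aeval (-residue W ⟨Y, hYW⟩) p = 0 := hp
  have hfin' : FiniteDimensional (ResidueField O) (ResidueField O)⟮-residue W ⟨Y, hYW⟩⟯ :=
    finite_of_finrank_pos (hdeg ▸ hr.pos)
  have hint : IsIntegral (ResidueField O) (-residue W ⟨Y, hYW⟩) :=
    isAlgebraic_iff_isIntegral.1 ⟨p, hp0, hpa⟩
  rw [adjoin.finrank hint] at hdeg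
  have := Polynomial.natDegree_le_of_dvd (minpoly.dvd _ _ hpa) hp0
  omega

end ResidueCyclic

end

section

open IntermediateField Module IsLocalRing

/-! ### Residue fields inherit the absence of Galois extensions of degree r. -/

section ResidueCyclic

variable {F Ω : Type u} [Field F] [Field Ω] [Algebra F Ω] {O : ValuationSubring F}
  {W : ValuationSubring Ω} {r : ℕ} [Fact r.Prime]

/-- An element of degree less than `r` whose `r`-th power `y` is in a field containing the `r`-th
roots of unity forces `y` to be an `r`-th power. -/
theorem exists_pow_eq_of_natDegree_lt {k M A : Type*} [Field k] [Field M] [Field A] [Algebra k M]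
    (ι : M →+* A) {y : M} {β : A} (hβ : β ^ r = ι y) {p : Polynomial k} (hp : p ≠ 0)
    (hpr : p.natDegree < r) (hpβ : p.eval₂ (ι.comp (algebraMap k M)) β = 0) : ∃ γ, γ ^ r = y := by
  have hr : r.Prime := Fact.out
  by_contra! hc
  have hirr := X_pow_sub_C_irreducible_of_prime hr hc
  let := ι.toAlgebra
  have hβ0 : Polynomial.aeval β (Polynomial.X ^ r - Polynomial.C y) = 0 := by
    rw [map_sub, map_pow, Polynomial.aeval_X, Polynomial.aeval_C, hβ]
    exact sub_self _
  have h1 := minpoly.eq_of_irreducible_of_monic hirr hβ0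
    (Polynomial.monic_X_pow_sub_C y hr.ne_zero)
  have h2 : Polynomial.aeval β (p.map (algebraMap k M)) = 0 := by
    rw [Polynomial.aeval_def, Polynomial.eval₂_map]
    exact hpβ
  have h3 := Polynomial.natDegree_le_of_dvd (minpoly.dvd _ _ h2)
    ((Polynomial.map_ne_zero_iff (algebraMap k M).injective).2 hp)
  rw [← h1, Polynomial.natDegree_X_pow_sub_C, Polynomial.natDegree_map] at h3
  omega

theorem IsPrimitiveRoot.of_prime_of_ne_one {M : Type*} [CommMonoid M] {x : M} (hx : x ^ r = 1)
    (h1 : x ≠ 1) : IsPrimitiveRoot x r := by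
  rw [IsPrimitiveRoot.iff_orderOf]
  exact orderOf_eq_prime hx h1

/-- An extension of degree r yields an equivariant family over the residue field whose product is
not an r-th power in the field of r-th roots of unity. Lifting the coefficients of its interpolating
polynomial to O gives an integral family over F, whose product is β ^ r with β in F(ζ). The residue
of β has degree less than r over the residue field, and this forces the original product to be an
r-th power after all. -/
theorem finrank_residueField_ne_of_natCast_ne_zero [IsGalois F Ω] [IsSepClosed Ω]
    (h : Extends O W) (hk : (r : ResidueField O) ≠ 0)
    (hno : ∀ E : IntermediateField F Ω, IsGalois F E → finrank F E ≠ r)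
    (E : Type u) [Field E] [Algebra (ResidueField O) E] [IsGalois (ResidueField O) E] :
    finrank (ResidueField O) E ≠ r := by
  intro hE
  have hr : r.Prime := Fact.out
  let k := ResidueField O
  let κ := ResidueField W
  let Ωk := SeparableClosure k
  have hΩr : NeZero (r : Ωk) := ⟨by
    rw [← map_natCast (algebraMap k Ωk)]
    exact (map_ne_zero _).2 hk⟩
  have hκr : (r : κ) ≠ 0 := by
    rw [← map_natCast h.residueMap]
    exact (map_ne_zero _).2 hk
  have hΩ : NeZero (r : Ω) := ⟨by
    intro h0
    have h1 : (r : W) = 0 := Subtype.ext ((map_natCast W.subtype r).trans h0)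
    exact hκr (by rw [← map_natCast (residue W), h1, map_zero])⟩
  obtain ⟨ζk, hζk⟩ := HasEnoughRootsOfUnity.exists_primitiveRoot Ωk r
  obtain ⟨ζ₀, hζ₀⟩ := HasEnoughRootsOfUnity.exists_primitiveRoot Ω r
  let e : E →ₐ[k] Ωk := IsSepClosed.lift
  let e' : E ≃ₐ[k] e.fieldRange := AlgEquiv.ofInjectiveField e
  have : IsGalois k e.fieldRange := IsGalois.of_algEquiv e'
  obtain ⟨z, hz, hz0, hzn⟩ := exists_isEquivariant_not_pow hζk e.fieldRange
    ((LinearEquiv.finrank_eq e'.toLinearEquiv).symm.trans hE)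
  obtain ⟨f', hf'⟩ := hz.exists_polynomial
  obtain ⟨g, rfl⟩ := Polynomial.map_surjective (residue O) residue_surjective f'
  let A := AlgebraicClosure κ
  let j : W →+* A := (algebraMap κ A).comp (residue W)
  let : Algebra k A := ((algebraMap κ A).comp h.residueMap).toAlgebra
  let ι : Ωk →ₐ[k] A := IsSepClosed.lift
  have hζ₀W : ζ₀ ∈ W := (W.valuation_le_one_iff _).1 (valuation_root W.valuation hζ₀).le
  let ζ₀' : W := ⟨ζ₀, hζ₀W⟩
  have hζ₀'r : ζ₀' ^ r = 1 := Subtype.ext hζ₀.pow_eq_one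
  have hj1 : j ζ₀' ≠ 1 := by
    intro h1
    have h2 : ∑ i ∈ Finset.range r, ζ₀' ^ i = 0 := by
      apply Subtype.ext
      rw [AddSubmonoidClass.coe_finsetSum]
      exact hζ₀.geom_sum_eq_zero hr.one_lt
    have h3 := congrArg j h2
    simp_rw [map_sum, map_pow, h1, one_pow, map_zero, Finset.sum_const, Finset.card_range,
      nsmul_eq_mul, mul_one] at h3
    refine hκr ((algebraMap κ A).injective ?_)
    rw [map_natCast, h3, map_zero]
  have hjr : j ζ₀' ^ r = 1 := by rw [← map_pow, hζ₀'r, map_one]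
  -- The lifted root of unity is chosen to reduce to the prescribed ζk; the algebraically closed
  -- field A contains both residue worlds and makes the comparison possible.
  obtain ⟨i, -, hi⟩ := (IsPrimitiveRoot.of_prime_of_ne_one hjr hj1).eq_pow_of_pow_eq_one
    (ξ := ι ζk) (by rw [← map_pow, hζk.pow_eq_one, map_one])
  let ζ' : W := ζ₀' ^ i
  have hjζ : j ζ' = ι ζk := by rw [map_pow, hi]
  have hζ : IsPrimitiveRoot (ζ' : Ω) r := by
    refine IsPrimitiveRoot.of_prime_of_ne_one ?_ fun h1 => ?_
    · have : ζ' ^ r = 1 := by rw [← pow_mul, mul_comm, pow_mul, hζ₀'r, one_pow]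
      exact_mod_cast congrArg Subtype.val this
    · have h2 : ζ' = 1 := Subtype.ext h1
      rw [h2, map_one, ← map_one ι] at hjζ
      exact hζk.ne_one hr.one_lt (ι.injective hjζ).symm
  let Z : (ZMod r)ˣ → W := fun t => g.eval₂ h.ringHom (ζ' ^ (t : ZMod r).val)
  have hZ : ∀ t : (ZMod r)ˣ, (Z t : Ω) =
      Polynomial.aeval ((ζ' : Ω) ^ (t : ZMod r).val) (g.map O.subtype) := by
    intro t
    have h1 := Polynomial.hom_eval₂ g h.ringHom W.subtype (ζ' ^ (t : ZMod r).val)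
    rw [Polynomial.aeval_def, Polynomial.eval₂_map]
    exact h1
  have hjZ : ∀ t, j (Z t) = ι (z t) := by
    intro t
    have h1 := Polynomial.hom_eval₂ g h.ringHom j (ζ' ^ (t : ZMod r).val)
    rw [map_pow, hjζ] at h1
    rw [← hf' t, ← Polynomial.aeval_algHom_apply, map_pow, Polynomial.aeval_def,
      Polynomial.eval₂_map]
    exact h1
  obtain ⟨β, hβF, hβ⟩ := (isEquivariant_aeval hζ (g.map O.subtype)).exists_pow_eq (fun t h0 => by
    rw [← hZ, ZeroMemClass.coe_eq_zero] at h0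
    have h1 := hjZ t
    rw [h0, map_zero] at h1
    exact hz0 t (ι.injective (h1.symm.trans (map_zero ι).symm))) hno
  simp_rw [← hZ] at hβ
  have hcyc : cycloProj (fun t => (Z t : Ω)) =
      ((∏ t, Z t ^ ((t⁻¹ : (ZMod r)ˣ) : ZMod r).val : W) : Ω) := by
    rw [SubmonoidClass.coe_finsetProd]
    rfl
  rw [hcyc] at hβ
  have hβW : β ∈ W := by
    rw [← W.valuation_le_one_iff, ← pow_le_one_iff_of_nonneg zero_le hr.ne_zero, ← map_pow, hβ]
    exact W.valuation_le_one _
  have hβ' : (⟨β, hβW⟩ : W) ^ r = ∏ t, Z t ^ ((t⁻¹ : (ZMod r)ˣ) : ZMod r).val := Subtype.ext hβ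
  have hfin := finiteDimensional_adjoin_root (F := F) (ζ := (ζ' : Ω))
  obtain ⟨p, hp0, hpr, hp⟩ := h.exists_polynomial_residue F⟮(ζ' : Ω)⟯ (finrank_adjoin_root_lt hζ)
    ⟨β, hβW⟩ hβF
  obtain ⟨γ, hγ⟩ := exists_pow_eq_of_natDegree_lt (r := r) (k := k) (M := k⟮ζk⟯) (A := A)
    (y := ⟨cycloProj z, cycloProj_mem_adjoin hz⟩) (β := j ⟨β, hβW⟩)
    ((ι.comp k⟮ζk⟯.val).toRingHom) (by
      rw [← map_pow, hβ', map_prod]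
      simp_rw [map_pow, hjZ, ← map_pow, ← map_prod]
      rfl) hp0 hpr (by
      have h1 := congrArg (algebraMap κ A) hp
      rw [Polynomial.hom_eval₂, map_zero] at h1
      have h2 : (ι.comp k⟮ζk⟯.val).toRingHom.comp (algebraMap k k⟮ζk⟯) =
          (algebraMap κ A).comp h.residueMap := (ι.comp k⟮ζk⟯.val).comp_algebraMap
      rw [h2]
      exact h1)
  exact hzn γ γ.2 (congrArg Subtype.val hγ)

/-- If a field has no Galois extension of prime degree `r`, neither has the residue field of any of
its valuation rings. -/
theorem finrank_residueField_ne [IsGalois F Ω] [IsSepClosed Ω] (O : ValuationSubring F)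
    (hno : ∀ E : IntermediateField F Ω, IsGalois F E → finrank F E ≠ r)
    (E : Type u) [Field E] [Algebra (ResidueField O) E] [IsGalois (ResidueField O) E] :
    finrank (ResidueField O) E ≠ r := by
  obtain ⟨W, h⟩ := exists_extends (Ω := Ω) O
  have hr : r.Prime := Fact.out
  by_cases hk : (r : ResidueField O) = 0
  · intro hE
    have hc : CharP (ResidueField O) r := (CharP.charP_iff_prime_eq_zero hr).2 hk
    obtain ⟨a, ha⟩ := exists_ne_pow_sub_self (r := r) hE
    by_cases hF : (r : F) = 0
    · have : CharP F r := (CharP.charP_iff_prime_eq_zero hr).2 hF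
      obtain ⟨c, hc⟩ := exists_pow_sub_self_of_charP hno a
      exact ha c hc
    · obtain ⟨c, hc⟩ := exists_pow_sub_self_of_mixed h hF hno a
      exact ha c hc
  · exact finrank_residueField_ne_of_natCast_ne_zero h hk hno E

end ResidueCyclic

end

section

open IntermediateField Module IsLocalRing

/-! ### The prime degree case of the bound on finite closures. -/

section DegreeBound

variable {F Ω : Type u} [Field F] [Field Ω] [Algebra F Ω] {r : ℕ} [Fact r.Prime]

/-- In characteristic `r`, a Galois extension of degree `r` has Galois extensions of degree `r`. -/
theorem exists_isGalois_finrank_eq_of_charP [IsGalois F Ω] [IsSepClosed Ω] [CharP F r]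
    (L : IntermediateField F Ω) [IsGalois F L] (hL : finrank F L = r) :
    ∃ E : IntermediateField L Ω, IsGalois L E ∧ finrank L E = r := by
  have hr : r.Prime := Fact.out
  have : FiniteDimensional F L := finite_of_finrank_pos (hL ▸ hr.pos)
  have : CharP L r := charP_of_injective_algebraMap (algebraMap F L).injective r
  by_contra! hno
  obtain ⟨a, ha⟩ := exists_ne_pow_sub_self (r := r) hL
  -- The trace is onto and commutes with x ↦ x ^ r - x, so a solution y for b in L gives a solution
  -- for a in F.
  obtain ⟨b, rfl⟩ := Algebra.trace_surjective F L a
  have : CharP Ω r := charP_of_injective_algebraMap (algebraMap F Ω).injective r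
  obtain ⟨β, hβ⟩ : ∃ β : Ω, β ^ r - β = algebraMap L Ω b := by
    obtain ⟨β, hβ⟩ := IsSepClosed.exists_root_C_mul_X_pow_add_C_mul_X_add_C (k := Ω) (n := r) 1 (-1)
      (-algebraMap L Ω b) (CharP.cast_eq_zero Ω r) hr.two_le (by simp)
    exact ⟨β, by linear_combination hβ⟩
  have hβF : β ∈ (⊥ : IntermediateField L Ω) := by
    by_contra h
    obtain ⟨h1, h2⟩ := isGalois_of_artinSchreier hβ h
    exact hno _ h1 h2
  obtain ⟨y, rfl⟩ := mem_bot.1 hβF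
  have hy : y ^ r - y = b := (algebraMap L Ω).injective (by rw [map_sub, map_pow, hβ])
  refine ha (Algebra.trace F L y) ((algebraMap F L).injective ?_)
  rw [map_sub, map_pow, trace_eq_sum_automorphisms, trace_eq_sum_automorphisms, sum_pow_char,
    ← Finset.sum_sub_distrib, ← hy]
  simp_rw [map_sub, map_pow]

/-- If `L / F` is Galois of prime degree `r` and `L` has no Galois extension of degree `r`,
then `r = 2` and `-1` is not a square in `F`. -/
theorem eq_two_and_not_sq [IsGalois F Ω] [IsSepClosed Ω]
    (L : IntermediateField F Ω) [IsGalois F L] (hL : finrank F L = r)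
    (hno : ∀ E : IntermediateField L Ω, IsGalois L E → finrank L E ≠ r) :
    r = 2 ∧ ∀ i : F, i ^ 2 ≠ -1 := by
  by_cases hF : (r : F) = 0
  · have : CharP F r := (CharP.charP_iff_prime_eq_zero Fact.out).2 hF
    obtain ⟨E, hE, hEr⟩ := exists_isGalois_finrank_eq_of_charP L hL
    exact absurd hEr (hno E hE)
  · have : NeZero (r : Ω) := ⟨by
      rw [← map_natCast (algebraMap F Ω)]
      exact (map_ne_zero _).2 hF⟩
    obtain ⟨ζ, hζ⟩ := HasEnoughRootsOfUnity.exists_primitiveRoot Ω r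
    exact eq_two_and_not_sq_of_primitiveRoot hζ L hL hno

end DegreeBound

/-! ### Weak approximation for independent valuation rings. -/

section Independent

variable {K : Type u} [Field K] {O₁ O₂ : ValuationSubring K}

/-- The set T of all t with t O₁ ⊆ O₂ is a module over both rings, so its ring of multipliers U
contains both and is K. If T had a nonzero element d, then T = K and O₂ would be trivial. -/
theorem Independent.exists_mul_notMem (h : Independent O₁ O₂) {d : K} (hd : d ≠ 0) :
    ∃ x ∈ O₁, d * x ∉ O₂ := by
  by_contra! hc
  let T : Set K := {t | ∀ x ∈ O₁, t * x ∈ O₂}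
  have hT0 : (0 : K) ∈ T := fun x _ => by rw [zero_mul]; exact O₂.zero_mem
  have hTadd : ∀ s ∈ T, ∀ t ∈ T, s + t ∈ T := fun s hs t ht x hx => by
    rw [add_mul]
    exact O₂.add_mem _ _ (hs x hx) (ht x hx)
  have hTneg : ∀ s ∈ T, -s ∈ T := fun s hs x hx => by
    rw [neg_mul]
    exact O₂.neg_mem _ (hs x hx)
  have h1 : ∀ y ∈ O₁, ∀ t ∈ T, y * t ∈ T := fun y hy t ht x hx => by
    rw [mul_comm y, mul_assoc]
    exact ht _ (O₁.mul_mem _ _ hy hx)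
  have h2 : ∀ y ∈ O₂, ∀ t ∈ T, y * t ∈ T := fun y hy t ht x hx => by
    rw [mul_assoc]
    exact O₂.mul_mem _ _ hy (ht x hx)
  let U : ValuationSubring K :=
    { carrier := {x | ∀ t ∈ T, x * t ∈ T}
      mul_mem' := fun {a b} ha hb t ht => by
        rw [mul_assoc]
        exact ha _ (hb t ht)
      one_mem' := fun t ht => by rwa [one_mul]
      add_mem' := fun {a b} ha hb t ht => by
        rw [add_mul]
        exact hTadd _ (ha t ht) _ (hb t ht)
      zero_mem' := fun t _ => by rwa [zero_mul]
      neg_mem' := fun {a} ha t ht => by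
        rw [neg_mul]
        exact hTneg _ (ha t ht)
      mem_or_inv_mem' := fun x => (O₁.mem_or_inv_mem x).imp (h1 x) (h1 _) }
  have hU : U = ⊤ := top_le_iff.1 (h.2.2 ▸ sup_le (show O₁ ≤ U from h1) (show O₂ ≤ U from h2))
  refine h.2.1 (top_le_iff.1 fun x _ => ?_)
  have hx : x * d⁻¹ ∈ U := hU ▸ ValuationSubring.mem_top _
  have h3 : x * d⁻¹ * d ∈ T := hx d hc
  rw [inv_mul_cancel_right₀ hd] at h3
  simpa using h3 1 O₁.one_mem

theorem exists_valuation_lt_one {O : ValuationSubring K} (h : O ≠ ⊤) :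
    ∃ m : K, m ≠ 0 ∧ O.valuation m < 1 := by
  by_contra! hc
  refine h (top_le_iff.1 fun x _ => ?_)
  by_cases hx : x = 0
  · exact hx ▸ O.zero_mem
  · have h1 := hc x⁻¹ (inv_ne_zero hx)
    rw [← O.valuation_le_one_iff]
    rw [map_inv₀] at h1
    exact (one_le_inv₀ (zero_lt_iff.2 ((map_ne_zero _).2 hx))).1 h1

theorem Independent.exists_lt_lt (h : Independent O₁ O₂) {d₁ d₂ : K} (h₁ : d₁ ≠ 0) (h₂ : d₂ ≠ 0) :
    ∃ u : K, O₁.valuation u < O₁.valuation d₁ ∧ O₂.valuation d₂ < O₂.valuation u := by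
  obtain ⟨m, hm0, hm⟩ := exists_valuation_lt_one h.1
  obtain ⟨x, hx, hx2⟩ := h.exists_mul_notMem (d := d₁ * m / d₂)
    (div_ne_zero (mul_ne_zero h₁ hm0) h₂)
  refine ⟨d₁ * m * x, ?_, ?_⟩
  · rw [map_mul, map_mul, mul_assoc]
    exact mul_lt_of_lt_one_right (zero_lt_iff.2 ((map_ne_zero _).2 h₁))
      (mul_lt_one_of_lt_of_le hm ((O₁.valuation_le_one_iff x).2 hx))
  · rw [← O₂.valuation_le_one_iff, not_le, div_mul_eq_mul_div, map_div₀,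
      one_lt_div₀ (zero_lt_iff.2 ((map_ne_zero _).2 h₂))] at hx2
    exact hx2

theorem exists_valuation_le_and_le (O : ValuationSubring K) {a b : K} (ha : a ≠ 0) (hb : b ≠ 0) :
    ∃ d : K, d ≠ 0 ∧ O.valuation d ≤ O.valuation a ∧ O.valuation d ≤ O.valuation b := by
  obtain h | h := le_total (O.valuation a) (O.valuation b)
  · exact ⟨a, ha, le_rfl, h⟩
  · exact ⟨b, hb, h, le_rfl⟩

/-- Weak approximation for two independent valuation rings. -/
theorem Independent.exists_approx (h : Independent O₁ O₂) (a₁ a₂ : K) {d₁ d₂ : K}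
    (h₁ : d₁ ≠ 0) (h₂ : d₂ ≠ 0) :
    ∃ x : K, O₁.valuation (x - a₁) < O₁.valuation d₁ ∧ O₂.valuation (x - a₂) < O₂.valuation d₂ := by
  obtain rfl | ha := eq_or_ne a₁ a₂
  · refine ⟨a₁, ?_, ?_⟩ <;> rw [sub_self, map_zero] <;> exact zero_lt_iff.2 ((map_ne_zero _).2 ‹_›)
  have ha' : a₁ - a₂ ≠ 0 := sub_ne_zero.2 ha
  obtain ⟨e₁, he₁, he₁1, he₁d⟩ := exists_valuation_le_and_le O₁ one_ne_zero (div_ne_zero h₁ ha')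
  obtain ⟨e₂, he₂, he₂1, he₂d⟩ := exists_valuation_le_and_le O₂ one_ne_zero (div_ne_zero h₂ ha')
  obtain ⟨u, hu₁, hu₂⟩ := h.exists_lt_lt he₁ (inv_ne_zero he₂)
  have hv₁ : O₁.valuation u < 1 := (hu₁.trans_le he₁1).trans_eq (map_one _)
  have hv₂ : 1 < O₂.valuation u := by
    refine lt_of_le_of_lt ?_ hu₂
    rw [map_inv₀, one_le_inv₀ (zero_lt_iff.2 ((map_ne_zero _).2 he₂))]
    exact he₂1.trans_eq (map_one _)
  have hw₁ : O₁.valuation (1 + u) = 1 := by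
    rw [Valuation.map_add_eq_of_lt_left, map_one]
    rwa [map_one]
  have hw₂ : O₂.valuation (1 + u) = O₂.valuation u := by
    rw [Valuation.map_add_eq_of_lt_right]
    rwa [map_one]
  have hne : 1 + u ≠ 0 := fun h0 => by
    rw [h0, map_zero] at hw₁
    exact zero_ne_one hw₁
  have hpos : ∀ (O : ValuationSubring K) {x : K}, x ≠ 0 → 0 < O.valuation x := fun O x hx =>
    zero_lt_iff.2 ((map_ne_zero _).2 hx)
  have hu0 : u ≠ 0 := fun h0 => by
    rw [h0, map_zero] at hv₂
    exact not_lt_zero hv₂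
  -- A weighted mean: u is small for O₁ and large for O₂, which pulls the value towards a₁ and a₂
  -- respectively.
  refine ⟨(a₁ + a₂ * u) / (1 + u), ?_, ?_⟩
  · have : (a₁ + a₂ * u) / (1 + u) - a₁ = -((a₁ - a₂) * (u / (1 + u))) := by
      field_simp
      ring
    rw [this, Valuation.map_neg, map_mul, map_div₀, hw₁, div_one]
    calc _ < O₁.valuation (a₁ - a₂) * O₁.valuation (d₁ / (a₁ - a₂)) :=
          mul_lt_mul_of_pos_left (hu₁.trans_le he₁d) (hpos O₁ ha')
      _ = _ := by rw [← map_mul, mul_div_cancel₀ _ ha']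
  · have : (a₁ + a₂ * u) / (1 + u) - a₂ = (a₁ - a₂) / (1 + u) := by
      field_simp
      ring
    rw [this, map_div₀, hw₂, div_lt_iff₀ (hpos O₂ hu0)]
    have h3 : O₂.valuation (a₁ - a₂) ≤ O₂.valuation d₂ * O₂.valuation e₂⁻¹ := by
      rw [map_inv₀, ← div_eq_mul_inv, le_div_iff₀ (hpos O₂ he₂)]
      calc _ ≤ O₂.valuation (a₁ - a₂) * O₂.valuation (d₂ / (a₁ - a₂)) := by gcongr
        _ = _ := by rw [← map_mul, mul_div_cancel₀ _ ha']
    exact h3.trans_lt (mul_lt_mul_of_pos_left hu₂ (hpos O₂ h₂))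

/-- Independence is inherited by algebraic extensions. -/
theorem Independent.of_extends (h : Independent O₁ O₂) {F : Type u} [Field F] [Algebra K F]
    [Algebra.IsAlgebraic K F] {W₁ W₂ : ValuationSubring F} (h₁ : Extends O₁ W₁)
    (h₂ : Extends O₂ W₂) : Independent W₁ W₂ := by
  have hne : ∀ {O : ValuationSubring K} {W : ValuationSubring F}, O ≠ ⊤ → Extends O W → W ≠ ⊤ := by
    rintro O W hO h rfl
    exact hO (top_le_iff.1 fun x _ => (h.mem_iff x).1 (ValuationSubring.mem_top _))
  refine ⟨hne h.1 h₁, hne h.2.1 h₂, top_le_iff.1 fun x _ => ?_⟩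
  set U := W₁ ⊔ W₂ with hU
  have hK : ∀ y : K, algebraMap K F y ∈ U := by
    have : U.comap (algebraMap K F) = ⊤ := by
      rw [← top_le_iff, ← h.2.2]
      refine sup_le (fun y hy => ?_) (fun y hy => ?_)
      · exact (le_sup_left : W₁ ≤ U) ((h₁.mem_iff y).2 hy)
      · exact (le_sup_right : W₂ ≤ U) ((h₂.mem_iff y).2 hy)
    intro y
    have h3 : y ∈ U.comap (algebraMap K F) := this ▸ ValuationSubring.mem_top y
    exact h3
  -- U contains the image of K, so x is integral over U, and valuation rings are integrally closed.
  obtain ⟨p, hp, hpx⟩ := isAlgebraic_iff_isIntegral.1 (Algebra.IsAlgebraic.isAlgebraic (R := K) x)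
  let φ : K →+* U := (algebraMap K F).codRestrict U.toSubring hK
  have hint : IsIntegral U x := by
    refine ⟨p.map φ, hp.map φ, ?_⟩
    rw [Polynomial.eval₂_map]
    exact hpx
  obtain ⟨y, rfl⟩ := IsIntegrallyClosed.isIntegral_iff.1 hint
  exact y.2

end Independent

end

section

open IntermediateField Module IsLocalRing

/-! ### Independent invariant valuation rings exclude Galois extensions of degree r. -/

section Approximation

variable {F Ω : Type u} [Field F] [Field Ω] [Algebra F Ω] {O : ValuationSubring F}
  {W : ValuationSubring Ω}

theorem Extends.valuation_lt_one_iff (h : Extends O W) (x : F) :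
    W.valuation (algebraMap F Ω x) < 1 ↔ O.valuation x < 1 := by
  obtain rfl | hx := eq_or_ne x 0
  · simp
  have key : ∀ {L : Type u} [Field L] (A : ValuationSubring L) {y : L}, y ≠ 0 →
      (A.valuation y < 1 ↔ ¬ A.valuation y⁻¹ ≤ 1) := fun A y hy => by
    rw [not_le, map_inv₀, one_lt_inv₀ (zero_lt_iff.2 ((map_ne_zero _).2 hy))]
  rw [key W ((map_ne_zero _).2 hx), key O hx, ← map_inv₀, h.valuation_le_one_iff,
    O.valuation_le_one_iff]

theorem Extends.valuation_lt_iff (h : Extends O W) {x y : F} (hy : y ≠ 0) :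
    W.valuation (algebraMap F Ω x) < W.valuation (algebraMap F Ω y) ↔
      O.valuation x < O.valuation y := by
  rw [← div_lt_one₀ (zero_lt_iff.2 ((map_ne_zero O.valuation).2 hy)), ← map_div₀,
    ← h.valuation_lt_one_iff, map_div₀, map_div₀,
    div_lt_one₀ (zero_lt_iff.2 ((map_ne_zero W.valuation).2 ((map_ne_zero (algebraMap F Ω)).2 hy)))]

theorem Extends.mem_of_isIntegral (h : Extends O W) {x : Ω}
    (hx : ((algebraMap F Ω).comp O.subtype).IsIntegralElem x) : x ∈ W := by
  obtain ⟨p, hp, hpx⟩ := hx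
  have hint : IsIntegral W x := by
    refine ⟨p.map h.ringHom, hp.map _, ?_⟩
    rw [Polynomial.eval₂_map]
    exact hpx
  obtain ⟨y, rfl⟩ := IsIntegrallyClosed.isIntegral_iff.1 hint
  exact y.2

/-- Finitely many nonzero elements of an algebraic extension are bounded below by an element of the
base field. -/
theorem Extends.exists_valuation_le [Algebra.IsAlgebraic F Ω] (h : Extends O W) {ι : Type*}
    [Finite ι] (y : ι → Ω) (hy : ∀ i, y i ≠ 0) :
    ∃ c : F, c ≠ 0 ∧ ∀ i, W.valuation (algebraMap F Ω c) ≤ W.valuation (y i) := by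
  classical
  have := Fintype.ofFinite ι
  let : Algebra O Ω := ((algebraMap F Ω).comp O.subtype).toAlgebra
  have : IsScalarTower O F Ω := IsScalarTower.of_algebraMap_eq fun _ => rfl
  have : Algebra.IsAlgebraic O F := IsLocalization.isAlgebraic F (nonZeroDivisors O)
  have := Algebra.IsAlgebraic.trans O F Ω
  -- A common denominator c makes every c / y i integral over O, hence an element of W; this is the
  -- desired bound.
  obtain ⟨c, hc, hcy⟩ := Algebra.IsAlgebraic.exists_integral_multiples (R := O)
    (Finset.univ.image fun i => (y i)⁻¹)
  refine ⟨c, fun h0 => hc (Subtype.ext h0), fun i => ?_⟩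
  have h1 := h.mem_of_isIntegral (hcy _ (Finset.mem_image_of_mem _ (Finset.mem_univ i)))
  rw [Algebra.smul_def, ← W.valuation_le_one_iff, map_mul, map_inv₀, ← div_eq_mul_inv,
    div_le_one₀ (zero_lt_iff.2 ((map_ne_zero _).2 (hy i)))] at h1
  exact h1

theorem valuation_aeval_sub_lt {f g : Polynomial F} {c : F} (h : Extends O W)
    (hfg : ∀ i, O.valuation ((g - f).coeff i) < O.valuation c) {ξ : Ω} (hξ : W.valuation ξ = 1) :
    W.valuation (Polynomial.aeval ξ g - Polynomial.aeval ξ f) < W.valuation (algebraMap F Ω c) := by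
  have hc : c ≠ 0 := by
    rintro rfl
    exact not_lt_zero ((hfg 0).trans_eq (map_zero _))
  have hc' : W.valuation (algebraMap F Ω c) ≠ 0 :=
    (map_ne_zero _).2 ((map_ne_zero (algebraMap F Ω)).2 hc)
  rw [← map_sub, Polynomial.aeval_eq_sum_range]
  refine Valuation.map_sum_lt _ hc' fun i _ => ?_
  rw [Algebra.smul_def, map_mul, map_pow, hξ, one_pow, mul_one, h.valuation_lt_iff hc]
  exact hfg i

theorem Independent.exists_polynomial_approx {O₁ O₂ : ValuationSubring F} (h : Independent O₁ O₂)
    (f₁ f₂ : Polynomial F) {d₁ d₂ : F} (h₁ : d₁ ≠ 0) (h₂ : d₂ ≠ 0) :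
    ∃ g : Polynomial F, (∀ i, O₁.valuation ((g - f₁).coeff i) < O₁.valuation d₁) ∧
      ∀ i, O₂.valuation ((g - f₂).coeff i) < O₂.valuation d₂ := by
  choose x hx₁ hx₂ using fun i => h.exists_approx (f₁.coeff i) (f₂.coeff i) h₁ h₂
  set n := max f₁.natDegree f₂.natDegree + 1 with hn
  have hcoeff : ∀ i, (∑ j ∈ Finset.range n, Polynomial.C (x j) * Polynomial.X ^ j).coeff i =
      if i < n then x i else 0 := by
    intro i
    simp [Polynomial.finsetSum_coeff, Polynomial.coeff_C_mul, Polynomial.coeff_X_pow]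
  refine ⟨∑ j ∈ Finset.range n, Polynomial.C (x j) * Polynomial.X ^ j, fun i => ?_, fun i => ?_⟩
  all_goals
    rw [Polynomial.coeff_sub, hcoeff]
    split_ifs with hi
    · first | exact hx₁ i | exact hx₂ i
    · rw [Polynomial.coeff_eq_zero_of_natDegree_lt (by omega), sub_zero, map_zero]
      exact zero_lt_iff.2 ((map_ne_zero _).2 ‹_›)

theorem IsEquivariant.div {r : ℕ} [Fact r.Prime] {ζ : Ω} {hζ : IsPrimitiveRoot ζ r}
    {z z' : (ZMod r)ˣ → Ω} (hz : IsEquivariant F hζ z) (hz' : IsEquivariant F hζ z') :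
    IsEquivariant F hζ (fun t => z t / z' t) := fun σ t => by
  rw [map_div₀, hz, hz']

/-- A field with two independent valuation rings, both of which extend uniquely to all Galois
extensions of prime degree `r`, has no Galois extensions of degree `r`. -/
theorem Independent.finrank_ne [IsGalois F Ω] [IsSepClosed Ω] {r : ℕ} [Fact r.Prime]
    {O₁ O₂ : ValuationSubring F} (h : Independent O₁ O₂) {W₁ W₂ : ValuationSubring Ω}
    (h₁ : Extends O₁ W₁) (h₂ : Extends O₂ W₂)
    (hW₁ : ∀ E : IntermediateField F Ω, IsGalois F E → finrank F E = r →
      ∀ σ : Ω ≃ₐ[F] Ω, ∀ x ∈ E, x ∈ W₁ → σ x ∈ W₁)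
    (hW₂ : ∀ E : IntermediateField F Ω, IsGalois F E → finrank F E = r →
      ∀ σ : Ω ≃ₐ[F] Ω, ∀ x ∈ E, x ∈ W₂ → σ x ∈ W₂)
    (L : IntermediateField F Ω) [IsGalois F L] : finrank F L ≠ r := by
  intro hL
  have hr : r.Prime := Fact.out
  by_cases hF : (r : F) = 0
  · have : CharP F r := (CharP.charP_iff_prime_eq_zero hr).2 hF
    have hAS : ∀ {O : ValuationSubring F} {W : ValuationSubring Ω}, Extends O W →
        (∀ E : IntermediateField F Ω, IsGalois F E → finrank F E = r →
          ∀ σ : Ω ≃ₐ[F] Ω, ∀ x ∈ E, x ∈ W → σ x ∈ W) → ∀ b, O.valuation b < 1 →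
        ∃ c, c ^ r - c = b := by
      intro O W h hW b hb
      obtain ⟨β, hβ⟩ : ∃ β : Ω, β ^ r - β = algebraMap F Ω b := by
        obtain ⟨β, hβ⟩ := IsSepClosed.exists_root_C_mul_X_pow_add_C_mul_X_add_C (k := Ω) (n := r)
          1 (-1) (-algebraMap F Ω b)
          (by rw [← map_natCast (algebraMap F Ω), hF, map_zero]) hr.two_le (by simp)
        exact ⟨β, by linear_combination hβ⟩
      obtain ⟨c, rfl⟩ := mem_bot.1 (mem_bot_of_artinSchreier_of_valuation_lt hβ W hW
        ((h.valuation_lt_one_iff b).2 hb))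
      exact ⟨c, (algebraMap F Ω).injective (by rw [map_sub, map_pow, hβ])⟩
    obtain ⟨a, ha⟩ := exists_ne_pow_sub_self (r := r) hL
    -- b is close to a for O₁ and to 0 for O₂, so both b - a and b have the form c ^ r - c, and
    -- hence so does a.
    obtain ⟨b, hb₁, hb₂⟩ := h.exists_approx a 0 (one_ne_zero) (one_ne_zero)
    rw [map_one] at hb₁ hb₂
    rw [sub_zero] at hb₂
    obtain ⟨c, hc⟩ := hAS h₁ hW₁ _ hb₁
    obtain ⟨c', hc'⟩ := hAS h₂ hW₂ _ hb₂
    refine ha (c' - c) ?_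
    rw [sub_pow_char]
    linear_combination hc' - hc
  · have : NeZero (r : Ω) := ⟨by
      rw [← map_natCast (algebraMap F Ω)]
      exact (map_ne_zero _).2 hF⟩
    obtain ⟨ζ, hζ⟩ := HasEnoughRootsOfUnity.exists_primitiveRoot Ω r
    obtain ⟨z, hz, hz0, hzn⟩ := exists_isEquivariant_not_pow hζ L hL
    obtain ⟨f, hf⟩ := hz.exists_polynomial
    have hζ1 : ζ - 1 ≠ 0 := sub_ne_zero.2 (hζ.ne_one hr.one_lt)
    -- The factor z t is included so that after division by z t the error is still below the
    -- threshold (ζ - 1) ^ r.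
    obtain ⟨c₁, hc₁, hc₁le⟩ := h₁.exists_valuation_le (fun t => z t * (ζ - 1) ^ r)
      fun t => mul_ne_zero (hz0 t) (pow_ne_zero _ hζ1)
    obtain ⟨c₂, hc₂, hc₂le⟩ := h₂.exists_valuation_le (fun _ : Unit => (ζ - 1) ^ r)
      fun t => pow_ne_zero _ hζ1
    -- The values of g form a family y close to z for W₁ and to 1 for W₂. So y/z and y both have
    -- r-th powers as products, and by multiplicativity so does z.
    obtain ⟨g, hg₁, hg₂⟩ := h.exists_polynomial_approx f 1 hc₁ hc₂
    set y : (ZMod r)ˣ → Ω := fun t => Polynomial.aeval (ζ ^ (t : ZMod r).val) g with hy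
    have hyE : IsEquivariant F hζ y := isEquivariant_aeval hζ g
    have hval : ∀ (W : ValuationSubring Ω) (t : (ZMod r)ˣ),
        W.valuation (ζ ^ (t : ZMod r).val) = 1 := fun W t => by
      rw [map_pow, valuation_root _ hζ, one_pow]
    have hle : ∀ W : ValuationSubring Ω, W.valuation (ζ - 1) ^ r ≤ 1 := fun W => by
      refine pow_le_one₀ zero_le ?_
      refine (W.valuation.map_sub _ _).trans ?_
      rw [valuation_root _ hζ, map_one, max_self]
    have hpos : ∀ W : ValuationSubring Ω, W.valuation (ζ - 1) ^ r ≠ 0 := fun W =>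
      pow_ne_zero _ ((map_ne_zero _).2 hζ1)
    have hy₂ : ∀ t, W₂.valuation (y t - 1) < W₂.valuation (ζ - 1) ^ r := by
      intro t
      have := (valuation_aeval_sub_lt h₂ hg₂ (hval W₂ t)).trans_le (hc₂le ())
      rwa [map_one, map_pow] at this
    have hy₁ : ∀ t, W₁.valuation (y t / z t - 1) < W₁.valuation (ζ - 1) ^ r := by
      intro t
      have := (valuation_aeval_sub_lt h₁ hg₁ (hval W₁ t)).trans_le (hc₁le t)
      rw [hf, map_mul, map_pow, mul_comm, ← div_lt_iff₀
        (zero_lt_iff.2 ((map_ne_zero _).2 (hz0 t))), ← map_div₀, sub_div, div_self (hz0 t)] at this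
      exact this
    have hne : ∀ {W : ValuationSubring Ω} {x : Ω}, W.valuation (x - 1) < W.valuation (ζ - 1) ^ r →
        x ≠ 0 := by
      rintro W x hx rfl
      rw [zero_sub, Valuation.map_neg, map_one] at hx
      exact (hx.trans_le (hle W)).false
    have hproj : ∀ (W : ValuationSubring Ω) (x : (ZMod r)ˣ → Ω),
        (∀ t, W.valuation (x t - 1) < W.valuation (ζ - 1) ^ r) →
        W.valuation (cycloProj x - 1) < W.valuation (ζ - 1) ^ r := by
      intro W x hx
      refine valuation_prod_sub_one_lt _ _ _ _ (hpos W) (hle W) fun t _ => ?_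
      rw [← Finset.card_range ((t⁻¹ : (ZMod r)ˣ) : ZMod r).val, ← Finset.prod_const]
      exact valuation_prod_sub_one_lt _ _ _ _ (hpos W) (hle W) fun _ _ => hx t
    have hy0 : ∀ t, y t ≠ 0 := fun t => hne (hy₂ t)
    have hyz0 : ∀ t, y t / z t ≠ 0 := fun t => hne (hy₁ t)
    obtain ⟨β₁, hβ₁⟩ := IsSepClosed.exists_pow_nat_eq (cycloProj fun t => y t / z t) r
    obtain ⟨β₂, hβ₂⟩ := IsSepClosed.exists_pow_nat_eq (cycloProj y) r
    have hm₁ := (hyE.div hz).mem_adjoin_of_valuation_lt hyz0 hβ₁ W₁ hW₁ (hproj W₁ _ hy₁)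
    have hm₂ := hyE.mem_adjoin_of_valuation_lt hy0 hβ₂ W₂ hW₂ (hproj W₂ _ hy₂)
    refine hzn (β₂ / β₁) (div_mem hm₂ hm₁) ?_
    have h3 : cycloProj (fun t => y t / z t) * cycloProj z = cycloProj y := by
      rw [← cycloProj_mul]
      exact congrArg cycloProj (funext fun t => div_mul_cancel₀ _ (hz0 t))
    rw [div_pow, hβ₁, hβ₂, ← h3, mul_div_cancel_left₀ _ (cycloProj_ne_zero hyz0)]

end Approximation

end

section

open IntermediateField Module IsLocalRing

/-! ### Formal properties of classes of finite groups. -/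

section GroupClass

variable {C : GroupClass.{u}} {G H : Type u} [Group G] [Group H]

theorem GroupClass.IsClass.of_injective (hC : C.IsClass) (f : G →* H) (hf : Function.Injective f)
    (hH : C H) : C G :=
  hC.iso _ _ (MonoidHom.ofInjective hf).symm (hC.subgroup H f.range hH)

theorem GroupClass.IsClass.of_surjective (hC : C.IsClass) (f : G →* H)
    (hf : Function.Surjective f) (hG : C G) : C H :=
  hC.iso _ _ (QuotientGroup.quotientKerEquivOfSurjective f hf) (hC.quotient G f.ker hG)

theorem GroupClass.IsClass.of_subsingleton (hC : C.IsClass) (hG : C G) [Subsingleton H] : C H :=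
  hC.of_surjective (1 : G →* H) (fun _ => ⟨1, Subsingleton.elim _ _⟩) hG

/-- By Cauchy a group in C whose order is divisible by r has a subgroup of order r. In this way
every prime met in a Galois group supplies degree r extensions to work with. -/
theorem GroupClass.IsClass.of_card_eq_prime (hC : C.IsClass) (hG : C G) {r : ℕ} [Fact r.Prime]
    (hr : r ∣ Nat.card G) (hH : Nat.card H = r) : C H := by
  have := hC.finite G hG
  obtain ⟨g, hg⟩ := exists_prime_orderOf_dvd_card' r hr
  exact hC.iso _ _ (mulEquivOfPrimeCardEq (p := r) (by rw [Nat.card_zpowers, hg]) hH)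
    (hC.subgroup G (Subgroup.zpowers g) hG)

/-- The subgroup `A` is normal, and the quotient by `A` belongs to the class `C`. -/
def GroupClass.QuotientMem (C : GroupClass.{u}) (A : Subgroup G) : Prop :=
  ∃ _ : A.Normal, C (G ⧸ A)

theorem GroupClass.IsClass.quotientMem_ker_iff (hC : C.IsClass) (f : G →* H)
    (hf : Function.Surjective f) : C.QuotientMem f.ker ↔ C H := by
  let e := QuotientGroup.quotientKerEquivOfSurjective f hf
  exact ⟨fun ⟨_, h⟩ => hC.iso _ _ e h, fun h => ⟨inferInstance, hC.iso _ _ e.symm h⟩⟩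

theorem GroupClass.IsClass.quotientMem_ker (hC : C.IsClass) (f : G →* H) (hH : C H) :
    C.QuotientMem f.ker :=
  ⟨inferInstance, hC.of_injective (QuotientGroup.kerLift f) (QuotientGroup.kerLift_injective f) hH⟩

theorem GroupClass.IsClass.quotientMem_mono (hC : C.IsClass) {A B : Subgroup G} [hB : B.Normal]
    (hAB : A ≤ B) (hA : C.QuotientMem A) : C.QuotientMem B := by
  obtain ⟨_, hA⟩ := hA
  exact ⟨hB, hC.of_surjective (QuotientGroup.map A B (MonoidHom.id G) hAB) (fun x => by
    obtain ⟨x, rfl⟩ := QuotientGroup.mk_surjective x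
    exact ⟨x, rfl⟩) hA⟩

/-- G/(A ∩ B) is an extension of G/A by a kernel that embeds into G/B. -/
theorem GroupClass.IsClass.quotientMem_inf (hC : C.IsClass) {A B : Subgroup G}
    (hA : C.QuotientMem A) (hB : C.QuotientMem B) : C.QuotientMem (A ⊓ B) := by
  obtain ⟨_, hA⟩ := hA
  obtain ⟨_, hB⟩ := hB
  refine ⟨inferInstance, ?_⟩
  let f : G ⧸ (A ⊓ B) →* G ⧸ A := QuotientGroup.map _ _ (MonoidHom.id G) inf_le_left
  let g : G ⧸ (A ⊓ B) →* G ⧸ B := QuotientGroup.map _ _ (MonoidHom.id G) inf_le_right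
  have hfs : Function.Surjective f := fun x => by
    obtain ⟨x, rfl⟩ := QuotientGroup.mk_surjective x
    exact ⟨x, rfl⟩
  refine hC.extension _ f.ker (hC.of_injective (g.comp f.ker.subtype) ?_ hB)
    (hC.iso _ _ (QuotientGroup.quotientKerEquivOfSurjective f hfs).symm hA)
  rw [injective_iff_map_eq_one]
  rintro ⟨x, hx⟩ hgx
  obtain ⟨x, rfl⟩ := QuotientGroup.mk_surjective x
  apply Subtype.ext
  have h1 : x ∈ A := (QuotientGroup.eq_one_iff x).1 hx
  have h2 : x ∈ B := (QuotientGroup.eq_one_iff x).1 hgx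
  exact (QuotientGroup.eq_one_iff x).2 ⟨h1, h2⟩

theorem GroupClass.IsClass.quotientMem_top (hC : C.IsClass) (h1 : C PUnit) :
    C.QuotientMem (⊤ : Subgroup G) :=
  have := QuotientGroup.subsingleton_quotient_top (G := G)
  ⟨inferInstance, hC.of_subsingleton h1⟩

theorem GroupClass.IsClass.quotientMem_finset_inf (hC : C.IsClass) (h1 : C PUnit) {ι : Type*}
    (s : Finset ι) (A : ι → Subgroup G) (hA : ∀ i ∈ s, C.QuotientMem (A i)) :
    C.QuotientMem (s.inf A) := by
  classical
  induction s using Finset.induction_on with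
  | empty => exact hC.quotientMem_top h1
  | insert a s ha ih =>
    rw [Finset.inf_insert]
    exact hC.quotientMem_inf (hA a (Finset.mem_insert_self a s))
      (ih fun i hi => hA i (Finset.mem_insert_of_mem hi))

end GroupClass

/-! ### The maximal C-extension inside a Galois extension. -/

section Closure

variable {C : GroupClass.{u}} {K Ω : Type u} [Field K] [Field Ω] [Algebra K Ω]

/-- The compositum of all finite Galois extensions inside `Ω` with group in `C`. -/
def relClosure (C : GroupClass.{u}) (K Ω : Type u) [Field K] [Field Ω] [Algebra K Ω] :
    IntermediateField K Ω :=
  sSup {L | FiniteDimensional K L ∧ IsGalois K L ∧ C (L ≃ₐ[K] L)}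

theorem quotientMem_fixingSubgroup_iff [Normal K Ω] (hC : C.IsClass) (L : IntermediateField K Ω)
    [Normal K L] : C.QuotientMem L.fixingSubgroup ↔ C (L ≃ₐ[K] L) := by
  rw [← L.restrictNormalHom_ker]
  exact hC.quotientMem_ker_iff _ (AlgEquiv.restrictNormalHom_surjective Ω)

instance isGalois_relClosure [IsGalois K Ω] : IsGalois K (relClosure C K Ω) := by
  have : Normal K (relClosure C K Ω) := by
    rw [relClosure, sSup_eq_iSup']
    exact normal_iSup (h := fun i => i.2.2.1.to_normal)
  exact ⟨⟩

/-- Finite composita of C-extensions are C-extensions by `GroupClass.IsClass.quotientMem_inf`, and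
each of finitely many generators lies in such a compositum. -/
theorem exists_le_of_le_relClosure [IsGalois K Ω] (hC : C.IsClass) (h1 : C PUnit)
    (L : IntermediateField K Ω) [FiniteDimensional K L] (hL : L ≤ relClosure C K Ω) :
    ∃ M : IntermediateField K Ω, L ≤ M ∧ FiniteDimensional K M ∧ IsGalois K M ∧
      C (M ≃ₐ[K] M) := by
  let S := {L : IntermediateField K Ω // FiniteDimensional K L ∧ IsGalois K L ∧ C (L ≃ₐ[K] L)}
  classical
  have hsup : ∀ s : Finset S, FiniteDimensional K ↥(s.sup fun M => M.1) ∧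
      IsGalois K ↥(s.sup fun M => M.1) ∧
      C (↥(s.sup fun M => M.1) ≃ₐ[K] ↥(s.sup fun M => M.1)) := by
    intro s
    induction s using Finset.induction_on with
    | empty =>
      rw [Finset.sup_empty]
      refine ⟨inferInstance, inferInstance, ?_⟩
      rw [← quotientMem_fixingSubgroup_iff hC]
      have : (⊥ : IntermediateField K Ω).fixingSubgroup = ⊤ := fixingSubgroup_bot
      rw [this]
      exact hC.quotientMem_top h1
    | insert a s ha ih =>
      rw [Finset.sup_insert]
      obtain ⟨hs1, hs2, hs3⟩ := ih
      obtain ⟨a, ha1, ha2, ha3⟩ := a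
      have : Normal K ↥(a ⊔ s.sup fun M => M.1) := inferInstance
      refine ⟨inferInstance, ⟨⟩, ?_⟩
      rw [← quotientMem_fixingSubgroup_iff hC, fixingSubgroup_sup]
      exact hC.quotientMem_inf ((quotientMem_fixingSubgroup_iff hC _).2 ha3)
        ((quotientMem_fixingSubgroup_iff hC _).2 hs3)
  obtain ⟨t, rfl⟩ := (essFiniteType_iff.1 inferInstance : L.FG)
  have hx : ∀ x ∈ t, ∃ s : Finset S, x ∈ s.sup fun M => M.1 := by
    intro x hx
    have h2 := hL (subset_adjoin K _ hx)
    rw [relClosure, sSup_eq_iSup'] at h2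
    obtain ⟨s, hs⟩ := exists_finset_of_mem_iSup h2
    rw [← Finset.sup_eq_iSup] at hs
    exact ⟨s, hs⟩
  choose! s hs using hx
  refine ⟨(t.biUnion s).sup fun M => M.1, ?_, hsup _⟩
  rw [adjoin_le_iff]
  intro x hx
  have h3 : ((s x).sup fun M => M.1) ≤ (t.biUnion s).sup fun M => M.1 :=
    Finset.sup_mono (Finset.subset_biUnion_of_mem s hx)
  exact h3 (hs x hx)

theorem mem_of_le_relClosure [IsGalois K Ω] (hC : C.IsClass) (h1 : C PUnit)
    (L : IntermediateField K Ω) [FiniteDimensional K L] [IsGalois K L]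
    (hL : L ≤ relClosure C K Ω) : C (L ≃ₐ[K] L) := by
  obtain ⟨M, hLM, -, hM, hM'⟩ := exists_le_of_le_relClosure hC h1 L hL
  rw [← quotientMem_fixingSubgroup_iff hC] at hM' ⊢
  have : L.fixingSubgroup.Normal := L.restrictNormalHom_ker ▸ inferInstance
  exact hC.quotientMem_mono (fixingSubgroup_antitone hLM) hM'

theorem le_relClosure (L : IntermediateField K Ω) [FiniteDimensional K L] [IsGalois K L]
    (hL : C (L ≃ₐ[K] L)) : L ≤ relClosure C K Ω :=
  le_sSup ⟨inferInstance, inferInstance, hL⟩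

/-- The field `K^c` has no proper Galois extension with group in `C`, and more generally `K^c`
contains the `C`-extensions of its subfields. -/
theorem restrictScalars_le_relClosure [IsGalois K Ω] (hC : C.IsClass) (h1 : C PUnit)
    {F : IntermediateField K Ω} (hF : F ≤ relClosure C K Ω) (E : IntermediateField F Ω)
    [IsGalois F E] (hE : C (E ≃ₐ[F] E)) : E.restrictScalars K ≤ relClosure C K Ω := by
  intro α hα
  have hα' : α ∈ E := hα
  have : FiniteDimensional K K⟮α⟯ :=
    adjoin.finiteDimensional (Algebra.IsSeparable.isIntegral K α)
  -- Q is the normal closure of K(α). Its group is an extension of the group of a subfield of K^c by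
  -- the image of N, the group fixing K^c, and both parts belong to C.
  let Q : IntermediateField K Ω := normalClosure K K⟮α⟯ Ω
  have hQn : Normal K Q := inferInstance
  have hQ : IsGalois K Q := ⟨⟩
  have hQf : FiniteDimensional K Q := inferInstance
  have hconj : ∀ σ : Ω ≃ₐ[K] Ω, σ α ∈ Q := by
    intro σ
    have h2 : K⟮α⟯.map σ.toAlgHom ≤ Q := by
      change _ ≤ normalClosure K K⟮α⟯ Ω
      rw [normalClosure_def'']
      exact le_iSup (fun f : Ω ≃ₐ[K] Ω => K⟮α⟯.map f.toAlgHom) σ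
    exact h2 ⟨α, mem_adjoin_simple_self K α, rfl⟩
  refine le_relClosure Q ?_ (by simpa using hconj 1)
  set N := (relClosure C K Ω).fixingSubgroup with hN
  have hNn : N.Normal := by
    rw [hN, ← (relClosure C K Ω).restrictNormalHom_ker]
    infer_instance
  let q : (Ω ≃ₐ[K] Ω) →* (Q ≃ₐ[K] Q) := AlgEquiv.restrictNormalHom Q
  have hq : Function.Surjective q := AlgEquiv.restrictNormalHom_surjective Ω
  have hqapp : ∀ σ (x : Q), (q σ x : Ω) = σ x := fun σ x => AlgEquiv.restrictNormal_commutes σ Q x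
  have hNq : (N.map q).Normal := hNn.map q hq
  refine hC.extension _ (N.map q) ?_ ?_
  · -- the normal subgroup
    choose g hg using hq
    let ρ : N →* (E ≃ₐ[F] E) := (AlgEquiv.restrictNormalHom E).comp
      ((F.fixingSubgroupEquiv).toMonoidHom.comp
        (Subgroup.inclusion (fixingSubgroup_antitone hF)))
    have hρ : ∀ (n : N) (x : E), (ρ n x : Ω) = (n : Ω ≃ₐ[K] Ω) x := fun n x =>
      AlgEquiv.restrictNormal_commutes _ E x
    -- N fixes F and thus acts on E. Twisting the action by lifts of the finitely many elements of
    -- Gal(Q/K) gives one kernel for each conjugate of α, and the intersection of these kernels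
    -- fixes all conjugates, hence Q.
    let A : (Q ≃ₐ[K] Q) → Subgroup N := fun τ =>
      (ρ.comp (MulAut.conjNormal (g τ)⁻¹).toMonoidHom).ker
    have hA : C.QuotientMem ((Finset.univ : Finset (Q ≃ₐ[K] Q)).inf A) :=
      hC.quotientMem_finset_inf h1 _ A fun τ _ => hC.quotientMem_ker _ hE
    let φ : N →* N.map q := q.subgroupMap N
    have hφ : Function.Surjective φ := q.subgroupMap_surjective N
    rw [← hC.quotientMem_ker_iff φ hφ]
    refine hC.quotientMem_mono (fun n hn => ?_) hA
    rw [MonoidHom.mem_ker]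
    apply Subtype.ext
    change q n = 1
    have hn' : (n : Ω ≃ₐ[K] Ω) ∈ Q.fixingSubgroup := by
      have h3 : Q ≤ fixedField (Subgroup.zpowers (n : Ω ≃ₐ[K] Ω)) := by
        change normalClosure K K⟮α⟯ Ω ≤ _
        rw [normalClosure_def'', iSup_le_iff]
        intro σ
        rw [adjoin_map, adjoin_le_iff]
        rintro _ ⟨a, ha, rfl⟩
        obtain rfl : α = a := ha.symm
        have h4 : (n : Ω ≃ₐ[K] Ω) (σ α) = σ α := by
          have h5 : g (q σ) α = σ α := by
            have := congrArg (fun τ => ((τ ⟨α, by simpa using hconj 1⟩ : Q) : Ω)) (hg (q σ))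
            simp only [hqapp] at this
            exact this
          have h6 : n ∈ A (q σ) := Finset.inf_le (f := A) (Finset.mem_univ (q σ)) hn
          have h7 := hρ (MulAut.conjNormal (g (q σ))⁻¹ n) ⟨α, hα'⟩
          have h8 : ρ (MulAut.conjNormal (g (q σ))⁻¹ n) = 1 := h6
          rw [h8, MulAut.conjNormal_apply, inv_inv, AlgEquiv.mul_apply, AlgEquiv.mul_apply,
            AlgEquiv.aut_inv] at h7
          have h9 := congrArg (g (q σ)) h7
          rw [AlgEquiv.apply_symm_apply] at h9
          rw [← h5]
          exact h9.symm
        rw [SetLike.mem_coe, mem_fixedField_iff]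
        have h10 : Subgroup.zpowers (n : Ω ≃ₐ[K] Ω) ≤ MulAction.stabilizer (Ω ≃ₐ[K] Ω) (σ α) := by
          rw [Subgroup.zpowers_le]
          exact h4
        exact fun f hf => h10 hf
      rw [IntermediateField.mem_fixingSubgroup_iff]
      exact fun x hx => (mem_fixedField_iff _ _).1 (h3 hx) _ (Subgroup.mem_zpowers _)
    rw [← Q.restrictNormalHom_ker] at hn'
    exact hn'
  · -- the quotient
    let M := fixedField (N.map q)
    refine hC.iso _ _ (IsGalois.normalAutEquivQuotient (N.map q)).symm ?_
    let M' : IntermediateField K Ω := lift M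
    let e : M ≃ₐ[K] M' := liftAlgEquiv M
    have hMg : IsGalois K M := inferInstance
    have : IsGalois K M' := IsGalois.of_algEquiv e
    have : FiniteDimensional K M' := e.toLinearEquiv.finiteDimensional
    refine hC.iso _ _ (AlgEquiv.autCongr e).symm (mem_of_le_relClosure hC h1 M' ?_)
    rintro x hx
    obtain ⟨y, hy, rfl⟩ := hx
    -- Elements of the fixed field of the image of N are fixed by N, hence lie in K^c.
    rw [← InfiniteGalois.fixedField_fixingSubgroup (relClosure C K Ω), mem_fixedField_iff]
    intro σ hσ
    have := (mem_fixedField_iff _ _).1 hy (q σ) ⟨σ, hσ, rfl⟩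
    exact (hqapp σ y).symm.trans (congrArg Subtype.val this)

end Closure

end

section

open IntermediateField Module IsLocalRing

/-! ### Reduction to extensions of prime degree. -/

section Fixed

variable {C : GroupClass.{u}} {K Ω : Type u} [Field K] [Field Ω] [Algebra K Ω]

/-- A finite Galois extension is cyclic of degree `orderOf g` over the fixed field of `g`. -/
theorem exists_isGalois_over_fixedField (L : IntermediateField K Ω) [FiniteDimensional K L]
    [IsGalois K L] (g : L ≃ₐ[K] L) :
    ∃ (F : IntermediateField K Ω) (E : IntermediateField F Ω), F ≤ L ∧ IsGalois F E ∧
      finrank F E = orderOf g ∧ E.restrictScalars K = L ∧ ∀ x : L, g x = x → (x : Ω) ∈ F := by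
  let F₀ : IntermediateField K L := fixedField (Subgroup.zpowers g)
  let F : IntermediateField K Ω := lift F₀
  have hFL : F ≤ L := lift_le F₀
  let E : IntermediateField F Ω := extendScalars hFL
  have hKE : IsGalois K E := inferInstanceAs (IsGalois K L)
  have hKEf : FiniteDimensional K E := inferInstanceAs (FiniteDimensional K L)
  refine ⟨F, E, hFL, IsGalois.tower_top_of_isGalois K F E, ?_, ?_, ?_⟩
  · have h1 : finrank K F * finrank F E = finrank K E := finrank_mul_finrank K F E
    have h2 : finrank K F₀ * finrank F₀ L = finrank K L := finrank_mul_finrank K F₀ L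
    have h3 : finrank K F₀ = finrank K F := (liftAlgEquiv F₀).toLinearEquiv.finrank_eq
    have h4 : finrank F₀ L = orderOf g := by
      rw [finrank_fixedField_eq_card, Nat.card_zpowers]
    have h5 : finrank K E = finrank K L := rfl
    have h6 : 0 < finrank K F₀ := finrank_pos
    rw [h3] at h2 h6
    rw [← h4]
    exact Nat.eq_of_mul_eq_mul_left h6 (by rw [h1, h2, h5])
  · exact extendScalars_restrictScalars hFL
  · intro x hx
    refine (mem_lift x).2 ((mem_fixedField_iff _ _).2 fun f hf => ?_)
    have : Subgroup.zpowers g ≤ MulAction.stabilizer (L ≃ₐ[K] L) x := by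
      rw [Subgroup.zpowers_le]
      exact hx
    exact this hf

theorem restrictScalars_le_relClosure_of_finrank [IsGalois K Ω] (hC : C.IsClass) (h1 : C PUnit)
    {F : IntermediateField K Ω} (hF : F ≤ relClosure C K Ω) {r : ℕ} [Fact r.Prime]
    (hCr : ∀ (H : Type u) [Group H], Nat.card H = r → C H) (E : IntermediateField F Ω)
    [IsGalois F E] (hE : finrank F E = r) : E.restrictScalars K ≤ relClosure C K Ω := by
  have hr : r.Prime := Fact.out
  have : FiniteDimensional F E := finite_of_finrank_pos (hE ▸ hr.pos)
  exact restrictScalars_le_relClosure hC h1 hF E (hCr _ (by rw [IsGalois.card_aut_eq_finrank, hE]))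

end Fixed

/-! ### The independence property. -/

section Independence

variable {C : GroupClass.{u}} {K : Type u} [Field K]

/-- W and its preimage under σ both restrict on K^c to extensions of O, so these restrictions
coincide. -/
theorem IsCHenselian.apply_mem {O : ValuationSubring K} (hO : IsCHenselian C O)
    {W : ValuationSubring (SeparableClosure K)} (hW : Extends O W)
    (σ : SeparableClosure K ≃ₐ[K] SeparableClosure K) {x : SeparableClosure K}
    (hx : x ∈ cClosure C K) (hxW : x ∈ W) : σ x ∈ W := by
  let ι := algebraMap (cClosure C K) (SeparableClosure K)
  have h1 : Extends O (W.comap ι) := by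
    ext y
    exact hW.mem_iff y
  have h2 : Extends O ((W.comap (σ : SeparableClosure K →+* SeparableClosure K)).comap ι) := by
    ext y
    refine Iff.trans ?_ (hW.mem_iff y)
    change σ (algebraMap K _ y) ∈ W ↔ _
    rw [AlgEquiv.commutes]
  have h3 : (⟨x, hx⟩ : cClosure C K) ∈ W.comap ι := hxW
  rw [hO.unique h1 h2] at h3
  exact h3

/-- If K^c ≠ K, a nontrivial finite C-extension L is Galois of some prime degree r over an
intermediate field F. Independence passes to F, and the Galois extensions of F of degree r lie in
K^c, where both rings are invariant; this contradicts `Independent.finrank_ne`. -/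
theorem independenceProperty (hC : C.IsClass) (h1 : C PUnit) (K : Type u) [Field K] :
    IndependenceProperty C K := by
  intro O₁ O₂ hO₁ hO₂ hind
  by_contra hbot
  let Ω := SeparableClosure K
  obtain ⟨x, hx, hxb⟩ : ∃ x ∈ cClosure C K, x ∉ (⊥ : IntermediateField K Ω) := by
    by_contra! hc
    exact hbot (le_bot_iff.1 hc)
  have : FiniteDimensional K K⟮x⟯ := adjoin.finiteDimensional (Algebra.IsSeparable.isIntegral K x)
  obtain ⟨L, hxL, hLf, hLg, hL⟩ := exists_le_of_le_relClosure (C := C) hC h1 K⟮x⟯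
    (adjoin_simple_le_iff.2 hx)
  have hcard : Nat.card (L ≃ₐ[K] L) ≠ 1 := by
    rw [IsGalois.card_aut_eq_finrank, Ne, IntermediateField.finrank_eq_one_iff]
    rintro rfl
    exact hxb (hxL (mem_adjoin_simple_self K x))
  let r := (Nat.card (L ≃ₐ[K] L)).minFac
  have hr : Fact r.Prime := ⟨Nat.minFac_prime hcard⟩
  obtain ⟨g, hg⟩ := exists_prime_orderOf_dvd_card' r (Nat.minFac_dvd (Nat.card (L ≃ₐ[K] L)))
  obtain ⟨F, E, hFL, hE, hEr, -, -⟩ := exists_isGalois_over_fixedField L g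
  obtain ⟨W₁, hW₁⟩ := exists_extends (Ω := Ω) O₁
  obtain ⟨W₂, hW₂⟩ := exists_extends (Ω := Ω) O₂
  have hst : ∀ {O : ValuationSubring K} {W : ValuationSubring Ω}, IsCHenselian C O → Extends O W →
      ∀ E : IntermediateField F Ω, IsGalois F E → finrank F E = r →
      ∀ σ : Ω ≃ₐ[F] Ω, ∀ x ∈ E, x ∈ W → σ x ∈ W := by
    intro O W hO hW E hE hEr σ x hxE hxW
    refine hO.apply_mem hW (σ.restrictScalars K) ?_ hxW
    exact restrictScalars_le_relClosure_of_finrank hC h1 (hFL.trans (le_relClosure L hL))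
      (fun _ _ => hC.of_card_eq_prime hL (Nat.minFac_dvd _)) E hEr hxE
  exact (hind.of_extends (F := F) (W₁ := W₁.comap (algebraMap F Ω))
    (W₂ := W₂.comap (algebraMap F Ω)) hW₁ hW₂).finrank_ne (Ω := Ω) rfl rfl
    (hst hO₁ hW₁) (hst hO₂ hW₂) E (hEr.trans hg)

end Independence

/-! ### The degree bound. -/

section DegreeBound

variable {C : GroupClass.{u}} {K Ω : Type u} [Field K] [Field Ω] [Algebra K Ω]

theorem mem_relClosure_of_sq_eq [IsGalois K Ω] (hC2 : ∀ (H : Type u) [Group H], Nat.card H = 2 → C H)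
    {i : Ω} {a : K} (hi : i ^ 2 = algebraMap K Ω a) : i ∈ relClosure C K Ω := by
  by_cases hiK : i ∈ (⊥ : IntermediateField K Ω)
  · exact bot_le (a := relClosure C K Ω) hiK
  have hint := Algebra.IsSeparable.isIntegral K i
  have : FiniteDimensional K K⟮i⟯ := adjoin.finiteDimensional hint
  have h2 : finrank K K⟮i⟯ = 2 := by
    refine le_antisymm ?_ ?_
    · rw [adjoin.finrank hint]
      have h3 := minpoly.min K i (Polynomial.monic_X_pow_sub_C a two_ne_zero) (by simp [hi])
      exact (Polynomial.natDegree_le_natDegree h3).trans_eq (Polynomial.natDegree_X_pow_sub_C)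
    · have h4 : finrank K K⟮i⟯ ≠ 1 := fun h => hiK (by
        rw [IntermediateField.finrank_eq_one_iff] at h
        exact h ▸ mem_adjoin_simple_self K i)
      have h5 : 0 < finrank K K⟮i⟯ := finrank_pos
      omega
  have : Algebra.IsQuadraticExtension K K⟮i⟯ := ⟨h2⟩
  have : IsGalois K K⟮i⟯ := ⟨⟩
  exact le_relClosure K⟮i⟯ (hC2 _ (by rw [IsGalois.card_aut_eq_finrank, h2]))
    (mem_adjoin_simple_self K i)

theorem finrank_ne_of_relClosure [IsGalois K Ω] (hC : C.IsClass) (h1 : C PUnit) {r : ℕ}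
    [Fact r.Prime] (hCr : ∀ (H : Type u) [Group H], Nat.card H = r → C H)
    (E : IntermediateField (relClosure C K Ω) Ω) [IsGalois (relClosure C K Ω) E] :
    finrank (relClosure C K Ω) E ≠ r := by
  intro hE
  have hr : r.Prime := Fact.out
  have h2 := restrictScalars_le_relClosure_of_finrank hC h1 le_rfl hCr E hE
  have h3 : E = ⊥ := le_bot_iff.1 fun x hx => mem_bot.2 ⟨⟨x, h2 hx⟩, rfl⟩
  rw [← IntermediateField.finrank_eq_one_iff, hE] at h3
  exact hr.ne_one h3

/-- K^c is Galois of degree r over the fixed field of g and has no Galois extension of degree r, so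
`eq_two_and_not_sq` applies. A square root of -1 generates an extension of degree at most 2, hence
lies in K^c. -/
theorem eq_two_and_apply_ne [IsGalois K Ω] [IsSepClosed Ω] (hC : C.IsClass) (h1 : C PUnit)
    [FiniteDimensional K (relClosure C K Ω)]
    (g : relClosure C K Ω ≃ₐ[K] relClosure C K Ω) {r : ℕ} [Fact r.Prime] (hg : orderOf g = r) :
    r = 2 ∧ (∃ i : relClosure C K Ω, i ^ 2 = -1) ∧ ∀ i : relClosure C K Ω, i ^ 2 = -1 → g i ≠ i := by
  have hCr : ∀ (H : Type u) [Group H], Nat.card H = r → C H := fun H _ hH =>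
    hC.of_card_eq_prime (mem_of_le_relClosure hC h1 (relClosure C K Ω) le_rfl)
      (hg ▸ orderOf_dvd_natCard g) hH
  obtain ⟨F, E, -, hE, hEr, hEK, hF⟩ := exists_isGalois_over_fixedField (relClosure C K Ω) g
  have hno : ∀ M : IntermediateField K Ω, M = relClosure C K Ω →
      ∀ E' : IntermediateField M Ω, IsGalois M E' → finrank M E' ≠ r := by
    rintro M rfl E' hE'
    exact finrank_ne_of_relClosure hC h1 hCr E'
  obtain ⟨h2, hsq⟩ := eq_two_and_not_sq E (hEr.trans hg) (hno _ hEK)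
  subst h2
  refine ⟨rfl, ?_, fun i hi hgi => hsq ⟨i, hF i hgi⟩ ?_⟩
  rotate_left
  · have h3 := congrArg (algebraMap (relClosure C K Ω) Ω) hi
    exact Subtype.ext h3
  have : NeZero (2 : Ω) := ⟨fun h0 => hsq 1 ((algebraMap F Ω).injective (by
    rw [one_pow, map_neg, map_one]
    linear_combination h0))⟩
  have : NeZero ((2 : ℕ) : Ω) := ⟨by exact_mod_cast this.out⟩
  obtain ⟨i, hi⟩ := IsSepClosed.exists_pow_nat_eq (-1 : Ω) 2
  exact ⟨⟨i, mem_relClosure_of_sq_eq (a := -1) hCr (by rw [hi, map_neg, map_one])⟩,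
    Subtype.ext hi⟩

/-- Each nontrivial automorphism has a power of prime order; that power moves i, hence so does the
automorphism. An automorphism is thus determined by its value at i, which is i or -i. -/
theorem degreeBound (hC : C.IsClass) (h1 : C PUnit) (K : Type u) [Field K] : DegreeBound C K := by
  intro hfin
  let Ω := SeparableClosure K
  let M := relClosure C K Ω
  have hfin' : FiniteDimensional K M := hfin
  change finrank K M ≤ 2
  rw [← IsGalois.card_aut_eq_finrank K M]
  obtain h | h := subsingleton_or_nontrivial (M ≃ₐ[K] M)
  · exact (Nat.card_unique (α := M ≃ₐ[K] M)).trans_le one_le_two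
  have key : ∀ g : M ≃ₐ[K] M, g ≠ 1 →
      (∃ i : M, i ^ 2 = -1) ∧ ∀ i : M, i ^ 2 = -1 → g i ≠ i := by
    intro g hg
    have hr : Fact (orderOf g).minFac.Prime := ⟨Nat.minFac_prime (by rwa [Ne, orderOf_eq_one_iff])⟩
    obtain ⟨m, hm⟩ := Nat.minFac_dvd (orderOf g)
    have hm0 : m ≠ 0 := fun h0 => (orderOf_pos g).ne' (by rw [hm, h0, mul_zero])
    have hgm : orderOf (g ^ m) = (orderOf g).minFac := by
      rw [orderOf_pow_of_dvd hm0 (hm ▸ dvd_mul_left _ _)]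
      nth_rw 1 [hm]
      exact Nat.mul_div_cancel _ (Nat.pos_of_ne_zero hm0)
    obtain ⟨-, h2, h3⟩ := eq_two_and_apply_ne (C := C) hC h1 (g ^ m) hgm
    refine ⟨h2, fun i hi hgi => h3 i hi ?_⟩
    have : g ^ m ∈ MulAction.stabilizer (M ≃ₐ[K] M) i := pow_mem (show g ∈ _ from hgi) m
    exact this
  obtain ⟨g₀, hg₀⟩ := exists_ne (1 : M ≃ₐ[K] M)
  obtain ⟨i, hi⟩ := (key g₀ hg₀).1
  have hmem : ∀ g : M ≃ₐ[K] M, g i = i ∨ g i = -i := fun g => sq_eq_sq_iff_eq_or_eq_neg.1 (by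
    rw [← map_pow, hi, map_neg, map_one])
  have hinj : Function.Injective fun g : M ≃ₐ[K] M => (⟨g i, hmem g⟩ : ({i, -i} : Set M)) := by
    intro g h hgh
    have hgh' : g i = h i := congrArg Subtype.val hgh
    by_contra hne
    refine (key (h⁻¹ * g) (fun h0 => hne (inv_mul_eq_one.1 h0).symm)).2 i hi ?_
    rw [AlgEquiv.mul_apply, hgh', ← AlgEquiv.mul_apply, inv_mul_cancel, AlgEquiv.one_apply]
  refine (Nat.card_le_card_of_injective _ hinj).trans ?_
  rw [Nat.card_coe_set_eq]
  exact (Set.ncard_insert_le i {-i}).trans_eq (by rw [Set.ncard_singleton])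

end DegreeBound

end

section

open IntermediateField Module IsLocalRing

/-! ### The Galois action on the residue field of an invariant valuation ring. -/

section ResidueGalois

variable {F M : Type u} [Field F] [Field M] [Algebra F M] {O : ValuationSubring F}
  {w : ValuationSubring M}

/-- The residues of the conjugates of an element of an invariant valuation ring are the roots of a
polynomial over the residue field of the base. -/
theorem Extends.exists_polynomial_conj [IsGalois F M] (h : Extends O w)
    (hst : ∀ σ : M ≃ₐ[F] M, ∀ x ∈ w, σ x ∈ w) (y : w) :
    ∃ q : Polynomial (ResidueField O), q ≠ 0 ∧ ∃ t : Multiset (ResidueField w),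
      q.map h.residueMap = (t.map fun b => Polynomial.X - Polynomial.C b).prod ∧
      residue w y ∈ t ∧ ∀ b ∈ t, ∃ σ : M ≃ₐ[F] M, residue w ⟨σ y, hst σ y y.2⟩ = b := by
  classical
  have hint : IsIntegral F (y : M) := Algebra.IsSeparable.isIntegral F (y : M)
  set P := minpoly F (y : M) with hP
  have hPm : P.Monic := minpoly.monic hint
  set s := (P.map (algebraMap F M)).roots with hs
  have hroot : ∀ b ∈ s, ∃ σ : M ≃ₐ[F] M, σ y = b := by
    intro b hb
    rw [hs, Polynomial.mem_roots', Polynomial.IsRoot.def, Polynomial.eval_map_algebraMap] at hb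
    exact minpoly.exists_algEquiv_of_root' hint.isAlgebraic hb.2
  have hsw : ∀ b ∈ s, b ∈ w := fun b hb => by
    obtain ⟨σ, rfl⟩ := hroot b hb
    exact hst σ y y.2
  obtain ⟨t, ht⟩ : ∃ t : Multiset w, t.map w.subtype = s := by
    refine ⟨s.attach.map fun b : {b // b ∈ s} => (⟨b.1, hsw b.1 b.2⟩ : w), ?_⟩
    rw [Multiset.map_map]
    exact s.attach_map_val
  have hsplit : P.map (algebraMap F M) =
      ((t.map fun b => Polynomial.X - Polynomial.C b).prod).map w.subtype := by
    rw [(Normal.splits (inferInstance : Normal F M) (y : M)).eq_prod_roots_of_monic (hPm.map _),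
      ← hs, ← ht, Polynomial.map_multiset_prod, Multiset.map_map, Multiset.map_map]
    congr 1
    refine Multiset.map_congr rfl fun b _ => ?_
    simp
  -- The coefficients of P are symmetric functions of the conjugates, which all lie in w.
  have hlift : P ∈ Polynomial.lifts O.subtype := by
    rw [Polynomial.lifts_iff_coeff_lifts]
    intro n
    have h1 := congrArg (fun p => p.coeff n) hsplit
    simp only [Polynomial.coeff_map] at h1
    refine ⟨⟨P.coeff n, (h.mem_iff _).1 ?_⟩, rfl⟩
    rw [h1]
    exact Subtype.property _
  obtain ⟨P₀, hP₀, -, hP₀m⟩ := Polynomial.lifts_and_natDegree_eq_and_monic hlift hPm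
  have hPw : P₀.map h.ringHom = (t.map fun b => Polynomial.X - Polynomial.C b).prod := by
    refine Polynomial.map_injective w.subtype Subtype.val_injective ?_
    rw [← hsplit, ← hP₀, Polynomial.map_map, Polynomial.map_map]
    rfl
  refine ⟨P₀.map (residue O), (hP₀m.map _).ne_zero, t.map (residue w), ?_, ?_, ?_⟩
  · have h2 := congrArg (Polynomial.map (residue w)) hPw
    rw [Polynomial.map_map, Polynomial.map_multiset_prod, Multiset.map_map] at h2
    rw [Polynomial.map_map, Multiset.map_map]
    refine Eq.trans h2 ?_
    congr 1
    refine Multiset.map_congr rfl fun b _ => ?_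
    simp
  · refine Multiset.mem_map_of_mem _ ?_
    have h3 : (y : M) ∈ t.map w.subtype := by
      rw [ht, hs, Polynomial.mem_roots (hPm.map _).ne_zero, Polynomial.IsRoot.def,
        Polynomial.eval_map_algebraMap]
      exact minpoly.aeval F (y : M)
    obtain ⟨y', hy', h4⟩ := Multiset.mem_map.1 h3
    obtain rfl : y' = y := Subtype.ext h4
    exact hy'
  · intro b hb
    obtain ⟨c, hc, rfl⟩ := Multiset.mem_map.1 hb
    obtain ⟨σ, hσ⟩ := hroot c (ht ▸ Multiset.mem_map_of_mem w.subtype hc)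
    exact ⟨σ, congrArg _ (Subtype.ext hσ)⟩

variable [Algebra (ResidueField O) (ResidueField w)]

theorem Extends.normal_residueField [IsGalois F M] (h : Extends O w)
    (hst : ∀ σ : M ≃ₐ[F] M, ∀ x ∈ w, σ x ∈ w)
    (hA : algebraMap (ResidueField O) (ResidueField w) = h.residueMap) :
    Normal (ResidueField O) (ResidueField w) := by
  rw [normal_iff]
  intro a
  obtain ⟨y, rfl⟩ := residue_surjective a
  obtain ⟨q, hq, t, hqt, hy, -⟩ := h.exists_polynomial_conj hst y
  rw [← hA] at hqt
  have hroot : Polynomial.aeval (residue w y) q = 0 := by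
    rw [← Polynomial.eval_map_algebraMap, hqt, Polynomial.eval_multiset_prod, Multiset.map_map]
    exact Multiset.prod_eq_zero (Multiset.mem_map.2 ⟨_, hy, by simp⟩)
  refine ⟨isAlgebraic_iff_isIntegral.1 ⟨q, hq, hroot⟩, ?_⟩
  refine Polynomial.Splits.of_dvd ?_ (Polynomial.map_ne_zero hq)
    (Polynomial.map_dvd _ (minpoly.dvd _ _ hroot))
  rw [hqt]
  exact Polynomial.Splits.multisetProd fun p hp => by
    obtain ⟨b, -, rfl⟩ := Multiset.mem_map.1 hp
    exact Polynomial.Splits.X_sub_C b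

/-- An element of the residue field which is fixed by all automorphisms comes from the residue
field of the base. -/
theorem Extends.mem_range_of_fixed [IsGalois F M] (h : Extends O w)
    (hst : ∀ σ : M ≃ₐ[F] M, ∀ x ∈ w, σ x ∈ w)
    (hA : algebraMap (ResidueField O) (ResidueField w) = h.residueMap)
    [Algebra.IsSeparable (ResidueField O) (ResidueField w)] (y : w)
    (hy : ∀ σ : M ≃ₐ[F] M, residue w ⟨σ y, hst σ y y.2⟩ = residue w y) :
    residue w y ∈ Set.range h.residueMap := by
  have hN := h.normal_residueField hst hA
  obtain ⟨q, hq, t, hqt, hyt, ht⟩ := h.exists_polynomial_conj hst y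
  rw [← hA] at hqt ⊢
  set a := residue w y
  have hroot : Polynomial.aeval a q = 0 := by
    rw [← Polynomial.eval_map_algebraMap, hqt, Polynomial.eval_multiset_prod, Multiset.map_map]
    exact Multiset.prod_eq_zero (Multiset.mem_map.2 ⟨_, hyt, by simp⟩)
  have hle : (minpoly (ResidueField O) a).natDegree ≤ 1 := by
    rw [← Polynomial.card_rootSet_eq_natDegree (Algebra.IsSeparable.isSeparable (ResidueField O) a)
      (hN.splits a), Fintype.card_le_one_iff_subsingleton, Set.subsingleton_coe]
    have hsub : ∀ b ∈ (minpoly (ResidueField O) a).rootSet (ResidueField w), b = a := by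
      intro b hb
      rw [Polynomial.mem_rootSet] at hb
      have h1 : Polynomial.aeval b q = 0 :=
        Polynomial.aeval_eq_zero_of_dvd_aeval_eq_zero (minpoly.dvd _ _ hroot) hb.2
      rw [← Polynomial.eval_map_algebraMap, hqt, Polynomial.eval_multiset_prod, Multiset.map_map,
        Multiset.prod_eq_zero_iff, Multiset.mem_map] at h1
      obtain ⟨c, hc, hbc⟩ := h1
      obtain ⟨σ, rfl⟩ := ht c hc
      simp only [Function.comp_apply, Polynomial.eval_sub, Polynomial.eval_X,
        Polynomial.eval_C] at hbc
      rw [sub_eq_zero.1 hbc, hy σ]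
    exact fun b hb c hc => (hsub b hb).trans (hsub c hc).symm
  have hint : IsIntegral (ResidueField O) a := Algebra.IsSeparable.isIntegral _ a
  exact minpoly.natDegree_eq_one_iff.1 (le_antisymm hle (minpoly.natDegree_pos hint))

/-- The action of the Galois group on the residue field of an invariant valuation ring. -/
noncomputable def Extends.resAut (h : Extends O w) (hst : ∀ σ : M ≃ₐ[F] M, ∀ x ∈ w, σ x ∈ w)
    (hA : algebraMap (ResidueField O) (ResidueField w) = h.residueMap) :
    (M ≃ₐ[F] M) →* (ResidueField w ≃ₐ[ResidueField O] ResidueField w) where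
  toFun σ := AlgEquiv.ofRingEquiv (f := ResidueField.mapEquiv
    { toFun := fun x => (⟨σ x, hst σ x x.2⟩ : w)
      invFun := fun x => ⟨σ.symm x, hst σ.symm x x.2⟩
      left_inv := fun x => Subtype.ext (σ.symm_apply_apply x)
      right_inv := fun x => Subtype.ext (σ.apply_symm_apply x)
      map_mul' := fun x y => Subtype.ext (map_mul σ (x : M) y)
      map_add' := fun x y => Subtype.ext (map_add σ (x : M) y) }) (by
    intro a
    obtain ⟨a, rfl⟩ := residue_surjective a
    rw [hA, h.residueMap_residue]
    exact congrArg (residue w) (Subtype.ext (σ.commutes (a : F))))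
  map_one' := by
    ext a
    obtain ⟨a, rfl⟩ := residue_surjective a
    rfl
  map_mul' σ τ := by
    ext a
    obtain ⟨a, rfl⟩ := residue_surjective a
    rfl

theorem Extends.resAut_residue (h : Extends O w) (hst : ∀ σ : M ≃ₐ[F] M, ∀ x ∈ w, σ x ∈ w)
    (hA : algebraMap (ResidueField O) (ResidueField w) = h.residueMap) (σ : M ≃ₐ[F] M) (y : w) :
    h.resAut hst hA σ (residue w y) = residue w ⟨σ y, hst σ y y.2⟩ := rfl

/-- To fix finitely many residues it suffices to fix chosen lifts of them. -/
theorem Extends.continuous_resAut [IsGalois F M] (h : Extends O w)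
    (hst : ∀ σ : M ≃ₐ[F] M, ∀ x ∈ w, σ x ∈ w)
    (hA : algebraMap (ResidueField O) (ResidueField w) = h.residueMap) :
    Continuous (h.resAut hst hA) := by
  refine continuous_of_continuousAt_one _ ?_
  rw [ContinuousAt, map_one, Filter.tendsto_def]
  intro s hs
  obtain ⟨E, hE, hEs⟩ := (krullTopology_mem_nhds_one_iff _ _ _).1 hs
  obtain ⟨t, rfl⟩ := (essFiniteType_iff.1 inferInstance : E.FG)
  choose y hy using fun a : ResidueField w => residue_surjective a
  refine (krullTopology_mem_nhds_one_iff _ _ _).2 ⟨adjoin F ((fun a => (y a : M)) '' t),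
    finiteDimensional_adjoin fun x _ => Algebra.IsSeparable.isIntegral F x, fun σ hσ => hEs ?_⟩
  rw [SetLike.mem_coe, IntermediateField.mem_fixingSubgroup_iff] at hσ ⊢
  refine fun x hx => apply_eq_of_mem_adjoin hx fun a ha => ?_
  rw [← hy a, h.resAut_residue]
  exact congrArg _ (Subtype.ext (hσ _ (subset_adjoin F _ ⟨a, ha, rfl⟩)))

/-- The image is compact, hence closed, and by `Extends.mem_range_of_fixed` its fixed field is the
base. Infinite Galois theory makes it the whole group. -/
theorem Extends.surjective_resAut [IsGalois F M] (h : Extends O w)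
    (hst : ∀ σ : M ≃ₐ[F] M, ∀ x ∈ w, σ x ∈ w)
    (hA : algebraMap (ResidueField O) (ResidueField w) = h.residueMap)
    [Algebra.IsSeparable (ResidueField O) (ResidueField w)] :
    Function.Surjective (h.resAut hst hA) := by
  have hN := h.normal_residueField hst hA
  have : IsGalois (ResidueField O) (ResidueField w) := ⟨⟩
  have : T2Space (ResidueField w ≃ₐ[ResidueField O] ResidueField w) := krullTopology_t2
  let H : ClosedSubgroup (ResidueField w ≃ₐ[ResidueField O] ResidueField w) :=
    ⟨(h.resAut hst hA).range, by
      have := isCompact_range (h.continuous_resAut hst hA)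
      exact this.isClosed⟩
  have hH := InfiniteGalois.fixingSubgroup_fixedField H
  have hbot : fixedField H.1 = ⊥ := by
    rw [eq_bot_iff]
    intro a ha
    rw [mem_fixedField_iff] at ha
    obtain ⟨y, rfl⟩ := residue_surjective a
    obtain ⟨b, hb⟩ := h.mem_range_of_fixed hst hA y fun σ => by
      rw [← h.resAut_residue hst hA]
      exact ha _ ⟨σ, rfl⟩
    exact mem_bot.2 ⟨b, by rw [hA, hb]⟩
  rw [hbot, fixingSubgroup_bot] at hH
  intro τ
  have : τ ∈ H.1 := hH ▸ Subgroup.mem_top τ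
  exact this

end ResidueGalois

end

section

open IntermediateField Module IsLocalRing

/-- Solvability puts the commutator subgroup inside a maximal subgroup, which is then normal. By
maximality an element of prime order generates the quotient. -/
theorem exists_normal_prime_index (G : Type*) [Group G] [Finite G] [Nontrivial G]
    (hG : Group.IsSolvable G) : ∃ N : Subgroup G, N.Normal ∧ N.index.Prime := by
  obtain h | ⟨H, hH, hle⟩ := eq_top_or_exists_le_coatom (commutator G)
  · exact absurd h hG.commutator_lt_top_of_nontrivial.ne
  have hN : H.Normal := Subgroup.Normal.of_commutator_le G hle
  refine ⟨H, hN, ?_⟩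
  have hcard : Nat.card (G ⧸ H) ≠ 1 := fun h1 => hH.1 (Subgroup.index_eq_one.1 h1)
  have hr : Fact (Nat.card (G ⧸ H)).minFac.Prime := ⟨Nat.minFac_prime hcard⟩
  obtain ⟨g, hg⟩ := exists_prime_orderOf_dvd_card' _ (Nat.minFac_dvd (Nat.card (G ⧸ H)))
  have hlt : H < (Subgroup.zpowers g).comap (QuotientGroup.mk' H) := by
    refine lt_of_le_of_ne (fun x hx => ?_) fun heq => ?_
    · have : QuotientGroup.mk' H x = 1 := (QuotientGroup.eq_one_iff x).2 hx
      rw [Subgroup.mem_comap, this]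
      exact one_mem _
    · obtain ⟨x, rfl⟩ := QuotientGroup.mk'_surjective H g
      have hx : x ∈ H := by
        rw [heq, Subgroup.mem_comap]
        exact Subgroup.mem_zpowers _
      have h1 : QuotientGroup.mk' H x = 1 := (QuotientGroup.eq_one_iff x).2 hx
      rw [h1, orderOf_one] at hg
      exact hr.out.ne_one hg.symm
  have htop : Subgroup.zpowers g = ⊤ := by
    refine Subgroup.comap_injective (QuotientGroup.mk'_surjective H) ?_
    rw [hH.2 _ hlt, Subgroup.comap_top]
  rw [Subgroup.index, ← Subgroup.card_top, ← htop, Nat.card_zpowers, hg]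
  exact hr.out

/-! ### Identification of the residue field with a maximal C-extension. -/

section ResidueClosure

variable {C : GroupClass.{u}}

theorem mem_of_intermediateField_relClosure {K Ω : Type u} [Field K] [Field Ω] [Algebra K Ω]
    [IsGalois K Ω] (hC : C.IsClass) (h1 : C PUnit) (N : IntermediateField K (relClosure C K Ω))
    [FiniteDimensional K N] [IsGalois K N] : C (N ≃ₐ[K] N) := by
  let e : N ≃ₐ[K] lift N := liftAlgEquiv N
  have : IsGalois K (lift N) := IsGalois.of_algEquiv e
  have : FiniteDimensional K (lift N) := e.toLinearEquiv.finiteDimensional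
  exact hC.iso _ _ (AlgEquiv.autCongr e).symm (mem_of_le_relClosure hC h1 (lift N) (lift_le N))

/-- The Galois groups of the finite Galois subextensions of the residue field of `K^c`. -/
theorem Extends.mem_of_intermediateField_residueField {K Ω : Type u} [Field K] [Field Ω]
    [Algebra K Ω] [IsGalois K Ω] (hC : C.IsClass) (h1 : C PUnit) {O : ValuationSubring K}
    {w : ValuationSubring (relClosure C K Ω)} (h : Extends O w)
    (hst : ∀ σ : relClosure C K Ω ≃ₐ[K] relClosure C K Ω, ∀ x ∈ w, σ x ∈ w)
    [Algebra (ResidueField O) (ResidueField w)]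
    (hA : algebraMap (ResidueField O) (ResidueField w) = h.residueMap)
    [Algebra.IsSeparable (ResidueField O) (ResidueField w)]
    (E : IntermediateField (ResidueField O) (ResidueField w))
    [FiniteDimensional (ResidueField O) E] [IsGalois (ResidueField O) E] :
    C (E ≃ₐ[ResidueField O] E) := by
  have hN := h.normal_residueField hst hA
  let f := (AlgEquiv.restrictNormalHom E).comp (h.resAut hst hA)
  have hf : Function.Surjective f :=
    (AlgEquiv.restrictNormalHom_surjective _).comp (h.surjective_resAut hst hA)
  have hker : f.ker = E.fixingSubgroup.comap (h.resAut hst hA) := by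
    rw [← E.restrictNormalHom_ker, MonoidHom.comap_ker]
  have hopen : (f.ker : Set (relClosure C K Ω ≃ₐ[K] relClosure C K Ω)) ∈ nhds 1 := by
    refine IsOpen.mem_nhds ?_ (one_mem f.ker)
    rw [hker]
    exact E.fixingSubgroup_isOpen.preimage (h.continuous_resAut hst hA)
  -- The kernel is open, so Gal(E/Kv) is a quotient of the group of a finite normal N inside K^c,
  -- and that group is in C.
  obtain ⟨N, hNf, hNn, hNle⟩ := (krullTopology_mem_nhds_one_iff_of_normal _ _ _).1 hopen
  have : IsGalois K N := ⟨⟩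
  rw [← hC.quotientMem_ker_iff f hf]
  exact hC.quotientMem_mono hNle ((quotientMem_fixingSubgroup_iff hC N).2
    (mem_of_intermediateField_relClosure hC h1 N))

variable {k l Ω : Type u} [Field k] [Field l] [Field Ω] [Algebra k l] [Algebra k Ω] [IsGalois k Ω]

/-- A Galois extension `l / k` is the maximal `C`-extension if its finite Galois subextensions have
groups in `C`, and it has no Galois extensions of prime degree with group in `C`. -/
theorem fieldRange_eq_relClosure [IsGalois k l] (hC : C.IsClass)
    (hsol : ∀ (G : Type u) [Group G], C G → Group.IsSolvable G)
    (hfin : ∀ E : IntermediateField k l, FiniteDimensional k E → IsGalois k E → C (E ≃ₐ[k] E))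
    (hno : ∀ r : ℕ, r.Prime → (∀ (H : Type u) [Group H], Nat.card H = r → C H) →
      ∀ (E : Type u) [Field E] [Algebra l E], IsGalois l E → finrank l E ≠ r)
    (ι : l →ₐ[k] Ω) : ι.fieldRange = relClosure C k Ω := by
  refine le_antisymm ?_ (sSup_le ?_)
  · rintro _ ⟨x, rfl⟩
    have : FiniteDimensional k k⟮x⟯ := adjoin.finiteDimensional (Algebra.IsSeparable.isIntegral k x)
    let E : IntermediateField k l := normalClosure k k⟮x⟯ l
    have hn : Normal k E := inferInstance
    have hg : IsGalois k E := ⟨⟩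
    have hf : FiniteDimensional k E := inferInstance
    let e : E ≃ₐ[k] E.map ι := E.equivMap ι
    have : IsGalois k (E.map ι) := IsGalois.of_algEquiv e
    have : FiniteDimensional k (E.map ι) := e.toLinearEquiv.finiteDimensional
    refine le_relClosure (E.map ι) (hC.iso _ _ (AlgEquiv.autCongr e) (hfin E hf hg)) ⟨x, ?_, rfl⟩
    exact k⟮x⟯.le_normalClosure (mem_adjoin_simple_self k x)
  · rintro L ⟨hLf, hLg, hL⟩
    let : Algebra l Ω := ι.toRingHom.toAlgebra
    have : IsScalarTower k l Ω := .of_algebraMap_eq fun x => (ι.commutes x).symm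
    have : IsGalois l Ω := IsGalois.tower_top_of_isGalois k l Ω
    obtain ⟨t, ht⟩ := (essFiniteType_iff.1 inferInstance : L.FG)
    -- The compositum of L and l: its group over l embeds by restriction into that of L over k,
    -- hence lies in C.
    let L' : IntermediateField l Ω := adjoin l (t : Set Ω)
    have hLL' : L ≤ L'.restrictScalars k := by
      rw [← ht, adjoin_le_iff]
      exact subset_adjoin l (t : Set Ω)
    have htL : (t : Set Ω) ⊆ L := by
      rw [← ht]
      exact subset_adjoin k (t : Set Ω)
    let f : (Ω ≃ₐ[l] Ω) →* (L ≃ₐ[k] L) :=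
      (AlgEquiv.restrictNormalHom L).comp (AlgEquiv.restrictScalarsHom k)
    have hfapp : ∀ (σ : Ω ≃ₐ[l] Ω) (x : L), (f σ x : Ω) = σ x := fun σ x =>
      AlgEquiv.restrictNormal_commutes (σ.restrictScalars k) L x
    have hL'g : IsGalois l L' := isGalois_adjoin fun σ s hs => hLL' (by
      rw [← hfapp σ ⟨s, htL hs⟩]
      exact Subtype.property _)
    have hL'f : FiniteDimensional l L' :=
      finiteDimensional_adjoin fun x _ => Algebra.IsSeparable.isIntegral l x
    have hL' : C (L' ≃ₐ[l] L') := by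
      have hnorm : L'.fixingSubgroup.Normal := L'.restrictNormalHom_ker ▸ inferInstance
      rw [← quotientMem_fixingSubgroup_iff hC]
      refine hC.quotientMem_mono (fun σ hσ => ?_) (hC.quotientMem_ker f hL)
      rw [IntermediateField.mem_fixingSubgroup_iff]
      refine fun x hx => apply_eq_of_mem_adjoin hx fun s hs => ?_
      rw [MonoidHom.mem_ker] at hσ
      rw [← hfapp σ ⟨s, htL hs⟩, hσ]
      rfl
    obtain hG | hG := subsingleton_or_nontrivial (L' ≃ₐ[l] L')
    · have hbot : L' = ⊥ := by
        rw [← IntermediateField.finrank_eq_one_iff, ← IsGalois.card_aut_eq_finrank]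
        exact Nat.card_unique
      intro x hx
      have hx' : x ∈ L' := hLL' hx
      rw [hbot] at hx'
      exact mem_bot.1 hx'
    · have := hC.finite _ hL'
      -- Here solvability is used: a nontrivial group in C has a quotient of prime order, so l would
      -- have a forbidden extension of prime degree.
      obtain ⟨N, hN, hNr⟩ := exists_normal_prime_index (L' ≃ₐ[l] L') (hsol _ hL')
      refine absurd ?_ (hno N.index hNr (fun H _ hH => ?_) (fixedField N) inferInstance)
      · rw [← IsGalois.card_aut_eq_finrank]
        exact (Nat.card_congr (IsGalois.normalAutEquivQuotient N).toEquiv).symm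
      · have : Fact N.index.Prime := ⟨hNr⟩
        exact hC.of_card_eq_prime hL' (N.index_dvd_card) hH

end ResidueClosure

end

section

open IntermediateField Module IsLocalRing

/-! ### The lifting property and the general criterion. -/

section Lifting

variable {C : GroupClass.{u}}

theorem Extends.residueMap_trans {K L M : Type u} [Field K] [Field L] [Field M] [Algebra K L]
    [Algebra L M] [Algebra K M] [IsScalarTower K L M] {O : ValuationSubring K}
    {v : ValuationSubring L} {w : ValuationSubring M} (h : Extends O v) (h' : Extends v w)
    (h'' : Extends O w) (a : ResidueField O) :
    h'.residueMap (h.residueMap a) = h''.residueMap a := by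
  obtain ⟨a, rfl⟩ := residue_surjective a
  rw [h.residueMap_residue, h'.residueMap_residue, h''.residueMap_residue]
  exact congrArg _ (Subtype.ext (IsScalarTower.algebraMap_apply K L M a).symm)

/-- A Galois subextension of the residue field is the residue field of a Galois subextension. -/
theorem Extends.exists_residueEq {K M : Type u} [Field K] [Field M] [Algebra K M] [IsGalois K M]
    {O : ValuationSubring K} {w : ValuationSubring M} (h : Extends O w)
    (hst : ∀ σ : M ≃ₐ[K] M, ∀ x ∈ w, σ x ∈ w)
    [Algebra (ResidueField O) (ResidueField w)]
    (hA : algebraMap (ResidueField O) (ResidueField w) = h.residueMap)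
    [Algebra.IsSeparable (ResidueField O) (ResidueField w)]
    (E : IntermediateField (ResidueField O) (ResidueField w)) [IsGalois (ResidueField O) E] :
    ∃ M' : IntermediateField K M, IsGalois K M' ∧ (h.restrict M').ResidueEq E := by
  have hN := h.normal_residueField hst hA
  have hG : IsGalois (ResidueField O) (ResidueField w) := ⟨⟩
  have hEn : E.fixingSubgroup.Normal := E.restrictNormalHom_ker ▸ inferInstance
  -- M' is the fixed field of the automorphisms that act trivially on E. Closedness of H ensures
  -- that no further automorphisms fix M'.
  let H : Subgroup (M ≃ₐ[K] M) := E.fixingSubgroup.comap (h.resAut hst hA)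
  have hHn : H.Normal := hEn.comap _
  have hHc : IsClosed (H : Set (M ≃ₐ[K] M)) :=
    (InfiniteGalois.fixingSubgroup_isClosed E).preimage (h.continuous_resAut hst hA)
  let M' : IntermediateField K M := fixedField H
  have hM'H : M'.fixingSubgroup = H := InfiniteGalois.fixingSubgroup_fixedField ⟨H, hHc⟩
  refine ⟨M', isGalois_of_forall_map_le fun σ x hx => ?_, ?_⟩
  · rw [mem_fixedField_iff] at hx ⊢
    intro τ hτ
    have h1 := hx _ (hHn.conj_mem τ hτ σ⁻¹)
    rw [inv_inv, AlgEquiv.mul_apply, AlgEquiv.mul_apply] at h1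
    have h2 := congrArg σ h1
    rwa [← AlgEquiv.mul_apply σ, mul_inv_cancel, AlgEquiv.one_apply] at h2
  · have hv : Extends (CanonicalClass.restrict w M') w := rfl
    let : Algebra (ResidueField O) (ResidueField (CanonicalClass.restrict w M')) := (h.restrict M').residueAlgebra
    let : Algebra (ResidueField (CanonicalClass.restrict w M')) (ResidueField w) := hv.residueAlgebra
    have htower : IsScalarTower (ResidueField O) (ResidueField (CanonicalClass.restrict w M')) (ResidueField w) :=
      .of_algebraMap_eq fun a => by
        rw [hA]
        exact ((h.restrict M').residueMap_trans hv h a).symm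
    have : Algebra.IsSeparable (ResidueField (CanonicalClass.restrict w M')) (ResidueField w) :=
      Algebra.isSeparable_tower_top_of_isSeparable (ResidueField O) _ _
    let j : ResidueField (CanonicalClass.restrict w M') →ₐ[ResidueField O] ResidueField w :=
      IsScalarTower.toAlgHom _ _ _
    have hj : j.fieldRange = E := by
      refine le_antisymm ?_ fun a ha => ?_
      · rintro _ ⟨a, rfl⟩
        obtain ⟨x, rfl⟩ := residue_surjective a
        rw [← InfiniteGalois.fixedField_fixingSubgroup E, mem_fixedField_iff]
        intro τ hτ
        obtain ⟨σ, rfl⟩ := h.surjective_resAut hst hA τ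
        have hx := (mem_fixedField_iff _ _).1 (x : M').2 σ hτ
        change h.resAut hst hA σ (hv.residueMap (residue _ x)) = hv.residueMap (residue _ x)
        rw [hv.residueMap_residue, h.resAut_residue]
        exact congrArg _ (Subtype.ext hx)
      -- Automorphisms over M' lie in H, so they fix the residue; an invariant residue comes from
      -- the residue field of M'.
      · obtain ⟨y, rfl⟩ := residue_surjective a
        refine hv.mem_range_of_fixed (fun σ x hx => hst (σ.restrictScalars K) x hx) rfl y
          fun σ => ?_
        have hσ : σ.restrictScalars K ∈ H := by
          rw [← hM'H, IntermediateField.mem_fixingSubgroup_iff]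
          exact fun x hx => σ.commutes ⟨x, hx⟩
        exact (IntermediateField.mem_fixingSubgroup_iff _ _).1 hσ _ ha
    exact ⟨(AlgEquiv.ofInjectiveField j).trans (IntermediateField.equivOfEq hj)⟩

theorem IsCHenselian.invariant {K : Type u} [Field K] {O : ValuationSubring K}
    (hO : IsCHenselian C O) {w : ValuationSubring (cClosure C K)} (h : Extends O w)
    (σ : cClosure C K ≃ₐ[K] cClosure C K) (x : cClosure C K) (hx : x ∈ w) : σ x ∈ w := by
  have h2 : Extends O (w.comap (σ : cClosure C K →+* cClosure C K)) := by
    ext y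
    refine Iff.trans ?_ (h.mem_iff y)
    change σ (algebraMap K (cClosure C K) y) ∈ w ↔ _
    rw [AlgEquiv.commutes]
  rw [hO.unique h h2] at hx
  exact hx

/-- The residue field of `K^c` is the maximal `C`-extension of the residue field of `K`. -/
theorem Extends.fieldRange_residueField_eq {K Ω : Type u} [Field K] [Field Ω] [Algebra K Ω]
    [IsGalois K Ω] [IsSepClosed Ω] (hC : C.IsClass) (h1 : C PUnit)
    (hsol : ∀ (G : Type u) [Group G], C G → Group.IsSolvable G) {O : ValuationSubring K}
    {w : ValuationSubring (relClosure C K Ω)} (h : Extends O w)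
    (hst : ∀ σ : relClosure C K Ω ≃ₐ[K] relClosure C K Ω, ∀ x ∈ w, σ x ∈ w)
    [Algebra (ResidueField O) (ResidueField w)]
    (hA : algebraMap (ResidueField O) (ResidueField w) = h.residueMap)
    [Algebra.IsSeparable (ResidueField O) (ResidueField w)] {Ωk : Type u} [Field Ωk]
    [Algebra (ResidueField O) Ωk] [IsGalois (ResidueField O) Ωk]
    (ι : ResidueField w →ₐ[ResidueField O] Ωk) :
    ι.fieldRange = relClosure C (ResidueField O) Ωk := by
  have hN := h.normal_residueField hst hA
  have : IsGalois (ResidueField O) (ResidueField w) := ⟨⟩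
  refine fieldRange_eq_relClosure hC hsol ?_ ?_ ι
  · intro E hE1 hE2
    exact h.mem_of_intermediateField_residueField hC h1 hst hA E
  · intro r hr hCr E _ _ hE
    have : Fact r.Prime := ⟨hr⟩
    exact finrank_residueField_ne (Ω := Ω) w
      (fun E' hE' => finrank_ne_of_relClosure hC h1 hCr E') E

/-- All three clauses follow from the isomorphism `e` between the residue field of K^c and (Kv)^c,
which transports a given subextension back to the residue field, where `Extends.exists_residueEq`
lifts it. -/
theorem Extends.lifting {K Ω : Type u} [Field K] [Field Ω] [Algebra K Ω]
    [IsGalois K Ω] [IsSepClosed Ω] (hC : C.IsClass) (h1 : C PUnit)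
    (hsol : ∀ (G : Type u) [Group G], C G → Group.IsSolvable G) {O : ValuationSubring K}
    {w : ValuationSubring (relClosure C K Ω)} (h : Extends O w)
    (hst : ∀ σ : relClosure C K Ω ≃ₐ[K] relClosure C K Ω, ∀ x ∈ w, σ x ∈ w)
    (hsep : h.IsSeparable) {Ωk : Type u} [Field Ωk]
    [Algebra (ResidueField O) Ωk] [IsGalois (ResidueField O) Ωk] [IsSepClosed Ωk] :
    (∃ E : IntermediateField (ResidueField O) (relClosure C (ResidueField O) Ωk),
      IsGalois (ResidueField O) E ∧ h.ResidueEq E) ∧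
    (∀ E : IntermediateField (ResidueField O) (relClosure C (ResidueField O) Ωk),
      IsGalois (ResidueField O) E → ∃ M : IntermediateField K (relClosure C K Ω),
        IsGalois K M ∧ (h.restrict M).ResidueEq E) ∧
    (relClosure C K Ω = ⊥ →
      Function.Bijective h.residueMap ∧ relClosure C (ResidueField O) Ωk = ⊥) := by
  let := h.residueAlgebra
  have hsep' : Algebra.IsSeparable (ResidueField O) (ResidueField w) := hsep
  let ι : ResidueField w →ₐ[ResidueField O] Ωk := IsSepClosed.lift
  have hι := h.fieldRange_residueField_eq hC h1 hsol hst rfl ι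
  let e : ResidueField w ≃ₐ[ResidueField O] relClosure C (ResidueField O) Ωk :=
    (AlgEquiv.ofInjectiveField ι).trans (equivOfEq hι)
  refine ⟨⟨⊤, ?_, ⟨e.trans topEquiv.symm⟩⟩, ?_, ?_⟩
  · exact IsGalois.of_algEquiv
      (topEquiv (F := ResidueField O) (E := relClosure C (ResidueField O) Ωk)).symm
  · intro E hE
    let e' := E.equivMap
      (e.symm : relClosure C (ResidueField O) Ωk →ₐ[ResidueField O] ResidueField w)
    have := IsGalois.of_algEquiv e'
    obtain ⟨M', hM', hE'⟩ := h.exists_residueEq hst rfl (E.map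
      (e.symm : relClosure C (ResidueField O) Ωk →ₐ[ResidueField O] ResidueField w))
    let := (h.restrict M').residueAlgebra
    obtain ⟨e''⟩ := hE'
    exact ⟨M', hM', ⟨e''.trans e'.symm⟩⟩
  · intro hbot
    have hsurj : Function.Surjective h.residueMap := by
      intro a
      obtain ⟨⟨⟨y, hy⟩, hyw⟩, rfl⟩ := residue_surjective a
      have hyb : y ∈ (⊥ : IntermediateField K Ω) := hbot ▸ hy
      obtain ⟨x, rfl⟩ := mem_bot.1 hyb
      exact ⟨residue O ⟨x, (h.mem_iff x).1 hyw⟩, rfl⟩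
    refine ⟨⟨h.residueMap.injective, hsurj⟩, ?_⟩
    rw [← hι, eq_bot_iff]
    rintro _ ⟨a, rfl⟩
    obtain ⟨b, rfl⟩ := hsurj a
    exact mem_bot.2 ⟨b, (ι.commutes b).symm⟩

theorem liftingProperty (hC : C.IsClass) (h1 : C PUnit)
    (hsol : ∀ (G : Type u) [Group G], C G → Group.IsSolvable G) (K : Type u) [Field K] :
    LiftingProperty C K := fun O hO w h hsep =>
  Extends.lifting (Ω := SeparableClosure K) (Ωk := SeparableClosure (ResidueField O)) hC h1 hsol
    (O := O) (w := w) h (hO.invariant h) hsep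

/-- Solvability enters only through the lifting property. -/
theorem GroupClass.IsClass.isCanonical (hC : C.IsClass) (h1 : C PUnit)
    (hsol : ∀ (G : Type u) [Group G], C G → Group.IsSolvable G) : C.IsCanonical where
  isClass := hC
  lifting K _ := liftingProperty hC h1 hsol K
  independence K _ := independenceProperty hC h1 K
  degreeBound K _ := degreeBound hC h1 K

end Lifting

end

section

open Module

/-! ### Traces of complex matrices of finite order. -/

section TraceOfFiniteOrder

variable {d n : ℕ} {A : Matrix (Fin d) (Fin d) ℂ}

theorem pow_eq_one_of_mem_roots_charpoly (hA : A ^ n = 1) {x : ℂ} (hx : x ∈ A.charpoly.roots) :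
    x ^ n = 1 := by
  have h1 : x ∈ spectrum ℂ A := Matrix.mem_spectrum_iff_isRoot_charpoly.2
    (Polynomial.isRoot_of_mem_roots hx)
  have h2 := spectrum.pow_mem_pow A n h1
  have : Nontrivial (Matrix (Fin d) (Fin d) ℂ) := by
    by_contra hc
    rw [not_nontrivial_iff_subsingleton] at hc
    rw [spectrum.of_subsingleton] at h1
    exact h1
  rw [hA, spectrum.one_eq] at h2
  exact h2

theorem isIntegral_trace (hn : 0 < n) (hA : A ^ n = 1) : IsIntegral ℤ A.trace := by
  rw [Matrix.trace_eq_sum_roots_charpoly]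
  refine IsIntegral.multiset_sum fun x hx => ?_
  refine IsIntegral.of_pow hn ?_
  rw [pow_eq_one_of_mem_roots_charpoly hA hx]
  exact isIntegral_one

/-- The equality case of the triangle inequality: the nonnegative numbers 1 - Re(x c̄) add up to 0.
-/
theorem eq_of_sum_eq {R : Multiset ℂ} {c : ℂ} (hR : ∀ x ∈ R, ‖x‖ = 1) (hc : ‖c‖ = 1)
    (hsum : R.sum = R.card * c) {x : ℂ} (hx : x ∈ R) : x = c := by
  have hre : ∀ x ∈ R, 0 ≤ 1 - (x * (starRingEnd ℂ) c).re := by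
    intro x hx
    have h1 := Complex.re_le_norm (x * (starRingEnd ℂ) c)
    rw [norm_mul, RCLike.norm_conj, hR x hx, hc, one_mul] at h1
    linarith
  have hcc : c * (starRingEnd ℂ) c = 1 := by
    rw [Complex.mul_conj, Complex.normSq_eq_norm_sq, hc]
    simp
  have hzero : (R.map fun x => 1 - (x * (starRingEnd ℂ) c).re).sum = 0 := by
    rw [Multiset.sum_map_sub, Multiset.map_const', Multiset.sum_replicate, nsmul_eq_mul, mul_one]
    have h2 : (R.map fun x => (x * (starRingEnd ℂ) c).re).sum =
        (R.sum * (starRingEnd ℂ) c).re := by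
      clear hsum hR hre hx
      induction R using Multiset.induction_on with
      | empty => simp
      | cons a s ih => rw [Multiset.map_cons, Multiset.sum_cons, Multiset.sum_cons, add_mul,
          Complex.add_re, ih]
    rw [h2, hsum, mul_assoc, hcc, mul_one, Complex.natCast_re, sub_self]
  have h3 := Multiset.all_zero_of_le_zero_le_of_sum_eq_zero
    (fun y hy => by
      obtain ⟨x, hx, rfl⟩ := Multiset.mem_map.1 hy
      exact hre x hx) hzero _ (Multiset.mem_map_of_mem _ hx)
  have h4 : Complex.normSq (x - c) = 0 := by
    rw [Complex.normSq_sub, Complex.normSq_eq_norm_sq, Complex.normSq_eq_norm_sq, hR x hx, hc]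
    linarith
  exact sub_eq_zero.1 (Complex.normSq_eq_zero.1 h4)

open IntermediateField in
-- All conjugates of an average of roots of unity have absolute value at most 1, so by Kronecker a
-- nonzero integral average is a root of unity.
theorem norm_eq_one_of_isIntegral {R : Multiset ℂ} (hn : 0 < n) (hR : ∀ x ∈ R, x ^ n = 1)
    (h0 : R.sum ≠ 0) (hint : IsIntegral ℤ (R.sum / R.card)) : ‖R.sum / R.card‖ = 1 := by
  classical
  let F : IntermediateField ℚ ℂ := adjoin ℚ (R.toFinset : Set ℂ)
  have hfin : FiniteDimensional ℚ F := finiteDimensional_adjoin fun x hx =>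
    IsIntegral.of_pow hn (by
      rw [hR x (Multiset.mem_toFinset.1 hx)]
      exact isIntegral_one)
  have hnf : NumberField F := { to_charZero := inferInstance, to_finiteDimensional := hfin }
  have hRF : ∀ x ∈ R, x ∈ F := fun x hx => subset_adjoin ℚ _ (Multiset.mem_toFinset.2 hx)
  obtain ⟨S, hS⟩ : ∃ S : Multiset F, S.map (algebraMap F ℂ) = R := by
    refine ⟨R.attach.map fun b : {b // b ∈ R} => (⟨b.1, hRF b.1 b.2⟩ : F), ?_⟩
    rw [Multiset.map_map]
    exact R.attach_map_val
  have hcard : S.card = R.card := by rw [← hS, Multiset.card_map]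
  have hc : algebraMap F ℂ (S.sum / R.card) = R.sum / R.card := by
    rw [map_div₀, map_natCast, map_multiset_sum, hS]
  have hcard0 : (R.card : ℝ) ≠ 0 := by
    rw [Nat.cast_ne_zero, Ne, Multiset.card_eq_zero]
    rintro rfl
    exact h0 Multiset.sum_zero
  obtain ⟨N, hN, h1⟩ := NumberField.Embeddings.pow_eq_one_of_norm_le_one (K := F) (A := ℂ)
    (x := S.sum / R.card) (by
      intro h
      rw [h, map_zero, eq_comm, div_eq_zero_iff] at hc
      exact hc.elim h0 (by exact_mod_cast hcard0))
    (by
      rw [← isIntegral_algebraMap_iff (algebraMap F ℂ).injective, hc]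
      exact hint)
    (fun φ => by
      rw [map_div₀, map_natCast, map_multiset_sum, norm_div, Complex.norm_natCast,
        div_le_one₀ (lt_of_le_of_ne (Nat.cast_nonneg _) hcard0.symm)]
      refine (norm_multiset_sum_le _).trans ?_
      rw [Multiset.map_map, ← hcard]
      refine (Multiset.sum_le_card_nsmul _ 1 fun x hx => ?_).trans_eq (by
        rw [Multiset.card_map, nsmul_eq_mul, mul_one])
      obtain ⟨s, hs, rfl⟩ := Multiset.mem_map.1 hx
      have h2 : s ^ n = 1 := (algebraMap F ℂ).injective (by
        rw [map_pow, map_one]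
        exact hR _ (hS ▸ Multiset.mem_map_of_mem _ hs))
      refine (Complex.norm_eq_one_of_pow_eq_one (ζ := φ s) (n := n) ?_ hn.ne').le
      rw [← map_pow, h2, map_one])
  refine Complex.norm_eq_one_of_pow_eq_one (n := N) ?_ hN.ne'
  rw [← hc, ← map_pow, h1, map_one]

/-- A complex matrix of finite order and size `d` such that `trace / d` is an algebraic integer is
scalar, or has trace zero. -/
theorem trace_eq_zero_or_eq_algebraMap [NeZero d] (hn : 0 < n) (hA : A ^ n = 1)
    (hint : IsIntegral ℤ (A.trace / d)) :
    A.trace = 0 ∨ ∃ c : ℂ, A = algebraMap ℂ (Matrix (Fin d) (Fin d) ℂ) c := by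
  rw [or_iff_not_imp_left]
  intro h0
  set R := A.charpoly.roots with hRdef
  have hcard : R.card = d := by
    rw [hRdef, ← (IsAlgClosed.splits A.charpoly).natDegree_eq_card_roots,
      Matrix.charpoly_natDegree_eq_dim, Fintype.card_fin]
  have hR : ∀ x ∈ R, x ^ n = 1 := fun x hx => pow_eq_one_of_mem_roots_charpoly hA hx
  rw [Matrix.trace_eq_sum_roots_charpoly, ← hRdef] at h0 hint
  rw [← hcard] at hint
  set c := R.sum / R.card with hc
  have hc1 : ‖c‖ = 1 := norm_eq_one_of_isIntegral hn hR h0 hint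
  have hall : ∀ x ∈ R, x = c := fun x hx =>
    eq_of_sum_eq (fun y hy => Complex.norm_eq_one_of_pow_eq_one (hR y hy) hn.ne') hc1 (by
      rw [hc, mul_div_cancel₀]
      rw [hcard]
      exact Nat.cast_ne_zero.2 (NeZero.ne d)) hx
  refine ⟨c, ?_⟩
  -- Finite order makes the minimal polynomial squarefree; with c as the only eigenvalue it divides
  -- X - c, and A is scalar.
  have hdvd : minpoly ℂ A ∣ Polynomial.X ^ n - 1 := minpoly.dvd _ _ (by simp [hA])
  have hsep : (minpoly ℂ A).Separable := Polynomial.Separable.of_dvd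
    ((Polynomial.X_pow_sub_one_separable_iff).2 (Nat.cast_ne_zero.2 hn.ne')) hdvd
  have hmint : IsIntegral ℂ A := Algebra.IsIntegral.isIntegral A
  have hsplit := (IsAlgClosed.splits (minpoly ℂ A)).eq_prod_roots_of_monic (minpoly.monic hmint)
  have hle : (minpoly ℂ A).roots ≤ {c} := by
    rw [Multiset.le_iff_subset (Polynomial.nodup_roots hsep)]
    intro x hx
    rw [Multiset.mem_singleton]
    exact hall x (Multiset.mem_of_le (Polynomial.roots.le_of_dvd
      (Matrix.charpoly_monic A).ne_zero (Matrix.minpoly_dvd_charpoly A)) hx)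
  have hdvd' : minpoly ℂ A ∣ Polynomial.X - Polynomial.C c := by
    rw [hsplit]
    refine (Multiset.prod_dvd_prod_of_le (Multiset.map_le_map hle)).trans ?_
    rw [Multiset.map_singleton, Multiset.prod_singleton]
  have := Polynomial.aeval_eq_zero_of_dvd_aeval_eq_zero hdvd' (minpoly.aeval ℂ A)
  rw [map_sub, Polynomial.aeval_X, Polynomial.aeval_C] at this
  exact sub_eq_zero.1 this

end TraceOfFiniteOrder

end

section

open Module

/-! ### The regular character of the complex group algebra. -/

section GroupAlgebra

/-- Left multiplication acts separately on each of the d i columns of the i-th block. -/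
theorem trace_lmul_pi_matrix {n : ℕ} {d : Fin n → ℕ}
    (A : Π i, Matrix (Fin (d i)) (Fin (d i)) ℂ) :
    LinearMap.trace ℂ _ (Algebra.lmul ℂ (Π i, Matrix (Fin (d i)) (Fin (d i)) ℂ) A) =
      ∑ i, (d i : ℂ) * (A i).trace := by
  classical
  rw [LinearMap.trace_eq_matrix_trace ℂ
    (Pi.basis fun i => Matrix.stdBasis ℂ (Fin (d i)) (Fin (d i))), Matrix.trace, Fintype.sum_sigma]
  refine Finset.sum_congr rfl fun i _ => ?_
  have h1 : ∀ x : Fin (d i) × Fin (d i),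
      Matrix.diag (LinearMap.toMatrix (Pi.basis fun i => Matrix.stdBasis ℂ (Fin (d i)) (Fin (d i)))
        (Pi.basis fun i => Matrix.stdBasis ℂ (Fin (d i)) (Fin (d i)))
        (Algebra.lmul ℂ (Π i, Matrix (Fin (d i)) (Fin (d i)) ℂ) A)) ⟨i, x⟩ = A i x.1 x.1 := by
    rintro ⟨x, y⟩
    rw [Matrix.diag_apply, LinearMap.toMatrix_apply, Pi.basis_repr, Pi.basis_apply,
      Algebra.coe_lmul_eq_mul, LinearMap.mul_apply', Pi.mul_apply, Pi.single_eq_same,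
      Matrix.stdBasis_eq_single]
    have h2 : ∀ B : Matrix (Fin (d i)) (Fin (d i)) ℂ,
        (Matrix.stdBasis ℂ (Fin (d i)) (Fin (d i))).repr B (x, y) = B x y := fun B => by
      simp [Matrix.stdBasis]
    rw [h2]
    simp
  rw [Finset.sum_congr rfl fun x _ => h1 x, Fintype.sum_prod_type]
  simp [Matrix.trace, Finset.mul_sum]

variable {G : Type u} [Group G] [Finite G]

/-- Multiplication by g ≠ 1 permutes the group basis without fixed points. -/
theorem trace_lmul_of_eq_zero {g : G} (hg : g ≠ 1) :
    LinearMap.trace ℂ _ (Algebra.lmul ℂ (MonoidAlgebra ℂ G) (MonoidAlgebra.of ℂ G g)) = 0 := by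
  classical
  have := Fintype.ofFinite G
  rw [LinearMap.trace_eq_matrix_trace ℂ (MonoidAlgebra.basis G ℂ), Matrix.trace]
  refine Finset.sum_eq_zero fun h _ => ?_
  rw [Matrix.diag_apply, LinearMap.toMatrix_apply]
  simp [MonoidAlgebra.basis, hg]

theorem trace_lmul_one_eq_card :
    LinearMap.trace ℂ _ (Algebra.lmul ℂ (MonoidAlgebra ℂ G) 1) = Nat.card G := by
  classical
  have := Fintype.ofFinite G
  rw [map_one, LinearMap.trace_eq_matrix_trace ℂ (MonoidAlgebra.basis G ℂ), LinearMap.toMatrix_one,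
    Matrix.trace_one, Nat.card_eq_fintype_card]

theorem trace_lmul_algEquiv {R S : Type*} [Ring R] [Ring S] [Algebra ℂ R] [Algebra ℂ S]
    (e : R ≃ₐ[ℂ] S) (a : R) :
    LinearMap.trace ℂ _ (Algebra.lmul ℂ S (e a)) = LinearMap.trace ℂ _ (Algebra.lmul ℂ R a) := by
  rw [← LinearMap.trace_conj' _ e.toLinearEquiv]
  congr 1
  ext b
  simp [LinearEquiv.conj_apply]

end GroupAlgebra

/-! ### Conjugacy classes of prime power size in simple groups. -/

section Simple

variable {G : Type u} [Group G] [Finite G] {d : ℕ}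

omit [Finite G] in
theorem eq_algebraMap_of_commute (π : MonoidAlgebra ℂ G →ₐ[ℂ] Matrix (Fin d) (Fin d) ℂ)
    (hπ : Function.Surjective π) {Z : Matrix (Fin d) (Fin d) ℂ}
    (hZ : ∀ h, π (MonoidAlgebra.of ℂ G h) * Z = Z * π (MonoidAlgebra.of ℂ G h)) :
    ∃ c : ℂ, Z = algebraMap ℂ _ c := by
  have h1 : ∀ a, π a * Z = Z * π a := by
    intro a
    induction a using MonoidAlgebra.induction_on with
    | of m => exact hZ m
    | add x y hx hy => rw [map_add, add_mul, mul_add, hx, hy]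
    | smul r x hx => rw [map_smul, smul_mul_assoc, mul_smul_comm, hx]
  have h2 : Z ∈ Subalgebra.center ℂ (Matrix (Fin d) (Fin d) ℂ) := by
    rw [Subalgebra.mem_center_iff]
    intro b
    obtain ⟨a, rfl⟩ := hπ b
    exact h1 a
  rw [Algebra.IsCentral.center_eq_bot, Algebra.mem_bot] at h2
  obtain ⟨c, hc⟩ := h2
  exact ⟨c, hc.symm⟩

omit [Finite G] in
-- The sum absorbs every group element, so it is a scalar s with s π(h) = s; as π(h) ≠ 1, it
-- vanishes.
theorem sum_eq_zero_of_exists_ne_one [Fintype G]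
    (π : MonoidAlgebra ℂ G →ₐ[ℂ] Matrix (Fin d) (Fin d) ℂ) (hπ : Function.Surjective π) {h : G}
    (hh : π (MonoidAlgebra.of ℂ G h) ≠ 1) : ∑ x : G, π (MonoidAlgebra.of ℂ G x) = 0 := by
  have hl : ∀ y, π (MonoidAlgebra.of ℂ G y) * ∑ x : G, π (MonoidAlgebra.of ℂ G x) =
      ∑ x : G, π (MonoidAlgebra.of ℂ G x) := fun y => by
    rw [Finset.mul_sum]
    simp_rw [← map_mul]
    exact Equiv.sum_comp (Equiv.mulLeft y) fun x => π (MonoidAlgebra.of ℂ G x)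
  have hr : ∀ y, (∑ x : G, π (MonoidAlgebra.of ℂ G x)) * π (MonoidAlgebra.of ℂ G y) =
      ∑ x : G, π (MonoidAlgebra.of ℂ G x) := fun y => by
    rw [Finset.sum_mul]
    simp_rw [← map_mul]
    exact Equiv.sum_comp (Equiv.mulRight y) fun x => π (MonoidAlgebra.of ℂ G x)
  obtain ⟨s, hs⟩ := eq_algebraMap_of_commute π hπ fun y => (hl y).trans (hr y).symm
  have h1 := hl h
  rw [hs, Algebra.algebraMap_eq_smul_one, mul_smul_comm, mul_one] at h1
  by_contra h0
  have hs0 : s ≠ 0 := by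
    rintro rfl
    exact h0 (by rw [hs, map_zero])
  exact hh (smul_right_injective _ hs0 h1)

/-- The value of a central character at a conjugacy class is an algebraic integer. -/
theorem exists_isIntegral_mul_trace (π : MonoidAlgebra ℂ G →ₐ[ℂ] Matrix (Fin d) (Fin d) ℂ)
    (hπ : Function.Surjective π) [NeZero d] {g : G} {K : Finset G} (hK : ∀ x, x ∈ K ↔ IsConj g x) :
    ∃ ω : ℂ, IsIntegral ℤ ω ∧
      (d : ℂ) * ω = K.card * (π (MonoidAlgebra.of ℂ G g)).trace := by
  let ρ : G →* Matrix (Fin d) (Fin d) ℂ := (π : _ →* _).comp (MonoidAlgebra.of ℂ G)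
  have hconj : ∀ y : G, ∑ x ∈ K, ρ (y * x * y⁻¹) = ∑ x ∈ K, ρ x := fun y =>
    Finset.sum_bijective (fun x => y * x * y⁻¹) (MulAut.conj y).bijective (fun x => by
      rw [hK, hK]
      exact ⟨fun h => h.trans (isConj_iff.2 ⟨y, rfl⟩),
        fun h => h.trans (isConj_iff.2 ⟨y, rfl⟩).symm⟩) fun _ _ => rfl
  obtain ⟨ω, hω⟩ := eq_algebraMap_of_commute π hπ (Z := ∑ x ∈ K, ρ x) fun y => by
    change ρ y * _ = _ * ρ y
    conv_rhs => rw [← hconj y]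
    rw [Finset.mul_sum, Finset.sum_mul]
    refine Finset.sum_congr rfl fun x _ => ?_
    rw [← map_mul, ← map_mul, inv_mul_cancel_right]
  refine ⟨ω, ?_, ?_⟩
  -- The class sum already lives in the integral group ring, which is finite over ℤ.
  · have h1 : IsIntegral ℤ (∑ x ∈ K, MonoidAlgebra.of ℤ G x) := Algebra.IsIntegral.isIntegral _
    have h2 := h1.map (MonoidAlgebra.lift ℤ (Matrix (Fin d) (Fin d) ℂ) G ρ)
    simp_rw [map_sum, MonoidAlgebra.lift_of] at h2
    rw [hω] at h2
    exact (isIntegral_algebraMap_iff (algebraMap ℂ (Matrix (Fin d) (Fin d) ℂ)).injective).1 h2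
  · have h3 := congrArg Matrix.trace hω
    rw [Matrix.trace_sum, Algebra.algebraMap_eq_smul_one, Matrix.trace_smul, Matrix.trace_one,
      Fintype.card_fin, smul_eq_mul, mul_comm] at h3
    rw [← h3, ← nsmul_eq_mul]
    refine Finset.sum_eq_card_nsmul fun x hx => ?_
    obtain ⟨y, rfl⟩ := isConj_iff.1 ((hK x).1 hx)
    rw [map_mul, Matrix.trace_mul_comm, ← map_mul, inv_mul_cancel_left]
    rfl

/-- Bézout for |K| and d writes the quotient as an integral combination of the central character
value ω and the trace. -/
theorem isIntegral_trace_div (π : MonoidAlgebra ℂ G →ₐ[ℂ] Matrix (Fin d) (Fin d) ℂ)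
    (hπ : Function.Surjective π) [NeZero d] {g : G} {K : Finset G} (hK : ∀ x, x ∈ K ↔ IsConj g x)
    (hcop : K.card.Coprime d) : IsIntegral ℤ ((π (MonoidAlgebra.of ℂ G g)).trace / d) := by
  obtain ⟨ω, hω, h1⟩ := exists_isIntegral_mul_trace π hπ hK
  have hd : (d : ℂ) ≠ 0 := Nat.cast_ne_zero.2 (NeZero.ne d)
  have hA : π (MonoidAlgebra.of ℂ G g) ^ Nat.card G = 1 := by
    rw [← map_pow, ← map_pow, pow_card_eq_one', map_one, map_one]
  have hb := Nat.gcd_eq_gcd_ab K.card d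
  rw [hcop] at hb
  have hb' : (1 : ℂ) = K.card * (Nat.gcdA K.card d : ℂ) + d * (Nat.gcdB K.card d : ℂ) := by
    exact_mod_cast congrArg (Int.cast : ℤ → ℂ) hb
  have h2 : (π (MonoidAlgebra.of ℂ G g)).trace / d = (Nat.gcdA K.card d : ℂ) * ω +
      (Nat.gcdB K.card d : ℂ) * (π (MonoidAlgebra.of ℂ G g)).trace := by
    rw [div_eq_iff hd]
    linear_combination (π (MonoidAlgebra.of ℂ G g)).trace * hb' - (Nat.gcdA K.card d : ℂ) * h1
  rw [h2]
  have hint : ∀ m : ℤ, IsIntegral ℤ (m : ℂ) := fun m => isIntegral_algebraMap (R := ℤ) (x := m)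
  exact ((hint _).mul hω).add ((hint _).mul (isIntegral_trace Nat.card_pos hA))

/-- A nontrivial irreducible character of degree prime to the size of a conjugacy class vanishes
there if the group is simple and nonabelian. -/
theorem trace_eq_zero_of_coprime [IsSimpleGroup G] (hcenter : Subgroup.center G = ⊥)
    (π : MonoidAlgebra ℂ G →ₐ[ℂ] Matrix (Fin d) (Fin d) ℂ)
    (hπ : Function.Surjective π) [NeZero d] {g : G} (hg : g ≠ 1) {K : Finset G}
    (hK : ∀ x, x ∈ K ↔ IsConj g x) (hcop : K.card.Coprime d) {h : G}
    (hh : π (MonoidAlgebra.of ℂ G h) ≠ 1) : (π (MonoidAlgebra.of ℂ G g)).trace = 0 := by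
  let ρ : G →* Matrix (Fin d) (Fin d) ℂ := (π : _ →* _).comp (MonoidAlgebra.of ℂ G)
  have hA : ρ g ^ Nat.card G = 1 := by rw [← map_pow, pow_card_eq_one', map_one]
  refine (trace_eq_zero_or_eq_algebraMap Nat.card_pos hA
    (isIntegral_trace_div π hπ hK hcop)).resolve_right ?_
  rintro ⟨c, hc⟩
  -- A scalar image of g would make g central if the representation is faithful; otherwise
  -- simplicity makes the representation trivial.
  obtain hker | hker := (inferInstance : ρ.ker.Normal).eq_bot_or_eq_top
  · have hinj : Function.Injective ρ := (MonoidHom.ker_eq_bot_iff ρ).1 hker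
    refine hg (Subgroup.mem_bot.1 (hcenter ▸ Subgroup.mem_center_iff.2 fun x => hinj ?_))
    rw [map_mul, map_mul, hc]
    exact (Algebra.commutes c (ρ x)).symm
  · exact hh (MonoidHom.mem_ker.1 (hker ▸ Subgroup.mem_top h : h ∈ ρ.ker))

/-- A finite simple group with a nontrivial conjugacy class of prime power size is abelian. -/
theorem center_ne_bot_of_card_eq_pow [IsSimpleGroup G] {g : G} (hg : g ≠ 1) {K : Finset G}
    (hK : ∀ x, x ∈ K ↔ IsConj g x) {p c : ℕ} (hp : p.Prime) (hcard : K.card = p ^ c) :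
    Subgroup.center G ≠ ⊥ := by
  classical
  intro hcenter
  have := Fintype.ofFinite G
  have : NeZero (Nat.card G : ℂ) := ⟨Nat.cast_ne_zero.2 Nat.card_pos.ne'⟩
  obtain ⟨n, d, hd, ⟨e⟩⟩ :=
    IsSemisimpleRing.exists_algEquiv_pi_matrix_of_isAlgClosed ℂ (MonoidAlgebra ℂ G)
  let π : ∀ i, MonoidAlgebra ℂ G →ₐ[ℂ] Matrix (Fin (d i)) (Fin (d i)) ℂ := fun i =>
    (Pi.evalAlgHom ℂ (fun i => Matrix (Fin (d i)) (Fin (d i)) ℂ) i).comp e.toAlgHom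
  have hπ : ∀ i, Function.Surjective (π i) := fun i =>
    (Function.surjective_eval i).comp e.surjective
  have htr : ∀ a, LinearMap.trace ℂ _ (Algebra.lmul ℂ (MonoidAlgebra ℂ G) a) =
      ∑ i, (d i : ℂ) * (π i a).trace := fun a => by
    rw [← trace_lmul_algEquiv e, trace_lmul_pi_matrix]
    rfl
  let T := Finset.univ.filter fun i => ∀ h, π i (MonoidAlgebra.of ℂ G h) = 1
  -- Evaluate the regular trace at the sum of all group elements: it is |G|, nontrivial blocks
  -- contribute 0, and each trivial block contributes |G| (d i)².
  have hT : ∑ i ∈ T, (d i : ℂ) * d i = 1 := by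
    have h1 := htr (∑ x : G, MonoidAlgebra.of ℂ G x)
    rw [map_sum, map_sum, Finset.sum_eq_single 1 (fun x _ hx => trace_lmul_of_eq_zero hx)
      (fun h => absurd (Finset.mem_univ _) h), map_one, trace_lmul_one_eq_card,
      ← Finset.sum_filter_add_sum_filter_not _ fun i => ∀ h, π i (MonoidAlgebra.of ℂ G h) = 1,
      Finset.sum_eq_zero (s := Finset.univ.filter fun i => ¬ _), add_zero] at h1
    · have hG : (Nat.card G : ℂ) ≠ 0 := NeZero.ne _
      refine mul_right_cancel₀ hG ?_
      rw [one_mul, Finset.sum_mul]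
      refine Eq.trans (Finset.sum_congr rfl fun i hi => ?_) h1.symm
      rw [map_sum, Finset.sum_congr rfl fun x _ => (Finset.mem_filter.1 hi).2 x, Finset.sum_const,
        Finset.card_univ, Matrix.trace_smul, Matrix.trace_one, Fintype.card_fin, nsmul_eq_mul,
        Nat.card_eq_fintype_card]
      ring
    · intro i hi
      obtain ⟨h, hh⟩ := not_forall.1 (Finset.mem_filter.1 hi).2
      rw [map_sum, sum_eq_zero_of_exists_ne_one (π i) (hπ i) hh, Matrix.trace_zero, mul_zero]
  -- Either p divides the degree, or the degree is prime to the class size and the character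
  -- vanishes at g.
  have hN : ∀ i, i ∉ T → ∃ α : ℂ, IsIntegral ℤ α ∧
      (d i : ℂ) * (π i (MonoidAlgebra.of ℂ G g)).trace = p * α := by
    intro i hi
    obtain ⟨h, hh⟩ := not_forall.1 fun h => hi (Finset.mem_filter.2 ⟨Finset.mem_univ i, h⟩)
    by_cases hpd : p ∣ d i
    · obtain ⟨m, hm⟩ := hpd
      refine ⟨m * (π i (MonoidAlgebra.of ℂ G g)).trace, ?_, ?_⟩
      · refine (isIntegral_algebraMap (R := ℤ) (A := ℂ) (x := (m : ℤ))).mul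
          (isIntegral_trace (n := Nat.card G) Nat.card_pos ?_)
        rw [← map_pow, ← map_pow, pow_card_eq_one', map_one, map_one]
      · have hm' : (d i : ℂ) = p * m := by exact_mod_cast congrArg (Nat.cast : ℕ → ℂ) hm
        rw [hm', mul_assoc]
    · refine ⟨0, isIntegral_zero, ?_⟩
      rw [trace_eq_zero_of_coprime hcenter (π i) (hπ i) hg hK ?_ hh, mul_zero, mul_zero]
      rw [hcard]
      exact Nat.Coprime.pow_left c ((Nat.Prime.coprime_iff_not_dvd hp).2 hpd)
  choose! α hα hαe using hN
  have h2 := htr (MonoidAlgebra.of ℂ G g)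
  rw [trace_lmul_of_eq_zero hg,
    ← Finset.sum_filter_add_sum_filter_not _ fun i => ∀ h, π i (MonoidAlgebra.of ℂ G h) = 1] at h2
  have h3 : ∑ i ∈ T, (d i : ℂ) * (π i (MonoidAlgebra.of ℂ G g)).trace = 1 := by
    rw [← hT]
    refine Finset.sum_congr rfl fun i hi => ?_
    rw [(Finset.mem_filter.1 hi).2 g, Matrix.trace_one, Fintype.card_fin]
  have hmem : ∀ i ∈ Finset.univ.filter fun i => ¬ ∀ h, π i (MonoidAlgebra.of ℂ G h) = 1, i ∉ T :=
    fun i hi hiT => (Finset.mem_filter.1 hi).2 (Finset.mem_filter.1 hiT).2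
  have hint := IsIntegral.sum _ fun i hi => hα i (hmem i hi)
  rw [h3, Finset.sum_congr rfl fun i hi => hαe i (hmem i hi), ← Finset.mul_sum] at h2
  set β := ∑ i ∈ Finset.univ.filter fun i => ¬ ∀ h, π i (MonoidAlgebra.of ℂ G h) = 1, α i
  have hp0 : (p : ℂ) ≠ 0 := Nat.cast_ne_zero.2 hp.ne_zero
  -- The regular trace vanishes at g, so 1 + p β = 0; but -1/p is not an algebraic integer.
  have hβ : β = algebraMap ℚ ℂ (-1 / p) := by
    rw [map_div₀, map_neg, map_one, map_natCast, eq_div_iff hp0]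
    linear_combination -h2
  rw [hβ, isIntegral_algebraMap_iff (algebraMap ℚ ℂ).injective] at hint
  obtain ⟨k, hk⟩ := IsIntegrallyClosed.isIntegral_iff.1 hint
  have hp0' : (p : ℚ) ≠ 0 := Nat.cast_ne_zero.2 hp.ne_zero
  rw [eq_div_iff hp0'] at hk
  have hk' : (-k) * (p : ℤ) = 1 := by
    have : (k : ℚ) * p = -1 := hk
    have h5 : k * (p : ℤ) = -1 := by exact_mod_cast this
    linarith
  exact hp.one_lt.ne' (Int.natCast_dvd_natCast.1 (by
    rw [Nat.cast_one]
    exact Dvd.intro_left _ hk') |> Nat.dvd_one.1)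

end Simple

end

section

/-! ### Burnside's theorem. -/

section Burnside

variable {G : Type u} [Group G] [Finite G] {p q : ℕ}

theorem exists_eq_pow_mul_pow_of_dvd (hp : p.Prime) (hq : q.Prime) {k n m : ℕ}
    (h : k ∣ p ^ n * q ^ m) : ∃ a b, k = p ^ a * q ^ b := by
  obtain ⟨x, y, hx, hy, rfl⟩ := (Nat.dvd_mul).1 h
  obtain ⟨a, -, rfl⟩ := (Nat.dvd_prime_pow hp).1 hx
  obtain ⟨b, -, rfl⟩ := (Nat.dvd_prime_pow hq).1 hy
  exact ⟨a, b, rfl⟩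

omit [Finite G] in
-- The size of the class is the index of the centralizer, which contains P.
theorem ncard_setOf_isConj_dvd_index {g : G} {P : Subgroup G} (hg : ∀ x ∈ P, x * g = g * x) :
    {x | IsConj g x}.ncard ∣ P.index := by
  have h1 : {x | IsConj g x} = MulAction.orbit (ConjAct G) g := by
    ext x
    rw [ConjAct.mem_orbit_conjAct, isConj_comm]
    rfl
  have h2 : {x | IsConj g x}.ncard = (Subgroup.centralizer {g} : Subgroup G).index := by
    rw [h1, ← MulAction.index_stabilizer, Subgroup.centralizer_eq_comap_stabilizer]
    exact (Subgroup.index_comap_of_surjective (MulAction.stabilizer (ConjAct G) g)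
      (f := (ConjAct.toConjAct : G ≃* ConjAct G).toMonoidHom) ConjAct.toConjAct.surjective).symm
  rw [h2]
  refine Subgroup.index_dvd_of_le fun x hx => Subgroup.mem_centralizer_singleton_iff.2 ?_
  exact hg x hx

/-- A nontrivial central element of a Sylow q-subgroup has a class of p-power size. If that Sylow
subgroup is trivial, G is itself a p-group. -/
theorem center_ne_bot_of_card_eq_pow_mul_pow [IsSimpleGroup G] (hp : p.Prime) (hq : q.Prime)
    {n m : ℕ} (h : Nat.card G = p ^ n * q ^ m) : Subgroup.center G ≠ ⊥ := by
  have := Fact.mk hp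
  have := Fact.mk hq
  obtain ⟨P⟩ : Nonempty (Sylow q G) := inferInstance
  have hP : (P : Subgroup G).index ∣ p ^ n := by
    refine Nat.Coprime.dvd_of_dvd_mul_right (n := q ^ m) ?_
      (h ▸ (P : Subgroup G).index_dvd_card)
    exact Nat.Coprime.pow_right m ((Nat.Prime.coprime_iff_not_dvd hq).2 P.not_dvd_index).symm
  obtain hbot | hbot := subsingleton_or_nontrivial P
  · have h1 : (P : Subgroup G) = ⊥ := (Subgroup.eq_bot_iff_forall _).2 fun x hx =>
      congrArg Subtype.val (Subsingleton.elim (⟨x, hx⟩ : P) 1)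
    rw [h1, Subgroup.index_bot] at hP
    exact (IsPGroup.of_card_dvd_pow hP).bot_lt_center.ne'
  · have := P.isPGroup'.center_nontrivial
    obtain ⟨g, hg⟩ := exists_ne (1 : Subgroup.center P)
    have hg1 : ((g : P) : G) ≠ 1 := fun h2 => hg (Subtype.ext (Subtype.ext h2))
    have h3 := (ncard_setOf_isConj_dvd_index (g := ((g : P) : G)) (P := (P : Subgroup G))
      fun x hx => congrArg Subtype.val (Subgroup.mem_center_iff.1 g.2 ⟨x, hx⟩)).trans hP
    obtain ⟨c, -, hc⟩ := (Nat.dvd_prime_pow hp).1 h3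
    rw [Set.ncard_eq_toFinset_card _ (Set.toFinite _)] at hc
    exact center_ne_bot_of_card_eq_pow hg1 (fun x => (Set.Finite.mem_toFinset _)) hp hc

/-- Burnside's theorem on groups of order `p ^ n * q ^ m`. -/
theorem isSolvable_of_card_eq_pow_mul_pow (hp : p.Prime) (hq : q.Prime) (G : Type u) [Group G]
    {n m : ℕ} (h : Nat.card G = p ^ n * q ^ m) : Group.IsSolvable G := by
  induction hk : Nat.card G using Nat.strong_induction_on generalizing G n m with
  | _ k ih =>
    subst hk
    have : Finite G := Nat.finite_of_card_ne_zero (h ▸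
      mul_ne_zero (pow_ne_zero n hp.ne_zero) (pow_ne_zero m hq.ne_zero))
    obtain hG | hG := subsingleton_or_nontrivial G
    · infer_instance
    have key : ∀ N : Subgroup G, N.Normal → N ≠ ⊥ → N ≠ ⊤ → Group.IsSolvable G := by
      intro N hN hbot htop
      have hmul := N.card_mul_index
      have h1 : 1 < Nat.card N := (Subgroup.one_lt_card_iff_ne_bot N).2 hbot
      have h2 : 1 < N.index := lt_of_le_of_ne (Nat.pos_of_ne_zero Subgroup.FiniteIndex.index_ne_zero)
        fun h3 => htop (Subgroup.index_eq_one.1 h3.symm)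
      obtain ⟨a, b, hab⟩ := exists_eq_pow_mul_pow_of_dvd hp hq (h ▸ N.card_subgroup_dvd_card)
      obtain ⟨c, d, hcd⟩ := exists_eq_pow_mul_pow_of_dvd hp hq (h ▸ N.index_dvd_card)
      refine (Group.isSolvable_iff_subgroup_quotient N).2
        ⟨ih _ ?_ N hab rfl, ih _ ?_ (G ⧸ N) (N.index_eq_card ▸ hcd) rfl⟩
      · nlinarith
      · rw [← N.index_eq_card]
        nlinarith
    by_cases hs : ∃ N : Subgroup G, N.Normal ∧ N ≠ ⊥ ∧ N ≠ ⊤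
    · obtain ⟨N, hN, hbot, htop⟩ := hs
      exact key N hN hbot htop
    · have : IsSimpleGroup G := ⟨fun N hN => by
        by_contra! h0
        exact hs ⟨N, hN, h0⟩⟩
      have hc := ((inferInstance : (Subgroup.center G).Normal).eq_bot_or_eq_top).resolve_left
        (center_ne_bot_of_card_eq_pow_mul_pow hp hq h)
      exact Group.isSolvable_of_comm fun a b =>
        (Subgroup.mem_center_iff.1 (hc ▸ Subgroup.mem_top a : a ∈ Subgroup.center G) b).symm

end Burnside

/-! ### Closure properties of the two classes, and the conclusion. -/

theorem isClass_solvClass : GroupClass.IsClass solvClass.{u} where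
  finite _ _ h := h.1
  iso G H _ _ e h := by
    obtain ⟨h1, h2⟩ := h
    exact ⟨Finite.of_equiv G e.toEquiv, Group.isSolvable_of_surjective (f := e.toMonoidHom)
      e.surjective⟩
  subgroup G _ H h := by
    obtain ⟨h1, h2⟩ := h
    exact ⟨inferInstance, inferInstance⟩
  quotient G _ N _ h := by
    obtain ⟨h1, h2⟩ := h
    exact ⟨inferInstance, inferInstance⟩
  extension G _ N _ hN hG := by
    obtain ⟨h1, h2⟩ := hN
    obtain ⟨h3, h4⟩ := hG
    exact ⟨Finite.of_subgroup_quotient N, (Group.isSolvable_iff_subgroup_quotient N).2 ⟨h2, h4⟩⟩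

theorem isClass_pqClass {p q : ℕ} (hp : p.Prime) (hq : q.Prime) :
    GroupClass.IsClass (pqClass.{u} p q) where
  finite G _ h := by
    obtain ⟨n, m, h⟩ := h
    exact Nat.finite_of_card_ne_zero (h ▸
      mul_ne_zero (pow_ne_zero n hp.ne_zero) (pow_ne_zero m hq.ne_zero))
  iso G H _ _ e h := by
    obtain ⟨n, m, h⟩ := h
    exact ⟨n, m, (Nat.card_congr e.toEquiv).symm.trans h⟩
  subgroup G _ H h := by
    obtain ⟨n, m, h⟩ := h
    exact exists_eq_pow_mul_pow_of_dvd hp hq (h ▸ H.card_subgroup_dvd_card)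
  quotient G _ N _ h := by
    obtain ⟨n, m, h⟩ := h
    exact exists_eq_pow_mul_pow_of_dvd hp hq (h ▸ N.card_quotient_dvd_card)
  extension G _ N _ hN hG := by
    obtain ⟨n, m, h⟩ := hN
    obtain ⟨n', m', h'⟩ := hG
    refine ⟨n' + n, m' + m, ?_⟩
    rw [N.card_eq_card_quotient_mul_card_subgroup, h, h']
    ring

end

end CanonicalClass

theorem mainTheorem11 :
    CanonicalClass.GroupClass.IsCanonical CanonicalClass.solvClass.{u} ∧
    ∀ p q : ℕ, p.Prime → q.Prime →
      CanonicalClass.GroupClass.IsCanonical (CanonicalClass.pqClass.{u} p q) := by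
  refine ⟨CanonicalClass.isClass_solvClass.isCanonical ⟨inferInstance, inferInstance⟩
    fun _ _ h => h.2, fun p q hp hq => (CanonicalClass.isClass_pqClass hp hq).isCanonical
      ⟨0, 0, by simp⟩ fun G _ h => ?_⟩
  obtain ⟨n, m, h⟩ := h
  exact CanonicalClass.isSolvable_of_card_eq_pow_mul_pow hp hq G h
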